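/- All manifolds, metrics, maps and vector fields are of class $C^\infty$. Let $M$ be a Riemannian three-manifold with metric $g=\langle\cdot,\cdot\rangle$ and Levi-Civita connection $\nabla$, let $\xi$ be a unit Killing field on $M$ (that is, $\mathcal L_\xi g=0$ and $\|\xi\|=1$), and let $p\in M$. A totally geodesic surface through $p$ is an immersion $f:S\to M$ of a two-dimensional manifold $S$, with a chosen point $q\in S$ such that $f(q)=p$, whose shape operator $X\mapsto-\nabla_XN$ ($N$ a local unit normal field) vanishes identically; "tangent" and "orthogonal" at $p$ refer to the tangent plane $df(T_qS)$. Geodesics are non-constant and defined on an open interval, and "through $p$" means that $p$ is the value at some parameter in that interval. (1) $M$ admits a totally geodesic surface through $p$ which is everywhere orthogonal to $\xi$ if and only if some neighbourhood of $p$ in $M$ is isometric to a Riemannian product $\Sigma\times I$ of a Riemannian surface $\Sigma$ and an open interval $I$, with $\xi$ tangent to the factor $I$. (2) Choose an orientation of each tangent space of $M$ (for example those given by an orientation of $M$, if $M$ is oriented), and let $\times$ be the corresponding cross product. There is a unique function $\tau:M\to\mathbb R$ with $\nabla_X\xi=\tau(x)\,X\times\xi$ for all $x\in M$ and $X\in T_xM$.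 $M$ admits a totally geodesic surface through $p$ which is everywhere tangent to $\xi$ if and only if there is a geodesic of $M$ through $p$, orthogonal to $\xi$ at $p$, along which $\tau$ vanishes identically. (3) The following three assertions are equivalent. (i) $M$ admits a totally geodesic surface through $p$ which is neither orthogonal nor tangent to $\xi$ at $p$. (ii) On a neighbourhood of $p$ there are Killing fields $X_1,X_2$ without zeros such that $\xi=X_1+X_2$, $\langle X_1,X_2\rangle=0$ and $[X_1,X_2]=0$. (iii) There are local coordinates $(x,y,z)$ of $M$ around $p$ and a smooth function $\theta$ of the coordinate $x$ such that $$g=dx^2+\sin^2\theta(x)\,dy^2+\cos^2\theta(x)\,dz^2,\qquad \xi=\partial_y+\partial_z .$$ -/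

import Mathlib

open Set Filter Topology Bundle Manifold VectorField
open scoped ContDiff

namespace UnitKilling

noncomputable section

/-- The model space of three-manifolds. -/
abbrev E3 : Type := EuclideanSpace ℝ (Fin 3)

/-- The model space of surfaces. -/
abbrev E2 : Type := EuclideanSpace ℝ (Fin 2)

/-- The cross product of an oriented three-dimensional inner product space `V`: the vector `u × v`
with `⟨u × v, z⟩ = vol(u, v, z)` for all `z` (see `inner_cross`), written in an orthonormal
basis. -/
def cross {V : Type*} [NormedAddCommGroup V] [InnerProductSpace ℝ V]
    [h : Fact (Module.finrank ℝ V = 3)] (o : Orientation ℝ V (Fin 3)) (u v : V) : V :=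
  let b := o.finOrthonormalBasis (by norm_num) h.out
  ∑ i, o.volumeForm ![u, v, b i] • b i

theorem inner_cross {V : Type*} [NormedAddCommGroup V] [InnerProductSpace ℝ V]
    [h : Fact (Module.finrank ℝ V = 3)] (o : Orientation ℝ V (Fin 3)) (u v z : V) :
    inner ℝ (cross o u v) z = o.volumeForm ![u, v, z] := by
  set b := o.finOrthonormalBasis (by norm_num) h.out with hb
  have hz : (![u, v, z] : Fin 3 → V) =
      Function.update ![u, v, 0] 2 (∑ i, inner ℝ (b i) z • b i) := by
    rw [b.sum_repr' z]
    ext i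
    fin_cases i <;> simp [Function.update]
  have hu : ∀ w : V, Function.update ![u, v, 0] 2 w = (![u, v, w] : Fin 3 → V) := by
    intro w
    ext i
    fin_cases i <;> simp [Function.update]
  rw [hz, AlternatingMap.map_update_sum]
  simp only [cross, ← hb, sum_inner, real_inner_smul_left]
  refine Finset.sum_congr rfl fun i _ => ?_
  rw [AlternatingMap.map_update_smul, hu, smul_eq_mul, mul_comm]

/-- A smooth surface: a two-dimensional smooth manifold without boundary, Hausdorff and second
countable. Such a manifold has at most continuum many points, so `Type` loses no generality. -/
structure Surface where
  carrier : Type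
  [topologicalSpace : TopologicalSpace carrier]
  [t2Space : T2Space carrier]
  [secondCountableTopology : SecondCountableTopology carrier]
  [chartedSpace : ChartedSpace E2 carrier]
  [isManifold : IsManifold (𝓡 2) ∞ carrier]

instance : CoeSort Surface (Type) := ⟨Surface.carrier⟩

attribute [instance] Surface.topologicalSpace Surface.t2Space Surface.secondCountableTopology
  Surface.chartedSpace Surface.isManifold

instance {M : Type*} [TopologicalSpace M] [ChartedSpace E3 M] (x : M) :
    Fact (Module.finrank ℝ (TangentSpace (𝓡 3) x) = 3) :=
  ⟨finrank_euclideanSpace_fin (𝕜 := ℝ) (n := 3)⟩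

instance {M : Type*} [TopologicalSpace M] [ChartedSpace E3 M] (x : M) :
    FiniteDimensional ℝ (TangentSpace (𝓡 3) x) :=
  inferInstanceAs (FiniteDimensional ℝ E3)

section Manifold

variable {M : Type*} [TopologicalSpace M] [ChartedSpace E3 M] [IsManifold (𝓡 3) ∞ M]

/-- The vector field `V` is smooth on the set `U`. -/
def SmoothFieldOn (V : Π x : M, TangentSpace (𝓡 3) x) (U : Set M) : Prop :=
  ContMDiffOn (𝓡 3) (𝓡 3).tangent ∞ (fun x => (⟨x, V x⟩ : TangentBundle (𝓡 3) M)) U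

variable [RiemannianBundle (fun x : M => TangentSpace (𝓡 3) x)]

/-- The derivative `X⟨Y, Z⟩` at the point `x`. -/
def derivInner (X Y Z : Π x : M, TangentSpace (𝓡 3) x) (x : M) : ℝ :=
  mvfderiv (𝓡 3) (fun y => inner ℝ (Y y) (Z y)) x (X x)

/-- `X` is a (smooth) Killing field on the open set `U`: the Lie derivative of the metric,
`(L_X g)(Y, Z) = X⟨Y, Z⟩ - ⟨[X, Y], Z⟩ - ⟨Y, [X, Z]⟩`, vanishes on `U`. -/
def IsKillingOn (X : Π x : M, TangentSpace (𝓡 3) x) (U : Set M) : Prop :=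
  SmoothFieldOn X U ∧
    ∀ (Y Z : Π x : M, TangentSpace (𝓡 3) x) (W : Set M), IsOpen W → W ⊆ U →
      SmoothFieldOn Y W → SmoothFieldOn Z W → ∀ x ∈ W,
        derivInner X Y Z x - inner ℝ (mlieBracket (𝓡 3) X Y x) (Z x)
          - inner ℝ (Y x) (mlieBracket (𝓡 3) X Z x) = 0

/-- The right-hand side of Koszul's formula for `2⟨∇_X Y, Z⟩`. -/
def koszul (X Y Z : Π x : M, TangentSpace (𝓡 3) x) (x : M) : ℝ :=
  derivInner X Y Z x + derivInner Y X Z x - derivInner Z X Y x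
    + inner ℝ (mlieBracket (𝓡 3) X Y x) (Z x)
    - inner ℝ (mlieBracket (𝓡 3) X Z x) (Y x)
    - inner ℝ (mlieBracket (𝓡 3) Y Z x) (X x)

/-- The Levi-Civita connection: `nabla Y x v` is `∇_v Y` for a vector `v` tangent at `x` and a
vector field `Y` that is differentiable at `x`. It is the vector whose inner product with `z` is
half of Koszul's expression for arbitrary local extensions of `v` and `z`, written in an
orthonormal basis of the tangent space. -/
def nabla (Y : Π x : M, TangentSpace (𝓡 3) x) (x : M) (v : TangentSpace (𝓡 3) x) :
    TangentSpace (𝓡 3) x :=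
  let b := stdOrthonormalBasis ℝ (TangentSpace (𝓡 3) x)
  ∑ i, (koszul (FiberBundle.extend E3 v) Y (FiberBundle.extend E3 (b i)) x / 2) • b i

/-- The function `τ` of a unit Killing field `ξ`, with respect to orientations `o x` of the tangent
spaces: `∇_X ξ = τ (X × ξ)` for all tangent vectors `X`. -/
def IsTau (o : Π x : M, Orientation ℝ (TangentSpace (𝓡 3) x) (Fin 3))
    (ξ : Π x : M, TangentSpace (𝓡 3) x) (τ : M → ℝ) : Prop :=
  ∀ (x : M) (X : TangentSpace (𝓡 3) x), nabla ξ x X = τ x • cross (o x) X (ξ x)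

/-- The velocity of a curve. -/
def velocity (γ : ℝ → M) (s : ℝ) : TangentSpace (𝓡 3) (γ s) :=
  mfderiv 𝓘(ℝ, ℝ) (𝓡 3) γ s (1 : ℝ)

/-- `γ` is a geodesic on the open interval `(a, b)`, i.e. it is smooth and `∇_{γ'} γ' = 0`, the
covariant derivative being computed with local extensions `V` of the velocity field. (A geodesic
is constant or an immersion, so that such extensions exist.) -/
def IsGeodesicOn (γ : ℝ → M) (a b : ℝ) : Prop :=
  ContMDiffOn 𝓘(ℝ, ℝ) (𝓡 3) ∞ γ (Ioo a b) ∧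
    ∀ s ∈ Ioo a b, ∃ (U : Set M) (V : Π x : M, TangentSpace (𝓡 3) x),
      IsOpen U ∧ γ s ∈ U ∧ SmoothFieldOn V U ∧ (∀ᶠ r in 𝓝 s, V (γ r) = velocity γ r) ∧
        nabla V (γ s) (velocity γ s) = 0

/-- `f` is a totally geodesic immersion of the surface `S` into `M`: a smooth immersion whose shape
operator `X ↦ -∇_{df X} N` vanishes at every point `q`. Here `N` is a local unit normal field of
the immersion around `q`, extended to a smooth vector field on a neighbourhood of `f q`. -/
def IsTotallyGeodesic {S : Surface} (f : S → M) : Prop :=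
  ContMDiff (𝓡 2) (𝓡 3) ∞ f ∧
  (∀ q, Function.Injective (mfderiv (𝓡 2) (𝓡 3) f q)) ∧
  ∀ q, ∃ (U : Set M) (N : Π x : M, TangentSpace (𝓡 3) x),
    IsOpen U ∧ f q ∈ U ∧ SmoothFieldOn N U ∧
    (∀ᶠ r in 𝓝 q, ‖N (f r)‖ = 1 ∧
      ∀ v : TangentSpace (𝓡 2) r, inner ℝ (N (f r)) (mfderiv (𝓡 2) (𝓡 3) f r v) = 0) ∧
    ∀ v : TangentSpace (𝓡 2) q, nabla N (f q) (mfderiv (𝓡 2) (𝓡 3) f q v) = 0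

/-- The vector field `ξ` is tangent to the immersion `f` at `q`. -/
def TangentAt {S : Surface} (f : S → M) (ξ : Π x : M, TangentSpace (𝓡 3) x) (q : S) : Prop :=
  ∃ v : TangentSpace (𝓡 2) q, mfderiv (𝓡 2) (𝓡 3) f q v = ξ (f q)

/-- The vector field `ξ` is orthogonal to the immersion `f` at `q`. -/
def OrthogonalAt {S : Surface} (f : S → M) (ξ : Π x : M, TangentSpace (𝓡 3) x) (q : S) : Prop :=
  ∀ v : TangentSpace (𝓡 2) q, inner ℝ (ξ (f q)) (mfderiv (𝓡 2) (𝓡 3) f q v) = 0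

/-- A neighbourhood of `p` is isometric, by a diffeomorphism `Φ`, to the Riemannian product of a
Riemannian surface `(S, h)` and an open interval `(a, b)`, and `ξ` is tangent to the interval
factor. -/
def IsLocalProductAt (ξ : Π x : M, TangentSpace (𝓡 3) x) (p : M) : Prop :=
  ∃ (S : Surface)
    (h : ContMDiffRiemannianMetric (𝓡 2) ∞ E2 (fun q : S => TangentSpace (𝓡 2) q))
    (a b : ℝ) (Φ : OpenPartialHomeomorph (S × ℝ) M),
    Φ.source = univ ×ˢ Ioo a b ∧ p ∈ Φ.target ∧
    ContMDiffOn ((𝓡 2).prod 𝓘(ℝ, ℝ)) (𝓡 3) ∞ Φ Φ.source ∧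
    ContMDiffOn (𝓡 3) ((𝓡 2).prod 𝓘(ℝ, ℝ)) ∞ Φ.symm Φ.target ∧
    (∀ y ∈ Φ.source, ∀ (v w : TangentSpace (𝓡 2) y.1) (s t : ℝ),
      inner ℝ (mfderiv ((𝓡 2).prod 𝓘(ℝ, ℝ)) (𝓡 3) Φ y (v, s))
        (mfderiv ((𝓡 2).prod 𝓘(ℝ, ℝ)) (𝓡 3) Φ y (w, t)) = h.inner y.1 v w + s * t) ∧
    ∀ y ∈ Φ.source, ∃ c : ℝ,
      ξ (Φ y) = mfderiv ((𝓡 2).prod 𝓘(ℝ, ℝ)) (𝓡 3) Φ y ((0 : TangentSpace (𝓡 2) y.1), c)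

/-- On a neighbourhood of `p`, `ξ` is the sum of two commuting Killing fields without zeros that are
orthogonal to each other. -/
def HasKillingDecompositionAt (ξ : Π x : M, TangentSpace (𝓡 3) x) (p : M) : Prop :=
  ∃ (U : Set M) (X₁ X₂ : Π x : M, TangentSpace (𝓡 3) x),
    IsOpen U ∧ p ∈ U ∧ IsKillingOn X₁ U ∧ IsKillingOn X₂ U ∧
    ∀ x ∈ U, ξ x = X₁ x + X₂ x ∧ inner ℝ (X₁ x) (X₂ x) = 0 ∧ X₁ x ≠ 0 ∧ X₂ x ≠ 0 ∧
      mlieBracket (𝓡 3) X₁ X₂ x = 0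

/-- There are local coordinates `(x, y, z)` around `p`, given by a smooth chart `e`, and a smooth
function `θ` of `x` with `g = dx² + sin² θ(x) dy² + cos² θ(x) dz²` and `ξ = ∂_y + ∂_z`.
The differential of `e.symm` at `u` sends the `i`-th standard basis vector to the `i`-th coordinate
vector field at `e.symm u`. -/
def HasAdaptedCoordinatesAt (ξ : Π x : M, TangentSpace (𝓡 3) x) (p : M) : Prop :=
  ∃ e ∈ IsManifold.maximalAtlas (𝓡 3) ∞ M, ∃ θ : ℝ → ℝ,
    p ∈ e.source ∧ ContDiffOn ℝ ∞ θ ((fun u : E3 => u 0) '' e.target) ∧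
    (∀ u ∈ e.target, ∀ v w : E3,
      inner ℝ (mfderiv (𝓡 3) (𝓡 3) e.symm u v) (mfderiv (𝓡 3) (𝓡 3) e.symm u w) =
        v 0 * w 0 + Real.sin (θ (u 0)) ^ 2 * (v 1 * w 1)
          + Real.cos (θ (u 0)) ^ 2 * (v 2 * w 2)) ∧
    ∀ u ∈ e.target, ξ (e.symm u) =
      mfderiv (𝓡 3) (𝓡 3) e.symm u (EuclideanSpace.single 1 1 : E3)
        + mfderiv (𝓡 3) (𝓡 3) e.symm u (EuclideanSpace.single 2 1 : E3)

end Manifold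

end

end UnitKilling

open UnitKilling

set_option linter.unusedSectionVars false

/-! Everything is local and is computed in charts through `covForm`, which is twice `⟨∇_v Y, w⟩` in
terms of the metric and its first derivatives (`two_inner_nabla`). For a Killing field this form is
skew in `v`, `w`; for the unit Killing field `ξ` it also vanishes as soon as one of them is `ξ`. In
dimension three the skew maps that kill `ξ` form a line, spanned by the cross product with `ξ`, and
this yields `τ`. In a flow box of `ξ` the metric does not depend on the flow coordinate, so facts
known on one slice spread to all its translates.

Assertion (1): on a surface orthogonal to `ξ`, the form `⟨∇_v ξ, w⟩` is skew by the Killing equation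
and symmetric because, up to sign, it is the second fundamental form; hence `ξ` is parallel there
(`nabla_eq_zero_of_orthogonal`). So slices of a product are totally geodesic. Conversely, the flow
box over an orthogonal surface is a product, since the metric is invariant and its mixed terms
vanish (`isLocalProductAt_of_chart`).

Assertion (2): on a totally geodesic surface tangent to `ξ`, let `Y` be a unit tangent field
orthogonal to `ξ`. The components of `∇_Y ξ` along `Y`, `ξ` and the normal vanish, and then so do
those of `∇_Y Y`. Integral curves of `Y` are thus geodesics along which `τ = 0`
(`exists_geodesic_of_tangent`). Conversely, the flow of `ξ` sweeps a surface out of such a geodesic.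
Its second fundamental form vanishes along the geodesic, hence everywhere by invariance
(`exists_tangent_surface_of_geodesic`).

Assertion (3): the flow of `ξ` moves a transversal totally geodesic surface through a family of such
surfaces. The parts of `ξ` normal and tangent to the family are the two Killing fields
(`covForm_normalField_skew`). Given the two fields, a unit field orthogonal to both completes them
to a commuting frame, hence to coordinates. The metric coefficients depend on `x` alone, and `‖ξ‖ =
1` makes two of them add up to `1`, so that they are a squared sine and cosine. In such coordinates
the planes `z = const` are totally geodesic.

Two analytic tools are built on the way: smooth local flows (`exists_smooth_flow`), from the
implicit function theorem on a space of curves, and the rectification of commuting frames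
(`exists_coordinates_of_commuting_frame`), from the Poincaré lemma. -/

namespace UnitKilling

noncomputable section

set_option synthInstance.maxHeartbeats 200000

/-! ### Smoothness of post-composition on spaces of continuous maps -/

section Nemytskii

variable {K : Type*} [TopologicalSpace K] [CompactSpace K]
  {E F : Type*} [NormedAddCommGroup E] [NormedSpace ℝ E] [NormedAddCommGroup F] [NormedSpace ℝ F]

/-- Pointwise application of a continuous family of operators to a continuous family of vectors. -/
def pointwiseApply : C(K, E →L[ℝ] F) →L[ℝ] C(K, E) →L[ℝ] C(K, F) :=
  LinearMap.mkContinuous₂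
    (LinearMap.mk₂ ℝ (fun (A : C(K, E →L[ℝ] F)) (h : C(K, E)) =>
      (⟨fun k => A k (h k), by fun_prop⟩ : C(K, F)))
      (fun _ _ _ => by ext; simp) (fun _ _ _ => by ext; simp)
      (fun _ _ _ => by ext; simp) (fun _ _ _ => by ext; simp)) 1
    (fun A h => by
      rw [one_mul]
      refine (ContinuousMap.norm_le _ (by positivity)).2 fun k => ?_
      exact (A k).le_of_opNorm_le_of_le (A.norm_coe_le_norm k) (h.norm_coe_le_norm k))

/-- Since `β ↦ f' ∘ β` is continuous in the sup norm, `f'` varies by at most `c` on balls of one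
common radius around all the points `α k`. The mean value inequality then gives an error bound
uniform in `k`. -/
theorem hasFDerivAt_postcomp (f : C(E, F)) (f' : C(E, E →L[ℝ] F))
    (hf : ∀ x, HasFDerivAt f (f' x) x) (α : C(K, E)) :
    HasFDerivAt (fun β : C(K, E) => f.comp β) (pointwiseApply (f'.comp α)) α := by
  refine .of_isLittleO (Asymptotics.isLittleO_iff.2 fun c hc => ?_)
  have hcont : Continuous fun β : C(K, E) => f'.comp β := ContinuousMap.continuous_postcomp f'
  obtain ⟨δ, hδ, hball⟩ := (Metric.continuousAt_iff (a := α)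
    (f := fun β : C(K, E) => f'.comp β)).1 hcont.continuousAt c hc
  have key : ∀ k : K, ∀ y ∈ Metric.ball (α k) δ, ‖f' y - f' (α k)‖ ≤ c := by
    intro k y hy
    -- Shifting `α` by a constant makes it pass through `y` at `k`, which turns a sup-norm estimate
    -- into a pointwise one.
    have h1 : dist (α + ContinuousMap.const K (y - α k)) α < δ := by
      rw [dist_eq_norm, add_sub_cancel_left]
      refine lt_of_le_of_lt ?_ (mem_ball_iff_norm.1 hy)
      exact (ContinuousMap.norm_le _ (norm_nonneg _)).2 fun _ => le_rfl
    have h2 := ((ContinuousMap.dist_lt_iff hc).1 (hball h1) k).le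
    simpa [dist_eq_norm] using h2
  filter_upwards [Metric.ball_mem_nhds α hδ] with β hβ
  refine (ContinuousMap.norm_le _ (by positivity)).2 fun k => ?_
  have hk : β k ∈ Metric.ball (α k) δ :=
    lt_of_le_of_lt (ContinuousMap.dist_apply_le_dist k) hβ
  have := (convex_ball (α k) δ).norm_image_sub_le_of_norm_hasFDerivWithin_le'
    (fun x _ => (hf x).hasFDerivWithinAt) (key k) (Metric.mem_ball_self hδ) hk
  refine this.trans ?_
  gcongr
  exact (β - α).norm_coe_le_norm k

end Nemytskii

universe u v

/-- The derivative of post-composition with `f` is post-composition with `f'` followed by the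
continuous linear map `pointwiseApply`. The induction therefore has to let the target `F` vary. -/
theorem contDiff_postcomp_nat {K : Type u} [TopologicalSpace K] [CompactSpace K] {E : Type v}
    [NormedAddCommGroup E] [NormedSpace ℝ E] (n : ℕ) :
    ∀ {F : Type v} [NormedAddCommGroup F] [NormedSpace ℝ F] (f : C(E, F)), ContDiff ℝ n f →
      ContDiff ℝ n (fun β : C(K, E) => f.comp β) := by
  induction n with
  | zero =>
    intro F _ _ f _
    exact contDiff_zero.2 (ContinuousMap.continuous_postcomp f)
  | succ n ih =>
    intro F _ _ f hf
    have hf' : ContDiff ℝ n (fderiv ℝ f) := hf.fderiv_right le_rfl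
    let f' : C(E, E →L[ℝ] F) := ⟨fderiv ℝ f, hf'.continuous⟩
    refine (contDiff_succ_iff_hasFDerivAt (n := n)).2
      ⟨fun α => pointwiseApply (f'.comp α), ?_, fun α => ?_⟩
    · exact pointwiseApply.contDiff.comp (ih f' hf')
    · exact hasFDerivAt_postcomp f f'
        (fun x => (hf.differentiable (by simp) x).hasFDerivAt) α

theorem contDiff_postcomp {K : Type u} [TopologicalSpace K] [CompactSpace K] {E F : Type v}
    [NormedAddCommGroup E] [NormedSpace ℝ E] [NormedAddCommGroup F] [NormedSpace ℝ F]
    (f : C(E, F)) (hf : ContDiff ℝ ∞ f) :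
    ContDiff ℝ ∞ (fun β : C(K, E) => f.comp β) :=
  contDiff_infty.2 fun n => contDiff_postcomp_nat n f (contDiff_infty.1 hf n)

/-! ### Smooth local flows of vector fields -/

section Flow

variable {E : Type v} [NormedAddCommGroup E] [NormedSpace ℝ E]

/-- The time interval `[-1, 1]`. -/
abbrev TimeInterval : Type := Icc (-1 : ℝ) 1

theorem continuous_extend_time {E : Type*} [NormedAddCommGroup E] (α : C(TimeInterval, E)) :
    Continuous fun s : ℝ => α (projIcc (-1) 1 (by norm_num) s) :=
  α.continuous.comp continuous_projIcc

/-- The primitive vanishing at time `0`. -/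
def primitive : C(TimeInterval, E) →L[ℝ] C(TimeInterval, E) :=
  LinearMap.mkContinuous
    { toFun := fun α => ⟨fun t => ∫ s in (0 : ℝ)..t, α (projIcc (-1) 1 (by norm_num) s),
        (intervalIntegral.continuous_primitive
          (fun _ _ => (continuous_extend_time α).intervalIntegrable _ _) 0).comp
          continuous_subtype_val⟩
      map_add' := fun α β => by
        ext t
        exact intervalIntegral.integral_add ((continuous_extend_time α).intervalIntegrable _ _)
          ((continuous_extend_time β).intervalIntegrable _ _)
      map_smul' := fun c α => by
        ext t
        exact intervalIntegral.integral_smul c _ } 1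
    (fun α => by
      refine (ContinuousMap.norm_le _ (by positivity)).2 fun t => ?_
      have h := intervalIntegral.norm_integral_le_of_norm_le_const (a := 0) (b := (t : ℝ))
        (C := ‖α‖) (f := fun s => α (projIcc (-1) 1 (by norm_num) s))
        fun s _ => α.norm_coe_le_norm _
      have ht : |(t : ℝ) - 0| ≤ 1 := by rw [sub_zero]; exact abs_le.2 t.2
      refine h.trans ?_
      nlinarith [norm_nonneg α])

theorem primitive_apply (α : C(TimeInterval, E)) (t : TimeInterval) :
    primitive α t = ∫ s in (0 : ℝ)..t, α (projIcc (-1) 1 (by norm_num) s) := rfl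

/-- Rescaling of time by `c ∈ [-1, 1]`. -/
def rescale (c : TimeInterval) : C(TimeInterval, TimeInterval) :=
  ⟨fun t => ⟨c * t, abs_le.1 (by
    rw [abs_mul]; exact mul_le_one₀ (abs_le.2 c.2) (abs_nonneg _) (abs_le.2 t.2))⟩, by fun_prop⟩

/-- Substitution `r = c s` in the integral. This is the scaling symmetry behind the relation between
flow times `s` and `c s`. -/
theorem primitive_comp_rescale (α : C(TimeInterval, E)) (c : TimeInterval) :
    (c : ℝ) • primitive (α.comp (rescale c)) = (primitive α).comp (rescale c) := by
  ext t
  simp only [ContinuousMap.smul_apply, ContinuousMap.comp_apply, primitive_apply]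
  have h : ∀ s ∈ uIcc (0 : ℝ) t, α (rescale c (projIcc (-1) 1 (by norm_num) s)) =
      (fun r => α (projIcc (-1) 1 (by norm_num) r)) (c * s) := by
    intro s hs
    have hs' : s ∈ Icc (-1 : ℝ) 1 :=
      (uIcc_subset_Icc (by norm_num) t.2 : uIcc (0 : ℝ) t ⊆ _) hs
    have : (rescale c (projIcc (-1) 1 (by norm_num) s)) =
        projIcc (-1) 1 (by norm_num) (c * s) := by
      rw [projIcc_of_mem _ hs']
      exact (projIcc_of_mem _ (rescale c ⟨s, hs'⟩).2).symm
    simp only [this]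
  rw [intervalIntegral.integral_congr h]
  have h2 := intervalIntegral.smul_integral_comp_mul_left (a := 0) (b := (t : ℝ))
    (fun r => α (projIcc (-1) 1 (by norm_num) r)) (c : ℝ)
  rw [mul_zero] at h2
  exact h2

variable [CompleteSpace E]

/-- An implicit function of a smooth equation is smooth near the base point. -/
theorem eventually_contDiffAt_implicitFunction {E₁ E₂ F : Type*}
    [NormedAddCommGroup E₁] [NormedSpace ℝ E₁] [CompleteSpace E₁]
    [NormedAddCommGroup E₂] [NormedSpace ℝ E₂] [CompleteSpace E₂]
    [NormedAddCommGroup F] [NormedSpace ℝ F] [CompleteSpace F]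
    {H : E₁ × E₂ → F} (hH : ContDiff ℝ ∞ H) {u : E₁ × E₂} {A : E₁ → E₂}
    (hinv : (fderiv ℝ H u ∘L .inr ℝ E₁ E₂).IsInvertible)
    (hAc : ∀ᶠ z in 𝓝 u.1, ContinuousAt A z) (hAu : A u.1 = u.2)
    (hA1 : ∀ᶠ z in 𝓝 u.1, H (z, A z) = H u) (hA2 : ∀ᶠ v in 𝓝 u, H v = H u → A v.1 = v.2) :
    ∀ᶠ z in 𝓝 u.1, ContDiffAt ℝ ∞ A z := by
  have hn : (∞ : WithTop ℕ∞) ≠ 0 := by simp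
  have hT : ContinuousAt (fun z => (z, A z)) u.1 := continuousAt_id.prodMk hAc.self_of_nhds
  have hTu : (u.1, A u.1) = u := by simp only [hAu]
  have hI : ∀ᶠ v in 𝓝 u, (fderiv ℝ H v ∘L .inr ℝ E₁ E₂).IsInvertible := by
    have hc : ContinuousAt (fun v => fderiv ℝ H v ∘L .inr ℝ E₁ E₂) u := by
      have := (hH.continuous_fderiv hn).continuousAt (x := u)
      exact this.clm_comp continuousAt_const
    obtain ⟨b, hb⟩ := hinv
    refine hc.eventually ?_
    beta_reduce
    rw [← hb]
    filter_upwards [ContinuousLinearEquiv.nhds b] with C ⟨c, hc⟩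
    exact ⟨c, hc⟩
  rw [ContinuousAt, hTu] at hT
  filter_upwards [hAc, hA1, hT.eventually hI, hT.eventually (eventually_eventually_nhds.2 hA2)]
    with z h1 h2 h3 h4
  -- `ContDiffAt ℝ ∞` at the base point yields a neighbourhood for each finite order but no common
  -- one. The implicit function theorem is therefore applied afresh at each nearby `(z, A z)`, and
  -- local uniqueness identifies the new solution with `A`.
  have hHz : ContDiffAt ℝ ∞ H (z, A z) := hH.contDiffAt
  have hC : ContDiffAt ℝ ∞ (hHz.implicitFunction hn h3) z := hHz.contDiffAt_implicitFunction hn h3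
  refine hC.congr_of_eventuallyEq ?_
  have h5 : hHz.implicitFunction hn h3 z = A z := hHz.implicitFunction_apply_self hn h3
  have h6 : Tendsto (fun y => (y, hHz.implicitFunction hn h3 y)) (𝓝 z) (𝓝 (z, A z)) := by
    have := (continuousAt_id (x := z)).prodMk hC.continuousAt
    rw [ContinuousAt, h5] at this
    exact this
  filter_upwards [hHz.eventually_apply_implicitFunction hn h3, h6.eventually h4] with y hy1 hy2
  exact hy2 (hy1.trans h2)

/-- A globally smooth vector field on a Banach space has a smooth local flow. -/
theorem exists_smooth_flow_of_contDiff (f : E → E) (hf : ContDiff ℝ ∞ f) (x₀ : E) :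
    ∃ φ : E × ℝ → E, (∀ᶠ z in 𝓝 (x₀, (0 : ℝ)), ContDiffAt ℝ ∞ φ z) ∧
      ∀ᶠ z in 𝓝 (x₀, (0 : ℝ)), φ (z.1, 0) = z.1 ∧
        HasDerivAt (fun t => φ (z.1, t)) (f (φ z)) z.2 := by
  let fc : C(E, E) := ⟨f, hf.continuous⟩
  let constL : E →L[ℝ] C(TimeInterval, E) := ContinuousLinearMap.const ℝ TimeInterval
  -- A zero `((x, s), β)` is the trajectory from `x` with time rescaled, `β t = φ (x, s t)` for `t ∈
  -- [-1, 1]`. At `s = 0` the derivative in `β` is the identity.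
  let H : (E × ℝ) × C(TimeInterval, E) → C(TimeInterval, E) := fun z =>
    z.2 - constL z.1.1 - z.1.2 • primitive (fc.comp z.2)
  let u : (E × ℝ) × C(TimeInterval, E) := ((x₀, 0), constL x₀)
  have hH : ContDiff ℝ ∞ H := by
    have h1 := (contDiff_postcomp (K := TimeInterval) fc hf)
    have h2 : ContDiff ℝ ∞ fun z : (E × ℝ) × C(TimeInterval, E) =>
      primitive (fc.comp z.2) := primitive.contDiff.comp (h1.comp contDiff_snd)
    have h3 : ContDiff ℝ ∞ fun z : (E × ℝ) × C(TimeInterval, E) => constL z.1.1 :=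
      constL.contDiff.comp (contDiff_fst.comp contDiff_fst)
    exact (contDiff_snd.sub h3).sub ((contDiff_snd.comp contDiff_fst).smul h2)
  have hHu : H u = 0 := by simp [H, u]
  have hinv : (fderiv ℝ H u ∘L .inr ℝ (E × ℝ) C(TimeInterval, E)).IsInvertible := by
    have h1 : HasFDerivAt (fun β => H ((x₀, 0), β))
        (fderiv ℝ H u ∘L .inr ℝ (E × ℝ) C(TimeInterval, E)) (constL x₀) :=
      (hH.differentiable (by simp) u).hasFDerivAt.comp (constL x₀)
        (hasFDerivAt_prodMk_right (x₀, (0 : ℝ)) (constL x₀))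
    have h2 : HasFDerivAt (fun β => H ((x₀, 0), β))
        (ContinuousLinearMap.id ℝ C(TimeInterval, E)) (constL x₀) := by
      have : (fun β => H ((x₀, 0), β)) = fun β => β - constL x₀ := by
        ext β : 1
        simp [H]
      rw [this]
      exact (hasFDerivAt_id _).sub_const _
    rw [h1.unique h2]
    exact ⟨ContinuousLinearEquiv.refl ℝ _, rfl⟩
  have hn : (∞ : WithTop ℕ∞) ≠ 0 := by simp
  have hHA : ContDiffAt ℝ ∞ H u := hH.contDiffAt
  let A := hHA.implicitFunction hn hinv
  have hA : ContDiffAt ℝ ∞ A (x₀, 0) := hHA.contDiffAt_implicitFunction hn hinv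
  have hAu : A (x₀, 0) = constL x₀ := hHA.implicitFunction_apply_self hn hinv
  have hA1 : ∀ᶠ z in 𝓝 (x₀, (0 : ℝ)), H (z, A z) = 0 := by
    simpa [hHu] using! hHA.eventually_apply_implicitFunction hn hinv
  have hA2 : ∀ᶠ v in 𝓝 u, H v = 0 → A v.1 = v.2 := by
    filter_upwards [hHA.eventually_apply_eq_iff_implicitFunction hn hinv] with v hv h
    exact hv.1 (h.trans hHu.symm)
  let one : TimeInterval := ⟨1, by norm_num, le_rfl⟩
  -- uniqueness in a product neighbourhood
  obtain ⟨r, hr, hr2⟩ := Metric.eventually_nhds_iff_ball.1 hA2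
  have hAc : ∀ᶠ z in 𝓝 (x₀, (0 : ℝ)), dist (A z) (constL x₀) < r := by
    have := hA.continuousAt
    rw [ContinuousAt, hAu] at this
    exact this (Metric.ball_mem_nhds _ hr)
  have hz : ∀ᶠ z in 𝓝 (x₀, (0 : ℝ)), dist z (x₀, (0 : ℝ)) < r := Metric.ball_mem_nhds _ hr
  -- The rescaled curve solves the equation with time parameter `c * z.2` and stays in the ball
  -- where solutions are unique. This trades the parameter `s` at `t = 1` for the time `t` at a
  -- fixed `s`.
  have hscale : ∀ᶠ z in 𝓝 (x₀, (0 : ℝ)), ∀ c : TimeInterval,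
      A (z.1, c * z.2) = (A z).comp (rescale c) := by
    filter_upwards [hA1, hAc, hz] with z h1 h2 h3 c
    refine hr2 ((z.1, c * z.2), (A z).comp (rescale c)) ?_ ?_
    · rw [Metric.mem_ball, Prod.dist_eq]
      refine max_lt ?_ ?_
      · rw [Prod.dist_eq] at h3 ⊢
        refine lt_of_le_of_lt (max_le_max le_rfl ?_) h3
        change dist (c * z.2) 0 ≤ dist z.2 0
        rw [dist_zero_right, dist_zero_right, norm_mul, Real.norm_eq_abs, Real.norm_eq_abs]
        exact mul_le_of_le_one_left (abs_nonneg _) (abs_le.2 c.2)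
      · refine lt_of_le_of_lt ?_ h2
        refine (ContinuousMap.dist_le dist_nonneg).2 fun t => ?_
        exact ContinuousMap.dist_apply_le_dist (f := A z) (g := constL x₀) (rescale c t)
    · have h4 : H (z, A z) = A z - constL z.1 - z.2 • primitive (fc.comp (A z)) := rfl
      have h5 : (A z - constL z.1 - z.2 • primitive (fc.comp (A z))).comp (rescale c) = 0 := by
        rw [← h4, h1]; rfl
      have h6 := primitive_comp_rescale (fc.comp (A z)) c
      ext t
      have h7 := congrArg (fun γ : C(TimeInterval, E) => γ t) h5
      have h8 := congrArg (fun γ : C(TimeInterval, E) => γ t) h6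
      simp only [ContinuousMap.comp_apply, ContinuousMap.sub_apply, ContinuousMap.smul_apply,
        ContinuousMap.zero_apply] at h7 h8
      simp only [H, ContinuousMap.comp_apply, ContinuousMap.sub_apply, ContinuousMap.smul_apply,
        ContinuousMap.zero_apply, mul_smul]
      rw [smul_comm, ← ContinuousMap.comp_assoc, h8]
      exact h7
  refine ⟨fun z => A z one, ?_, ?_⟩
  · have hAc : ∀ᶠ z in 𝓝 (x₀, (0 : ℝ)), ContinuousAt A z := by
      filter_upwards [(hA.of_le (m := 1) (by simp)).eventually (by simp)] with z hz
      exact hz.continuousAt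
    filter_upwards [eventually_contDiffAt_implicitFunction (u := u) hH hinv hAc hAu
      (by rwa [hHu]) (by rwa [hHu])] with z hz
    exact (ContinuousMap.evalCLM ℝ one).contDiff.contDiffAt.comp _ hz
  · obtain ⟨ρ, hρ, hρ2⟩ := Metric.eventually_nhds_iff_ball.1 (hA1.and hscale)
    filter_upwards [Metric.ball_mem_nhds (x₀, (0 : ℝ)) (half_pos hρ)] with z hz
    rw [Metric.mem_ball, Prod.dist_eq, max_lt_iff, dist_zero_right, Real.norm_eq_abs] at hz
    obtain ⟨hz1, hz2⟩ := hz
    have hmem : ∀ t : ℝ, |t| ≤ ρ / 2 → (z.1, t) ∈ Metric.ball (x₀, (0 : ℝ)) ρ := by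
      intro t ht
      rw [Metric.mem_ball, Prod.dist_eq, max_lt_iff, dist_zero_right, Real.norm_eq_abs]
      exact ⟨by linarith, by simp only; linarith⟩
    have hε : (0 : ℝ) < ρ / 2 := half_pos hρ
    constructor
    · have h0 := congrArg (fun γ : C(TimeInterval, E) => γ one)
        (hρ2 (z.1, 0) (hmem 0 (by rw [abs_zero]; exact hε.le))).1
      simp only [H, zero_smul, sub_zero, ContinuousMap.sub_apply, ContinuousMap.zero_apply] at h0
      exact sub_eq_zero.1 h0
    · obtain ⟨h1, h2⟩ := hρ2 (z.1, ρ / 2) (hmem _ (abs_of_pos hε).le)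
      -- One curve contains all the flow values for times below `ρ / 2`; the differential equation
      -- then follows from the fundamental theorem of calculus.
      set B := A (z.1, ρ / 2) with hB
      have hval : ∀ t : ℝ, (ht : |t| < ρ / 2) →
          A (z.1, t) one = B (projIcc (-1) 1 (by norm_num) (t / (ρ / 2))) := by
        intro t ht
        have hc : t / (ρ / 2) ∈ Icc (-1 : ℝ) 1 := by
          rw [mem_Icc, ← abs_le, abs_div, abs_of_pos hε, div_le_one hε]
          exact ht.le
        have h3 := h2 ⟨t / (ρ / 2), hc⟩
        simp only [div_mul_cancel₀ _ hε.ne'] at h3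
        rw [h3, projIcc_of_mem _ hc]
        simp only [ContinuousMap.comp_apply]
        congr 1
        exact Subtype.ext (mul_one _)
      have hAint : ∀ t : ℝ, (ht : |t| < ρ / 2) → A (z.1, t) one =
          z.1 + (ρ / 2) • ∫ s in (0 : ℝ)..(t / (ρ / 2)),
            f (B (projIcc (-1) 1 (by norm_num) s)) := by
        intro t ht
        have hc : t / (ρ / 2) ∈ Icc (-1 : ℝ) 1 := by
          rw [mem_Icc, ← abs_le, abs_div, abs_of_pos hε, div_le_one hε]
          exact ht.le
        have h4 := congrArg (fun γ : C(TimeInterval, E) => γ ⟨t / (ρ / 2), hc⟩) h1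
        simp only [H, ContinuousMap.sub_apply, ContinuousMap.smul_apply, primitive_apply,
          ContinuousMap.zero_apply] at h4
        rw [hval t ht, projIcc_of_mem _ hc, eq_comm, ← sub_eq_zero, ← neg_eq_zero]
        rw [← h4]
        simp only [fc, constL, ContinuousMap.comp_apply, ContinuousMap.coe_mk,
          ContinuousLinearMap.const_apply_apply]
        abel
      have hcont : Continuous fun s : ℝ => f (B (projIcc (-1) 1 (by norm_num) s)) :=
        hf.continuous.comp (continuous_extend_time B)
      have hd := (intervalIntegral.integral_hasDerivAt_right
        (hcont.intervalIntegrable 0 (z.2 / (ρ / 2)))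
        (hcont.stronglyMeasurableAtFilter _ _) hcont.continuousAt).scomp z.2
        ((hasDerivAt_id z.2).div_const (ρ / 2))
      have hd2 := (hd.const_smul (ρ / 2)).const_add z.1
      have hzv : A z one = B (projIcc (-1) 1 (by norm_num) (z.2 / (ρ / 2))) := hval z.2 hz2
      rw [hzv]
      refine (hd2.congr_of_eventuallyEq ?_).congr_deriv ?_
      · filter_upwards [(isOpen_Iio.preimage continuous_abs).mem_nhds hz2] with t ht
        exact hAint t ht
      · rw [smul_smul, mul_one_div_cancel hε.ne', one_smul]

/-- A vector field on a finite-dimensional space that is smooth near a point has a smooth local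
flow there. -/
theorem exists_smooth_flow {E : Type v} [NormedAddCommGroup E] [NormedSpace ℝ E]
    [FiniteDimensional ℝ E] (f : E → E) (x₀ : E) {U : Set E} (hU : U ∈ 𝓝 x₀)
    (hf : ContDiffOn ℝ ∞ f U) :
    ∃ φ : E × ℝ → E, (∀ᶠ z in 𝓝 (x₀, (0 : ℝ)), ContDiffAt ℝ ∞ φ z) ∧
      φ (x₀, 0) = x₀ ∧
      ∀ᶠ z in 𝓝 (x₀, (0 : ℝ)), φ (z.1, 0) = z.1 ∧
        HasDerivAt (fun t => φ (z.1, t)) (f (φ z)) z.2 := by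
  have : CompleteSpace E := FiniteDimensional.complete ℝ E
  obtain ⟨r, hr, hrU⟩ := Metric.mem_nhds_iff.1 hU
  -- The cut-off field is globally smooth and agrees with `f` on the ball of radius `r / 4`, where
  -- the flow stays for points near `x₀` and small times.
  let χ : ContDiffBump x₀ := ⟨r / 4, r / 2, by linarith, by linarith⟩
  have hsm : ContDiff ℝ ∞ fun x => χ x • f x := by
    refine contDiff_iff_contDiffAt.2 fun x => ?_
    by_cases hx : x ∈ Metric.ball x₀ r
    · exact χ.contDiff.contDiffAt.smul (hf.contDiffAt (mem_of_superset
        (Metric.isOpen_ball.mem_nhds hx) hrU))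
    · refine (contDiffAt_const (c := (0 : E))).congr_of_eventuallyEq ?_
      have hx' : x ∈ (Metric.closedBall x₀ (r / 2))ᶜ := by
        intro h
        exact hx (Metric.mem_ball.2 (lt_of_le_of_lt (Metric.mem_closedBall.1 h) (by linarith)))
      filter_upwards [Metric.isClosed_closedBall.isOpen_compl.mem_nhds hx'] with y hy
      have : χ y = 0 := χ.zero_of_le_dist (by
        simp only [mem_compl_iff, Metric.mem_closedBall, not_le] at hy
        exact hy.le)
      rw [this, zero_smul]
  obtain ⟨φ, h1, h2⟩ := exists_smooth_flow_of_contDiff _ hsm x₀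
  have h0 : φ (x₀, 0) = x₀ := h2.self_of_nhds.1
  refine ⟨φ, h1, h0, ?_⟩
  have h3 : ∀ᶠ z in 𝓝 (x₀, (0 : ℝ)), φ z ∈ Metric.ball x₀ (r / 4) := by
    have := h1.self_of_nhds.continuousAt
    rw [ContinuousAt, h0] at this
    exact this (Metric.ball_mem_nhds _ (by linarith))
  filter_upwards [h2, h3] with z hz hz3
  refine ⟨hz.1, ?_⟩
  have h4 : χ (φ z) = 1 := χ.one_of_mem_closedBall (Metric.ball_subset_closedBall hz3)
  simpa [h4] using hz.2

end Flow

/-! ### Commuting frames are coordinate frames -/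

section Frames

variable {E : Type*} [NormedAddCommGroup E] [NormedSpace ℝ E] [FiniteDimensional ℝ E]

theorem eventually_isInvertible {B : E →L[ℝ] E} (hB : B.IsInvertible) :
    ∀ᶠ C in 𝓝 B, C.IsInvertible := by
  have : CompleteSpace E := FiniteDimensional.complete ℝ E
  obtain ⟨b, rfl⟩ := hB
  filter_upwards [ContinuousLinearEquiv.nhds b] with C ⟨c, hc⟩
  exact ⟨c, hc⟩

theorem isInvertible_of_injective {E' : Type*} [NormedAddCommGroup E'] [NormedSpace ℝ E']
    (B : E →L[ℝ] E') (hB : Function.Injective B)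
    (hd : Module.finrank ℝ E' = Module.finrank ℝ E) [FiniteDimensional ℝ E'] :
    B.IsInvertible := by
  have h : Function.Bijective B :=
    ⟨hB,
      (LinearMap.injective_iff_surjective_of_finrank_eq_finrank (f := B.toLinearMap) hd.symm).1 hB⟩
  exact ⟨(LinearEquiv.ofBijective B.toLinearMap h).toContinuousLinearEquiv, by ext; rfl⟩

/-- A commuting frame (the images under `B` of the constant fields) is the coordinate frame of
local coordinates. -/
theorem exists_coordinates_of_commuting_frame (B : E → E →L[ℝ] E) (x₀ : E) {U : Set E}
    (hU : U ∈ 𝓝 x₀) (hB : ContDiffOn ℝ ∞ B U) (hinv : (B x₀).IsInvertible)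
    (hcomm : ∀ x ∈ U, ∀ c d, fderiv ℝ B x (B x c) d = fderiv ℝ B x (B x d) c) :
    ∃ F : E → E, (∀ᶠ y in 𝓝 0, ContDiffAt ℝ ∞ F y) ∧ F 0 = x₀ ∧
      ∀ᶠ y in 𝓝 0, HasFDerivAt F (B (F y)) y := by
  have : CompleteSpace E := FiniteDimensional.complete ℝ E
  have hBx : ContDiffAt ℝ ∞ B x₀ := hB.contDiffAt hU
  have h1 : ∀ᶠ x in 𝓝 x₀, (B x).IsInvertible :=
    hBx.continuousAt.eventually (eventually_isInvertible hinv)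
  obtain ⟨r, hr, hball⟩ := Metric.eventually_nhds_iff_ball.1
    (h1.and (eventually_eventually_nhds.2 hU))
  set W := Metric.ball x₀ r with hW
  have hBW : ∀ x ∈ W, ContDiffAt ℝ ∞ B x := fun x hx => hB.contDiffAt (hball x hx).2
  -- The dual coframe, seen as a vector-valued one-form. Coordinates adapted to the frame are a
  -- primitive of it.
  let A : E → E →L[ℝ] E := fun x => (B x).inverse
  have hA : ∀ x ∈ W, ContDiffAt ℝ ∞ A x := by
    intro x hx
    obtain ⟨b, hb⟩ := (hball x hx).1
    exact ContDiffAt.comp x (g := ContinuousLinearMap.inverse)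
      (by rw [← hb]; exact contDiffAt_map_inverse b) (hBW x hx)
  have hAB : ∀ x ∈ W, ∀ c, A x (B x c) = c := by
    intro x hx c
    obtain ⟨b, hb⟩ := (hball x hx).1
    simp [A, ← hb]
  have hBA : ∀ x ∈ W, ∀ c, B x (A x c) = c := by
    intro x hx c
    obtain ⟨b, hb⟩ := (hball x hx).1
    simp [A, ← hb]
  have hn : (∞ : WithTop ℕ∞) ≠ 0 := by simp
  have hderiv : ∀ x ∈ W, ∀ v w, fderiv ℝ A x v w = - A x (fderiv ℝ B x v (A x w)) := by
    intro x hx v w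
    have hAd := ((hA x hx).differentiableAt hn).hasFDerivAt
    have hBd := ((hBW x hx).differentiableAt hn).hasFDerivAt
    have h2 : HasFDerivAt (fun y => A y (B y (A x w)))
        ((A x).comp ((fderiv ℝ B x).flip (A x w)) + (fderiv ℝ A x).flip (B x (A x w))) x := by
      refine hAd.clm_apply ?_
      have := hBd.clm_apply (hasFDerivAt_const (A x w) x)
      simpa using this
    have h3 : HasFDerivAt (fun y => A y (B y (A x w))) (0 : E →L[ℝ] E) x := by
      refine (hasFDerivAt_const (A x w) x).congr_of_eventuallyEq ?_
      filter_upwards [Metric.isOpen_ball.mem_nhds hx] with y hy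
      exact hAB y hy _
    have h4 := congrArg (fun L : E →L[ℝ] E => L v) (h2.unique h3)
    simp only [_root_.add_apply, ContinuousLinearMap.comp_apply,
      ContinuousLinearMap.flip_apply, _root_.zero_apply, hBA x hx] at h4
    exact eq_neg_of_add_eq_zero_right h4
  -- Commutation of the frame is closedness of the coframe.
  have hsymm : ∀ x ∈ W, ∀ v w, fderiv ℝ A x v w = fderiv ℝ A x w v := by
    intro x hx v w
    rw [hderiv x hx, hderiv x hx]
    have h5 := hcomm x (mem_of_mem_nhds (hball x hx).2) (A x v) (A x w)
    rw [hBA x hx, hBA x hx] at h5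
    rw [h5]
  -- The Poincaré lemma on a ball. The map sought is the local inverse of the primitive, normalized
  -- to vanish at `x₀`.
  obtain ⟨Ψ, hΨ⟩ := (convex_ball x₀ r).exists_forall_hasFDerivWithinAt_of_hasFDerivWithinAt_symmetric
    (fun x hx => ((hA x hx).differentiableAt hn).hasFDerivAt.hasFDerivWithinAt)
    (fun x hx v _ w _ => hsymm x hx v w)
  let Φ : E → E := fun x => Ψ x - Ψ x₀
  have hΦ : ∀ x ∈ W, HasFDerivAt Φ (A x) x := fun x hx =>
    ((hΨ x hx).hasFDerivAt (Metric.isOpen_ball.mem_nhds hx)).sub_const _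
  have hΦs : ContDiffOn ℝ ∞ Φ W := by
    rw [contDiffOn_infty_iff_fderiv_of_isOpen Metric.isOpen_ball]
    refine ⟨fun x hx => (hΦ x hx).differentiableAt.differentiableWithinAt, ?_⟩
    refine ContDiffOn.congr (f := A) (fun x hx => (hA x hx).contDiffWithinAt) fun x hx => ?_
    exact (hΦ x hx).fderiv
  have hx₀ : x₀ ∈ W := Metric.mem_ball_self hr
  obtain ⟨b, hb⟩ := hinv
  have hbA : ((b.symm : E ≃L[ℝ] E) : E →L[ℝ] E) = A x₀ := by simp [A, ← hb]
  have hΦx : ContDiffAt ℝ ∞ Φ x₀ := hΦs.contDiffAt (Metric.isOpen_ball.mem_nhds hx₀)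
  have hΦd : HasFDerivAt Φ ((b.symm : E ≃L[ℝ] E) : E →L[ℝ] E) x₀ := by
    rw [hbA]; exact hΦ x₀ hx₀
  let h := hΦx.toOpenPartialHomeomorph Φ hΦd hn
  have hcoe : (h : E → E) = Φ := hΦx.toOpenPartialHomeomorph_coe hΦd hn
  have hΦ0 : Φ x₀ = 0 := sub_self _
  have hsrc : x₀ ∈ h.source := hΦx.mem_toOpenPartialHomeomorph_source hΦd hn
  have htgt : (0 : E) ∈ h.target := by
    rw [← hΦ0, ← hcoe]; exact h.map_source hsrc
  have hs0 : h.symm 0 = x₀ := by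
    rw [← hΦ0, ← hcoe]; exact h.left_inv hsrc
  have hcont : ContinuousAt h.symm 0 := h.symm.continuousAt htgt
  have hev : ∀ᶠ y in 𝓝 (0 : E), h.symm y ∈ W := by
    refine hcont.eventually ?_
    rw [hs0]
    exact Metric.isOpen_ball.mem_nhds hx₀
  have hboth : ∀ᶠ y in 𝓝 (0 : E), ContDiffAt ℝ ∞ h.symm y ∧
      HasFDerivAt h.symm (B (h.symm y)) y := by
    filter_upwards [hev, h.open_target.mem_nhds htgt] with y hy hyt
    obtain ⟨c, hc⟩ := (hball _ hy).1
    have hcA : ((c.symm : E ≃L[ℝ] E) : E →L[ℝ] E) = A (h.symm y) := by simp [A, ← hc]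
    have hd : HasFDerivAt h ((c.symm : E ≃L[ℝ] E) : E →L[ℝ] E) (h.symm y) := by
      rw [hcoe, hcA]
      exact hΦ _ hy
    refine ⟨h.contDiffAt_symm hyt hd ?_, ?_⟩
    · rw [hcoe]
      exact hΦs.contDiffAt (Metric.isOpen_ball.mem_nhds hy)
    · rw [← hc]
      exact h.hasFDerivAt_symm (f' := c.symm) hyt hd
  exact ⟨h.symm, hboth.mono fun _ h => h.1, hs0, hboth.mono fun _ h => h.2⟩

end Frames

/-! ### Changing a chart by a local diffeomorphism -/

section Charts

variable {M : Type*} [TopologicalSpace M] [ChartedSpace E3 M] [IsManifold (𝓡 3) ∞ M]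

/-- A local diffeomorphism `F` of coordinate space changes the chart `e₀` into a chart whose inverse
is `e₀.symm ∘ F` on a small ball. -/
theorem exists_chart {e₀ : OpenPartialHomeomorph M E3}
    (he₀ : e₀ ∈ IsManifold.maximalAtlas (𝓡 3) ∞ M)
    {p : M} (hp : p ∈ e₀.source) {F : E3 → E3} (hFe : ∀ᶠ u in 𝓝 0, ContDiffAt ℝ ∞ F u)
    (hF0 : F 0 = e₀ p)
    (hinv : (fderiv ℝ F 0).IsInvertible) {W : Set E3} (hW : W ∈ 𝓝 0) :
    ∃ e ∈ IsManifold.maximalAtlas (𝓡 3) ∞ M, ∃ ε > 0, e.target = Metric.ball 0 ε ∧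
      Metric.ball 0 ε ⊆ W ∧ p ∈ e.source ∧ e p = 0 ∧
      ∀ u ∈ Metric.ball (0 : E3) ε, ContDiffAt ℝ ∞ F u ∧ F u ∈ e₀.target ∧
        e.symm u = e₀.symm (F u) := by
  have hn : (∞ : WithTop ℕ∞) ≠ 0 := by simp
  have hF : ContDiffAt ℝ ∞ F 0 := hFe.self_of_nhds
  obtain ⟨b, hb⟩ := hinv
  have hFd : HasFDerivAt F (b : E3 →L[ℝ] E3) 0 := by
    rw [hb]; exact (hF.differentiableAt hn).hasFDerivAt
  let h := hF.toOpenPartialHomeomorph F hFd hn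
  have hcoe : (h : E3 → E3) = F := hF.toOpenPartialHomeomorph_coe hFd hn
  have hsrc : (0 : E3) ∈ h.source := hF.mem_toOpenPartialHomeomorph_source hFd hn
  have h2 : ∀ᶠ u in 𝓝 (0 : E3), (fderiv ℝ F u).IsInvertible := by
    have : ContinuousAt (fderiv ℝ F) 0 :=
      (hF.fderiv_right (m := 0) (by simp)).continuousAt
    exact this.eventually (eventually_isInvertible ⟨b, hb⟩)
  have h3 : ∀ᶠ u in 𝓝 (0 : E3), F u ∈ e₀.target := by
    refine hF.continuousAt.eventually (e₀.open_target.mem_nhds ?_)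
    rw [hF0]; exact e₀.map_source hp
  obtain ⟨ε, hε, hball⟩ := Metric.eventually_nhds_iff_ball.1
    (((hFe.and h2).and h3).and ((h.open_source.eventually_mem hsrc).and (eventually_mem_set.2 hW)))
  let h' := h.restrOpen (Metric.ball 0 ε) Metric.isOpen_ball
  have hsrc' : h'.source = Metric.ball 0 ε := by
    rw [OpenPartialHomeomorph.restrOpen_source]
    exact inter_eq_right.2 fun u hu => (hball u hu).2.1
  let e := e₀.trans h'.symm
  have hsymm : ∀ u, e.symm u = e₀.symm (F u) := by
    intro u
    simp only [e, OpenPartialHomeomorph.coe_trans_symm, Function.comp_apply,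
      OpenPartialHomeomorph.symm_symm]
    exact congrArg e₀.symm (congrFun hcoe u)
  have h'coe : ∀ u, h' u = F u := fun u => congrFun hcoe u
  have htgt : e.target = Metric.ball 0 ε := by
    simp only [e, OpenPartialHomeomorph.trans_target, OpenPartialHomeomorph.symm_target, hsrc',
      OpenPartialHomeomorph.symm_symm]
    exact inter_eq_left.2 fun u hu => by
      change h' u ∈ e₀.target
      rw [h'coe]; exact (hball u hu).1.2
  have h0 : (0 : E3) ∈ e.target := by rw [htgt]; exact Metric.mem_ball_self hε
  have hes0 : e.symm 0 = p := by rw [hsymm, hF0]; exact e₀.left_inv hp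
  refine ⟨e, ?_, ε, hε, htgt, fun u hu => (hball u hu).2.2, ?_, ?_, ?_⟩
  · rw [IsManifold.mem_maximalAtlas_iff_contMDiffOn] at he₀ ⊢
    constructor
    · have h4 : ContDiffOn ℝ ∞ h'.symm h'.target := by
        intro y hy
        have hy' : h'.symm y ∈ Metric.ball (0 : E3) ε := by
          rw [← hsrc']; exact h'.map_target hy
        obtain ⟨c, hc⟩ := (hball _ hy').1.1.2
        refine (h'.contDiffAt_symm hy (f₀' := c) ?_ ?_).contDiffWithinAt
        · rw [hc]
          have := ((hball _ hy').1.1.1.differentiableAt hn).hasFDerivAt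
          exact this.congr_of_eventuallyEq (Eventually.of_forall h'coe)
        · exact (hball _ hy').1.1.1.congr_of_eventuallyEq (Eventually.of_forall h'coe)
      have h5 : ContMDiffOn (𝓡 3) (𝓡 3) ∞ h'.symm h'.target := h4.contMDiffOn
      refine h5.comp (he₀.1.mono ?_) ?_
      · exact inter_subset_left
      · exact fun x hx => hx.2
    · have h6 : ContMDiffOn (𝓡 3) (𝓡 3) ∞ F e.target := by
        refine ContDiffOn.contMDiffOn fun u hu => ?_
        rw [htgt] at hu
        exact (hball u hu).1.1.1.contDiffWithinAt
      refine (he₀.2.comp h6 fun u hu => ?_).congr fun u _ => hsymm u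
      rw [htgt] at hu
      exact (hball u hu).1.2
  · rw [← hes0]; exact e.map_target h0
  · rw [← hes0]; exact e.right_inv h0
  · exact fun u hu => ⟨(hball u hu).1.1.1, (hball u hu).1.2, hsymm u⟩

end Charts

set_option synthInstance.maxHeartbeats 200000 in
instance : NormedAddCommGroup (E3 →L[ℝ] E3 →L[ℝ] ℝ) := ContinuousLinearMap.toNormedAddCommGroup

set_option synthInstance.maxHeartbeats 200000 in
instance : NormedSpace ℝ (E3 →L[ℝ] E3 →L[ℝ] ℝ) := ContinuousLinearMap.toNormedSpace

/-! ### Vector fields, metric and Levi-Civita connection in a chart -/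

section Coordinates

variable {M : Type*} [TopologicalSpace M] [ChartedSpace E3 M] [IsManifold (𝓡 3) ∞ M]
  {e : OpenPartialHomeomorph M E3}

/-- The vector field `V` is smooth at the point `x`. -/
def SmoothFieldAt (V : Π x : M, TangentSpace (𝓡 3) x) (x : M) : Prop :=
  ContMDiffAt (𝓡 3) (𝓡 3).tangent ∞ (fun x => (⟨x, V x⟩ : TangentBundle (𝓡 3) M)) x

theorem SmoothFieldOn.smoothFieldAt {V : Π x : M, TangentSpace (𝓡 3) x} {U : Set M}
    (hV : SmoothFieldOn V U) (hU : IsOpen U) {x : M} (hx : x ∈ U) : SmoothFieldAt V x :=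
  ContMDiffOn.contMDiffAt hV (hU.mem_nhds hx)

theorem smoothFieldOn_of_smoothFieldAt {V : Π x : M, TangentSpace (𝓡 3) x} {U : Set M}
    (hV : ∀ x ∈ U, SmoothFieldAt V x) : SmoothFieldOn V U :=
  fun x hx => (hV x hx).contMDiffWithinAt

/-- The coordinate frame of the chart `e`, as a linear isomorphism at each point. -/
def frame (e : OpenPartialHomeomorph M E3) (u : E3) : E3 →L[ℝ] TangentSpace (𝓡 3) (e.symm u) :=
  mfderiv (𝓡 3) (𝓡 3) e.symm u

/-- The components of a vector field in the chart `e`. -/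
def comps (e : OpenPartialHomeomorph M E3) (V : Π x : M, TangentSpace (𝓡 3) x) (u : E3) : E3 :=
  mpullback (𝓡 3) (𝓡 3) e.symm V u

/-- The vector field with the components `v` in the chart `e`. -/
def ofComps (e : OpenPartialHomeomorph M E3) (v : E3 → E3) (x : M) : TangentSpace (𝓡 3) x :=
  mpullback (𝓡 3) (𝓡 3) e (fun u : E3 => (v u : TangentSpace (𝓡 3) u)) x

theorem mdifferentiable_of_mem (he : e ∈ IsManifold.maximalAtlas (𝓡 3) ∞ M) :
    e.MDifferentiable (𝓡 3) (𝓡 3) :=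
  ⟨(contMDiffOn_of_mem_maximalAtlas he).mdifferentiableOn (by simp),
    (contMDiffOn_symm_of_mem_maximalAtlas he).mdifferentiableOn (by simp)⟩

theorem isInvertible_frame (he : e ∈ IsManifold.maximalAtlas (𝓡 3) ∞ M) {u : E3}
    (hu : u ∈ e.target) : (mfderiv (𝓡 3) (𝓡 3) e.symm u).IsInvertible :=
  ⟨(mdifferentiable_of_mem he).symm.mfderiv (x := u) hu, rfl⟩

theorem frame_injective (he : e ∈ IsManifold.maximalAtlas (𝓡 3) ∞ M) {u : E3}
    (hu : u ∈ e.target) : Function.Injective (frame e u) :=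
  (mdifferentiable_of_mem he).symm.mfderiv_injective hu

theorem frame_surjective (he : e ∈ IsManifold.maximalAtlas (𝓡 3) ∞ M) {u : E3}
    (hu : u ∈ e.target) : Function.Surjective (frame e u) :=
  (mdifferentiable_of_mem he).symm.mfderiv_surjective hu

theorem frame_comps (he : e ∈ IsManifold.maximalAtlas (𝓡 3) ∞ M) {u : E3} (hu : u ∈ e.target)
    (V : Π x : M, TangentSpace (𝓡 3) x) : frame e u (comps e V u) = V (e.symm u) := by
  obtain ⟨b, hb⟩ := isInvertible_frame he hu
  simp only [frame, comps, mpullback_apply, ← hb]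
  rw [ContinuousLinearMap.inverse_equiv]
  exact b.apply_symm_apply _

theorem comps_eq_of_frame_eq (he : e ∈ IsManifold.maximalAtlas (𝓡 3) ∞ M) {u : E3}
    (hu : u ∈ e.target) {V : Π x : M, TangentSpace (𝓡 3) x} {v : E3}
    (h : frame e u v = V (e.symm u)) : comps e V u = v :=
  frame_injective he hu (by rw [frame_comps he hu, h])

theorem contDiffAt_comps (he : e ∈ IsManifold.maximalAtlas (𝓡 3) ∞ M) {u : E3} (hu : u ∈ e.target)
    {V : Π x : M, TangentSpace (𝓡 3) x} (hV : SmoothFieldAt V (e.symm u)) :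
    ContDiffAt ℝ ∞ (comps e V) u := by
  have : IsManifold (𝓡 3) 1 M := .of_le (n := ∞) (by simp)
  have h := ContMDiffAt.mpullback_vectorField_preimage (m := ∞) (n := ∞) (f := e.symm) (x₀ := u) hV
    (contMDiffAt_symm_of_mem_maximalAtlas he hu) (isInvertible_frame he hu) (by simp)
  exact contMDiffAt_vectorSpace_iff_contDiffAt.1 h

theorem frame_eq_ofComps (he : e ∈ IsManifold.maximalAtlas (𝓡 3) ∞ M) {u : E3} (hu : u ∈ e.target)
    (v : E3 → E3) : frame e u (v u) = ofComps e v (e.symm u) := by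
  have hx := e.map_target hu
  let b := (mdifferentiable_of_mem he).mfderiv hx
  have h1 : ofComps e v (e.symm u) = b.symm (v (e (e.symm u))) := by
    change (mfderiv (𝓡 3) (𝓡 3) e (e.symm u)).inverse (v (e (e.symm u))) = _
    have : mfderiv (𝓡 3) (𝓡 3) e (e.symm u) = (b : _ →L[ℝ] _) := rfl
    rw [this, ContinuousLinearMap.inverse_equiv]
    rfl
  have h2 : b (frame e u (v u)) = v u :=
    congrArg (fun L => L (v u)) ((mdifferentiable_of_mem he).comp_symm_deriv hu)
  have h3 : b (frame e u (v u)) = v (e (e.symm u)) :=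
    h2.trans (congrArg v (e.right_inv hu)).symm
  exact (b.eq_symm_apply.2 h3).trans h1.symm

theorem comps_ofComps (he : e ∈ IsManifold.maximalAtlas (𝓡 3) ∞ M) {u : E3} (hu : u ∈ e.target)
    (v : E3 → E3) : comps e (ofComps e v) u = v u :=
  comps_eq_of_frame_eq he hu (frame_eq_ofComps he hu v)

theorem smoothFieldAt_ofComps (he : e ∈ IsManifold.maximalAtlas (𝓡 3) ∞ M) {u : E3}
    (hu : u ∈ e.target) {v : E3 → E3} (hv : ContDiffAt ℝ ∞ v u) :
    SmoothFieldAt (ofComps e v) (e.symm u) := by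
  have : IsManifold (𝓡 3) 1 M := .of_le (n := ∞) (by simp)
  have hx := e.map_target hu
  have hi : (mfderiv (𝓡 3) (𝓡 3) e (e.symm u)).IsInvertible :=
    ⟨(mdifferentiable_of_mem he).mfderiv hx, rfl⟩
  refine ContMDiffAt.mpullback_vectorField_preimage (m := ∞) (n := ∞) (f := e) (x₀ := e.symm u)
    ?_ (contMDiffAt_of_mem_maximalAtlas he hx) hi (by simp)
  rw [e.right_inv hu]
  exact contMDiffAt_vectorSpace_iff_contDiffAt.2 hv

theorem two_le_infty : (2 : WithTop ℕ∞) ≤ ∞ :=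
  WithTop.coe_le_coe.2 (le_top : (2 : ℕ∞) ≤ ⊤)

theorem lieBracket_apply (V W : E3 → E3) (u : E3) :
    mlieBracket (𝓡 3) (M := E3) V W u = fderiv ℝ W u (V u) - fderiv ℝ V u (W u) := by
  have h := congrFun (mlieBracketWithin_eq_lieBracketWithin (𝕜 := ℝ) (E := E3) (V := V) (W := W)
    (s := univ)) u
  refine (congrFun (mlieBracketWithin_univ (I := 𝓡 3) (V := V) (W := W)).symm u).trans
    (h.trans ?_)
  rw [lieBracketWithin, fderivWithin_univ, fderivWithin_univ]

theorem comps_mlieBracket (he : e ∈ IsManifold.maximalAtlas (𝓡 3) ∞ M) {u : E3} (hu : u ∈ e.target)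
    {V W : Π x : M, TangentSpace (𝓡 3) x} (hV : SmoothFieldAt V (e.symm u))
    (hW : SmoothFieldAt W (e.symm u)) :
    comps e (mlieBracket (𝓡 3) V W) u =
      fderiv ℝ (comps e W) u (comps e V u) - fderiv ℝ (comps e V) u (comps e W u) := by
  have : IsManifold (𝓡 3) (minSmoothness ℝ 2) M := .of_le (n := ∞)
    (by rw [minSmoothness_of_isRCLikeNormedField]; exact two_le_infty)
  have h := mpullback_mlieBracket (I := 𝓡 3) (I' := 𝓡 3) (n := ∞) (f := e.symm) (x₀ := u)
    (hV.mdifferentiableAt (by simp)) (hW.mdifferentiableAt (by simp))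
    (contMDiffAt_symm_of_mem_maximalAtlas he hu)
    (by rw [minSmoothness_of_isRCLikeNormedField]; exact two_le_infty)
  exact h.trans (lieBracket_apply (comps e V) (comps e W) u)

variable [RiemannianBundle (fun x : M => TangentSpace (𝓡 3) x)]

/-- The metric in the chart `e`. -/
def coordMetric (e : OpenPartialHomeomorph M E3) (u : E3) : E3 →L[ℝ] E3 →L[ℝ] ℝ :=
  (innerSL ℝ (E := TangentSpace (𝓡 3) (e.symm u))).bilinearComp (frame e u) (frame e u)

theorem coordMetric_apply (u v w : E3) :
    coordMetric e u v w = inner ℝ (frame e u v) (frame e u w) := rfl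

theorem coordMetric_symm (u v w : E3) : coordMetric e u v w = coordMetric e u w v := by
  rw [coordMetric_apply, coordMetric_apply, real_inner_comm]

theorem coordMetric_pos (he : e ∈ IsManifold.maximalAtlas (𝓡 3) ∞ M) {u : E3} (hu : u ∈ e.target)
    {v : E3} (hv : v ≠ 0) : 0 < coordMetric e u v v := by
  rw [coordMetric_apply]
  refine real_inner_self_pos.2 fun h => hv (frame_injective he hu ?_)
  rw [h, map_zero]

theorem inner_eq_coordMetric (he : e ∈ IsManifold.maximalAtlas (𝓡 3) ∞ M) {u : E3}
    (hu : u ∈ e.target) (V W : Π x : M, TangentSpace (𝓡 3) x) :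
    inner ℝ (V (e.symm u)) (W (e.symm u)) = coordMetric e u (comps e V u) (comps e W u) := by
  rw [coordMetric_apply, frame_comps he hu, frame_comps he hu]

variable [IsContMDiffRiemannianBundle (𝓡 3) ∞ E3 (fun x : M => TangentSpace (𝓡 3) x)]

/-- In finite dimension smoothness may be tested on constant vectors, and the resulting entries are
inner products of smooth fields. -/
theorem contDiffOn_coordMetric (he : e ∈ IsManifold.maximalAtlas (𝓡 3) ∞ M) :
    ContDiffOn ℝ ∞ (coordMetric e) e.target := by
  refine contDiffOn_clm_apply.2 fun v => contDiffOn_clm_apply.2 fun w => fun u hu => ?_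
  refine ContDiffAt.contDiffWithinAt ?_
  have hs : ∀ v : E3, SmoothFieldAt (ofComps e fun _ => v) (e.symm u) := fun v =>
    smoothFieldAt_ofComps he hu contDiffAt_const
  have h1 := ContMDiffAt.inner_bundle (hs v) (hs w)
  have h2 := (h1.comp u (contMDiffAt_symm_of_mem_maximalAtlas he hu)).contDiffAt
  refine h2.congr_of_eventuallyEq ?_
  filter_upwards [e.open_target.mem_nhds hu] with y hy
  simp only [Function.comp_apply]
  rw [inner_eq_coordMetric he hy, comps_ofComps he hy, comps_ofComps he hy]

theorem contDiffAt_coordMetric (he : e ∈ IsManifold.maximalAtlas (𝓡 3) ∞ M) {u : E3}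
    (hu : u ∈ e.target) : ContDiffAt ℝ ∞ (coordMetric e) u :=
  (contDiffOn_coordMetric he).contDiffAt (e.open_target.mem_nhds hu)

theorem derivInner_eq (he : e ∈ IsManifold.maximalAtlas (𝓡 3) ∞ M) {u : E3} (hu : u ∈ e.target)
    {X Y Z : Π x : M, TangentSpace (𝓡 3) x} (hY : SmoothFieldAt Y (e.symm u))
    (hZ : SmoothFieldAt Z (e.symm u)) :
    derivInner X Y Z (e.symm u) =
      fderiv ℝ (coordMetric e) u (comps e X u) (comps e Y u) (comps e Z u)
      + coordMetric e u (fderiv ℝ (comps e Y) u (comps e X u)) (comps e Z u)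
      + coordMetric e u (comps e Y u) (fderiv ℝ (comps e Z) u (comps e X u)) := by
  have hn : (∞ : WithTop ℕ∞) ≠ 0 := by simp
  have h1 : MDifferentiableAt (𝓡 3) 𝓘(ℝ, ℝ) (fun y => inner ℝ (Y y) (Z y)) (e.symm u) :=
    (ContMDiffAt.inner_bundle hY hZ).mdifferentiableAt hn
  have h2 := (contMDiffAt_symm_of_mem_maximalAtlas he hu).mdifferentiableAt hn
  have h3 := mfderiv_comp u h1 h2
  have h4 : derivInner X Y Z (e.symm u) =
      fderiv ℝ ((fun y => inner ℝ (Y y) (Z y)) ∘ e.symm) u (comps e X u) := by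
    have h5 : fderiv ℝ ((fun y => inner ℝ (Y y) (Z y)) ∘ e.symm) u =
      mfderiv (𝓡 3) 𝓘(ℝ, ℝ) ((fun y => inner ℝ (Y y) (Z y)) ∘ e.symm) u := mfderiv_eq_fderiv.symm
    rw [h5, h3]
    have h6 : X (e.symm u) = frame e u (comps e X u) := (frame_comps he hu X).symm
    simp only [derivInner, h6]
    rfl
  rw [h4]
  have hG := ((contDiffAt_coordMetric he hu).differentiableAt hn).hasFDerivAt
  have hY' := ((contDiffAt_comps he hu hY).differentiableAt hn).hasFDerivAt
  have hZ' := ((contDiffAt_comps he hu hZ).differentiableAt hn).hasFDerivAt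
  have h7 := (hG.clm_apply hY').clm_apply hZ'
  have h8 : ((fun y => inner ℝ (Y y) (Z y)) ∘ e.symm) =ᶠ[𝓝 u]
      fun y => coordMetric e y (comps e Y y) (comps e Z y) := by
    filter_upwards [e.open_target.mem_nhds hu] with y hy
    exact inner_eq_coordMetric he hy Y Z
  rw [(h7.congr_of_eventuallyEq h8).fderiv]
  simp only [_root_.add_apply, ContinuousLinearMap.comp_apply, ContinuousLinearMap.flip_apply]
  ring

/-- Twice the inner product of `w` and `∇_v Y`, for a vector field `Y` on coordinate space with the
metric `G`. -/
def covForm (G : E3 → E3 →L[ℝ] E3 →L[ℝ] ℝ) (Y : E3 → E3) (u v w : E3) : ℝ :=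
  2 * G u (fderiv ℝ Y u v) w + fderiv ℝ G u v (Y u) w + fderiv ℝ G u (Y u) v w
    - fderiv ℝ G u w v (Y u)

section covForm

variable (G : E3 → E3 →L[ℝ] E3 →L[ℝ] ℝ) (Y : E3 → E3) (u : E3)

theorem covForm_add_right (v w w' : E3) :
    covForm G Y u v (w + w') = covForm G Y u v w + covForm G Y u v w' := by
  simp only [covForm, map_add, _root_.add_apply]
  ring

theorem covForm_smul_right (v : E3) (c : ℝ) (w : E3) :
    covForm G Y u v (c • w) = c • covForm G Y u v w := by
  simp only [covForm, map_smul, _root_.smul_apply, smul_eq_mul]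
  ring

theorem covForm_add_left (v v' w : E3) :
    covForm G Y u (v + v') w = covForm G Y u v w + covForm G Y u v' w := by
  simp only [covForm, map_add, _root_.add_apply]
  ring

theorem covForm_smul_left (c : ℝ) (v w : E3) :
    covForm G Y u (c • v) w = c • covForm G Y u v w := by
  simp only [covForm, map_smul, _root_.smul_apply, smul_eq_mul]
  ring

end covForm

theorem fderiv_metric_symm {G : E3 → E3 →L[ℝ] E3 →L[ℝ] ℝ} {u : E3} (hG : DifferentiableAt ℝ G u)
    (hs : ∀ᶠ y in 𝓝 u, ∀ v w, G y v w = G y w v) (a v w : E3) :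
    fderiv ℝ G u a v w = fderiv ℝ G u a w v := by
  have h : ∀ v w : E3, HasFDerivAt (fun y => G y v w)
      (((fderiv ℝ G u).flip v).flip w) u := by
    intro v w
    have := (hG.hasFDerivAt.clm_apply (hasFDerivAt_const v u)).clm_apply (hasFDerivAt_const w u)
    simpa using this
  have h2 := (h v w).unique ((h w v).congr_of_eventuallyEq (hs.mono fun y hy => hy v w))
  exact congrArg (fun L : E3 →L[ℝ] ℝ => L a) h2

/-- The derivatives of `X` and `Z` cancel between the metric terms and the brackets. Koszul's
expression thus depends only on the values of `X` and `Z` at the point, which makes the choice of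
extensions in `nabla` harmless. -/
theorem koszul_eq (he : e ∈ IsManifold.maximalAtlas (𝓡 3) ∞ M) {u : E3} (hu : u ∈ e.target)
    {X Y Z : Π x : M, TangentSpace (𝓡 3) x} (hX : SmoothFieldAt X (e.symm u))
    (hY : SmoothFieldAt Y (e.symm u)) (hZ : SmoothFieldAt Z (e.symm u)) :
    koszul X Y Z (e.symm u) =
      covForm (coordMetric e) (comps e Y) u (comps e X u) (comps e Z u) := by
  rw [koszul, derivInner_eq he hu hY hZ, derivInner_eq he hu hX hZ, derivInner_eq he hu hX hY,
    inner_eq_coordMetric he hu, inner_eq_coordMetric he hu, inner_eq_coordMetric he hu,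
    comps_mlieBracket he hu hX hY, comps_mlieBracket he hu hX hZ, comps_mlieBracket he hu hY hZ]
  simp only [map_sub, _root_.sub_apply, covForm]
  have h := fun a b => coordMetric_symm (e := e) u a b
  rw [h (fderiv ℝ (comps e Z) u _) (comps e Y u), h (fderiv ℝ (comps e Z) u _) (comps e X u),
    h (comps e X u) (fderiv ℝ (comps e Y) u (comps e Z u)),
    h (comps e X u) (fderiv ℝ (comps e Z) u (comps e Y u)),
    h (comps e Y u) (fderiv ℝ (comps e Z) u (comps e X u))]
  ring

/-- The bridge between `nabla` and coordinates: `covForm` is linear in its last argument, so the sum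
over an orthonormal basis in the definition of `nabla` reassembles into it. -/
theorem two_inner_nabla (he : e ∈ IsManifold.maximalAtlas (𝓡 3) ∞ M) {u : E3} (hu : u ∈ e.target)
    {Y : Π x : M, TangentSpace (𝓡 3) x} (hY : SmoothFieldAt Y (e.symm u)) (v w : E3) :
    2 * inner ℝ (nabla Y (e.symm u) (frame e u v)) (frame e u w) =
      covForm (coordMetric e) (comps e Y) u v w := by
  have hext : ∀ z : TangentSpace (𝓡 3) (e.symm u),
      SmoothFieldAt (FiberBundle.extend E3 z) (e.symm u) := fun z =>
    FiberBundle.contMDiffAt_extend (I := 𝓡 3) (F := E3) z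
  set b := stdOrthonormalBasis ℝ (TangentSpace (𝓡 3) (e.symm u)) with hb
  have hc : ∀ z : E3, comps e (FiberBundle.extend E3 (frame e u z)) u = z := fun z =>
    comps_eq_of_frame_eq he hu (by rw [FiberBundle.extend_apply_self])
  choose c hcb using fun i => frame_surjective he hu (b i)
  have h1 : nabla Y (e.symm u) (frame e u v) =
      ∑ i, (covForm (coordMetric e) (comps e Y) u v (c i) / 2) • b i := by
    simp only [nabla]
    refine Finset.sum_congr rfl fun i _ => ?_
    rw [koszul_eq he hu (hext _) hY (hext _), hc, ← hb, ← hcb i, hc]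
  have h2 : w = ∑ i, inner ℝ (b i) (frame e u w) • c i := by
    apply frame_injective he hu
    rw [map_sum]
    conv_lhs => rw [← b.sum_repr' (frame e u w)]
    refine Finset.sum_congr rfl fun i _ => ?_
    rw [map_smul, hcb]
  rw [h1, sum_inner]
  have h3 : covForm (coordMetric e) (comps e Y) u v w =
      ∑ i, inner ℝ (b i) (frame e u w) * covForm (coordMetric e) (comps e Y) u v (c i) := by
    conv_lhs => rw [h2]
    let K : E3 →ₗ[ℝ] ℝ :=
      { toFun := covForm (coordMetric e) (comps e Y) u v
        map_add' := covForm_add_right _ _ u v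
        map_smul' := covForm_smul_right _ _ u v }
    change K (∑ i, inner ℝ (b i) (frame e u w) • c i) = _
    rw [map_sum]
    exact Finset.sum_congr rfl fun i _ => map_smul K _ _
  rw [h3, Finset.mul_sum]
  refine Finset.sum_congr rfl fun i _ => ?_
  rw [real_inner_smul_left]
  ring

end Coordinates

/-! ### Metric compatibility, Lie derivative and torsion in coordinates -/

section CoordinateCalculus

variable {G : E3 → E3 →L[ℝ] E3 →L[ℝ] ℝ} {X Y Z : E3 → E3} {u : E3}

/-- Compatibility of the connection with the metric, `v⟨Y, Z⟩ = ⟨∇_v Y, Z⟩ + ⟨Y, ∇_v Z⟩`. The factor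
`1 / 2` is there because `covForm` is twice an inner product. -/
theorem hasFDerivAt_metric_apply (hG : DifferentiableAt ℝ G u) (hY : DifferentiableAt ℝ Y u)
    (hZ : DifferentiableAt ℝ Z u) (hs : ∀ᶠ y in 𝓝 u, ∀ v w, G y v w = G y w v) (v : E3) :
    fderiv ℝ (fun y => G y (Y y) (Z y)) u v =
      (covForm G Y u v (Z u) + covForm G Z u v (Y u)) / 2 := by
  have h := ((hG.hasFDerivAt.clm_apply hY.hasFDerivAt).clm_apply hZ.hasFDerivAt).fderiv
  rw [h]
  simp only [_root_.add_apply, ContinuousLinearMap.comp_apply, ContinuousLinearMap.flip_apply,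
    covForm]
  rw [fderiv_metric_symm hG hs v (Z u), fderiv_metric_symm hG hs (Z u) v,
    fderiv_metric_symm hG hs (Y u) v, hs.self_of_nhds (Y u)]
  ring

/-- The Lie derivative of the metric along `X` is the symmetrized covariant derivative of `X`. -/
theorem covForm_add_swap (hG : DifferentiableAt ℝ G u)
    (hs : ∀ᶠ y in 𝓝 u, ∀ v w, G y v w = G y w v) (v w : E3) :
    covForm G X u v w + covForm G X u w v =
      2 * (fderiv ℝ G u (X u) v w + G u (fderiv ℝ X u v) w + G u v (fderiv ℝ X u w)) := by
  simp only [covForm]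
  rw [fderiv_metric_symm hG hs v (X u), fderiv_metric_symm hG hs w (X u),
    fderiv_metric_symm hG hs (X u) w, hs.self_of_nhds v]
  ring

theorem covForm_const (c v w : E3) : covForm G (fun _ => c) u v w =
    fderiv ℝ G u v c w + fderiv ℝ G u c v w - fderiv ℝ G u w v c := by
  simp [covForm]

/-- The connection is torsion-free. -/
theorem covForm_const_swap (hG : DifferentiableAt ℝ G u)
    (hs : ∀ᶠ y in 𝓝 u, ∀ v w, G y v w = G y w v) (c v w : E3) :
    covForm G (fun _ => c) u v w = covForm G (fun _ => v) u c w := by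
  rw [covForm_const, covForm_const, fderiv_metric_symm hG hs w v c]
  ring

end CoordinateCalculus

/-! ### The Killing equation in a chart -/

section Killing

variable {M : Type*} [TopologicalSpace M] [ChartedSpace E3 M] [IsManifold (𝓡 3) ∞ M]
  {e : OpenPartialHomeomorph M E3}
  [RiemannianBundle (fun x : M => TangentSpace (𝓡 3) x)]
  [IsContMDiffRiemannianBundle (𝓡 3) ∞ E3 (fun x : M => TangentSpace (𝓡 3) x)]

theorem differentiableAt_coordMetric (he : e ∈ IsManifold.maximalAtlas (𝓡 3) ∞ M)
    (hu : u ∈ e.target) : DifferentiableAt ℝ (coordMetric e) u :=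
  (contDiffAt_coordMetric he hu).differentiableAt (by simp)

theorem eventually_coordMetric_symm (u : E3) :
    ∀ᶠ y in 𝓝 u, ∀ v w, coordMetric e y v w = coordMetric e y w v :=
  Eventually.of_forall fun _ _ _ => coordMetric_symm _ _ _

theorem lieDerivative_metric_eq (he : e ∈ IsManifold.maximalAtlas (𝓡 3) ∞ M) {u : E3}
    (hu : u ∈ e.target) {X Y Z : Π x : M, TangentSpace (𝓡 3) x} (hX : SmoothFieldAt X (e.symm u))
    (hY : SmoothFieldAt Y (e.symm u)) (hZ : SmoothFieldAt Z (e.symm u)) :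
    derivInner X Y Z (e.symm u) - inner ℝ (mlieBracket (𝓡 3) X Y (e.symm u)) (Z (e.symm u))
          - inner ℝ (Y (e.symm u)) (mlieBracket (𝓡 3) X Z (e.symm u)) =
      (covForm (coordMetric e) (comps e X) u (comps e Y u) (comps e Z u) +
        covForm (coordMetric e) (comps e X) u (comps e Z u) (comps e Y u)) / 2 := by
  rw [covForm_add_swap (differentiableAt_coordMetric he hu) (eventually_coordMetric_symm u),
    derivInner_eq he hu hY hZ, inner_eq_coordMetric he hu, inner_eq_coordMetric he hu,
    comps_mlieBracket he hu hX hY, comps_mlieBracket he hu hX hZ]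
  simp only [map_sub, _root_.sub_apply]
  ring

/-- The Killing equation is tested on fields with constant components in the chart. -/
theorem IsKillingOn.covForm_skew {X : Π x : M, TangentSpace (𝓡 3) x} {U : Set M}
    (hX : IsKillingOn X U) (hU : IsOpen U) (he : e ∈ IsManifold.maximalAtlas (𝓡 3) ∞ M) {u : E3}
    (hu : u ∈ e.target) (huU : e.symm u ∈ U) (v w : E3) :
    covForm (coordMetric e) (comps e X) u v w = - covForm (coordMetric e) (comps e X) u w v := by
  have hc : ∀ v : E3, SmoothFieldOn (ofComps e fun _ => v) (U ∩ e.source) := fun v =>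
    smoothFieldOn_of_smoothFieldAt fun x hx => by
      rw [← e.left_inv hx.2]
      exact smoothFieldAt_ofComps he (e.map_source hx.2) contDiffAt_const
  have hx : e.symm u ∈ U ∩ e.source := ⟨huU, e.map_target hu⟩
  have hO := hU.inter e.open_source
  have h := hX.2 _ _ _ hO inter_subset_left (hc v) (hc w) _ hx
  rw [lieDerivative_metric_eq he hu (hX.1.smoothFieldAt hU huU)
    ((hc v).smoothFieldAt hO hx) ((hc w).smoothFieldAt hO hx), comps_ofComps he hu,
    comps_ofComps he hu] at h
  linarith

theorem isKillingOn_of_covForm_skew (he : e ∈ IsManifold.maximalAtlas (𝓡 3) ∞ M)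
    {X : Π x : M, TangentSpace (𝓡 3) x} (hX : SmoothFieldOn X e.source)
    (h : ∀ u ∈ e.target, ∀ v w, covForm (coordMetric e) (comps e X) u v w =
      - covForm (coordMetric e) (comps e X) u w v) : IsKillingOn X e.source := by
  refine ⟨hX, fun Y Z W hW hWe hY hZ x hx => ?_⟩
  have hu := e.map_source (hWe hx)
  have hxe := e.left_inv (hWe hx)
  rw [← hxe] at hx ⊢
  have hX' := hX.smoothFieldAt e.open_source (hWe hx)
  rw [lieDerivative_metric_eq he hu hX' (hY.smoothFieldAt hW hx)
    (hZ.smoothFieldAt hW hx), h _ hu]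
  ring

theorem IsKillingOn.add_swap_eq_zero {X : Π x : M, TangentSpace (𝓡 3) x} {U : Set M}
    (hX : IsKillingOn X U) (hU : IsOpen U) (he : e ∈ IsManifold.maximalAtlas (𝓡 3) ∞ M) {u : E3}
    (hu : u ∈ e.target) (huU : e.symm u ∈ U) (v w : E3) :
    fderiv ℝ (coordMetric e) u (comps e X u) v w
      + coordMetric e u (fderiv ℝ (comps e X) u v) w
      + coordMetric e u v (fderiv ℝ (comps e X) u w) = 0 := by
  have h := covForm_add_swap (X := comps e X) (differentiableAt_coordMetric he hu)
    (eventually_coordMetric_symm u) v w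
  rw [hX.covForm_skew hU he hu huU v w] at h
  linarith

/-- A unit Killing field in a chart. -/
theorem covForm_unit_right {ξ : Π x : M, TangentSpace (𝓡 3) x}
    (hξ : IsKillingOn ξ univ) (hunit : ∀ x, ‖ξ x‖ = 1)
    (he : e ∈ IsManifold.maximalAtlas (𝓡 3) ∞ M) {u : E3} (hu : u ∈ e.target) (v : E3) :
    covForm (coordMetric e) (comps e ξ) u v (comps e ξ u) = 0 := by
  have hs := (contDiffAt_comps he hu (hξ.1.smoothFieldAt isOpen_univ (mem_univ _))).differentiableAt
    (by simp)
  have h := hasFDerivAt_metric_apply (differentiableAt_coordMetric he hu) hs hs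
    (eventually_coordMetric_symm u) v
  have h1 : (fun y => coordMetric e y (comps e ξ y) (comps e ξ y)) =ᶠ[𝓝 u] fun _ => 1 := by
    filter_upwards [e.open_target.mem_nhds hu] with y hy
    rw [← inner_eq_coordMetric he hy, real_inner_self_eq_norm_sq, hunit, one_pow]
  rw [h1.fderiv_eq] at h
  simp only [fderiv_fun_const, Pi.zero_apply, _root_.zero_apply] at h
  linarith

/-- This is `∇_ξ ξ = 0`: the orbits of a unit Killing field are geodesics. -/
theorem covForm_unit_left {ξ : Π x : M, TangentSpace (𝓡 3) x}
    (hξ : IsKillingOn ξ univ) (hunit : ∀ x, ‖ξ x‖ = 1)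
    (he : e ∈ IsManifold.maximalAtlas (𝓡 3) ∞ M) {u : E3} (hu : u ∈ e.target) (v : E3) :
    covForm (coordMetric e) (comps e ξ) u (comps e ξ u) v = 0 := by
  rw [hξ.covForm_skew isOpen_univ he hu (mem_univ _), covForm_unit_right hξ hunit he hu, neg_zero]

end Killing

/-! ### Charts straightening a vector field -/

section FlowBox

variable {M : Type*} [TopologicalSpace M] [ChartedSpace E3 M] [IsManifold (𝓡 3) ∞ M]
  {e e₀ : OpenPartialHomeomorph M E3}

theorem frame_comp (he₀ : e₀ ∈ IsManifold.maximalAtlas (𝓡 3) ∞ M) {F : E3 → E3} {u : E3}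
    (hF : DifferentiableAt ℝ F u) (hFu : F u ∈ e₀.target)
    (hev : ∀ᶠ y in 𝓝 u, e.symm y = e₀.symm (F y)) (v : E3) :
    (frame e u v : E3) = frame e₀ (F u) (fderiv ℝ F u v) := by
  have h1 : mfderiv (𝓡 3) (𝓡 3) e.symm u = mfderiv (𝓡 3) (𝓡 3) (e₀.symm ∘ F) u :=
    Filter.EventuallyEq.mfderiv_eq hev
  have h2 := mfderiv_comp u
    ((contMDiffAt_symm_of_mem_maximalAtlas he₀ hFu).mdifferentiableAt (by simp))
    hF.mdifferentiableAt
  have h3 := congrArg (fun L : E3 →L[ℝ] E3 => L v) (h1.trans h2)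
  refine Eq.trans h3 ?_
  change frame e₀ (F u) (mfderiv (𝓡 3) (𝓡 3) F u v) = _
  exact congrArg (frame e₀ (F u)) (congrArg (fun L : E3 →L[ℝ] E3 => L v) mfderiv_eq_fderiv)

theorem comps_of_fderiv_eq (he : e ∈ IsManifold.maximalAtlas (𝓡 3) ∞ M)
    (he₀ : e₀ ∈ IsManifold.maximalAtlas (𝓡 3) ∞ M) {F : E3 → E3} {u : E3} (hu : u ∈ e.target)
    (hF : DifferentiableAt ℝ F u) (hFu : F u ∈ e₀.target)
    (hev : ∀ᶠ y in 𝓝 u, e.symm y = e₀.symm (F y)) {V : Π x : M, TangentSpace (𝓡 3) x} {v : E3}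
    (hv : fderiv ℝ F u v = comps e₀ V (F u)) : comps e V u = v := by
  refine comps_eq_of_frame_eq he hu ?_
  have h1 := frame_comp he₀ hF hFu hev v
  rw [hv, frame_comps he₀ hFu] at h1
  exact h1.trans (congrArg (fun x => (V x : E3)) hev.self_of_nhds.symm)

/-- The standard basis of coordinate space. -/
abbrev basisVec (i : Fin 3) : E3 := EuclideanSpace.single i 1

/-- A chart straightening the vector field `X`, with prescribed slice `T`. -/
theorem exists_flowBox (he₀ : e₀ ∈ IsManifold.maximalAtlas (𝓡 3) ∞ M) {p : M} (hp : p ∈ e₀.source)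
    {X : Π x : M, TangentSpace (𝓡 3) x} (hX : SmoothFieldOn X univ) (i : Fin 3) {T : E3 → E3}
    (hT : ∀ᶠ u in 𝓝 0, ContDiffAt ℝ ∞ T u) (hT0 : T 0 = e₀ p)
    (hTi : ∀ u (t : ℝ), T (u + t • basisVec i) = T u)
    (hinj : ∀ v : E3, fderiv ℝ T 0 v + v i • comps e₀ X (e₀ p) = 0 → v = 0)
    {W : Set E3} (hW : W ∈ 𝓝 0) :
    ∃ e ∈ IsManifold.maximalAtlas (𝓡 3) ∞ M, ∃ ε > 0, e.target = Metric.ball 0 ε ∧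
      Metric.ball 0 ε ⊆ W ∧ p ∈ e.source ∧ e p = 0 ∧
      (∀ u ∈ Metric.ball (0 : E3) ε, comps e X u = basisVec i) ∧
      ∀ u ∈ Metric.ball (0 : E3) ε, u i = 0 → e.symm u = e₀.symm (T u) := by
  have hn : (∞ : WithTop ℕ∞) ≠ 0 := by simp
  set x₀ := e₀ p with hx₀
  have hx₀t : x₀ ∈ e₀.target := e₀.map_source hp
  have hXs : ContDiffOn ℝ ∞ (comps e₀ X) e₀.target := fun u hu =>
    (contDiffAt_comps he₀ hu (hX.smoothFieldAt isOpen_univ (mem_univ _))).contDiffWithinAt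
  obtain ⟨φ, hφs, hφ0, hφ⟩ := exists_smooth_flow (comps e₀ X) x₀ (e₀.open_target.mem_nhds hx₀t) hXs
  let pr : E3 →L[ℝ] ℝ := EuclideanSpace.proj i
  -- Start on the slice `T` and flow for time `u i`. As `T` ignores the `i`-th coordinate, moving
  -- along that axis changes only the flow time.
  let F : E3 → E3 := fun u => φ (T u, pr u)
  have hTc : ContinuousAt (fun u => (T u, pr u)) 0 :=
    hT.self_of_nhds.continuousAt.prodMk pr.continuous.continuousAt
  have hT00 : (fun u => (T u, pr u)) 0 = (x₀, 0) := by simp [hT0]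
  have htend : Tendsto (fun u => (T u, pr u)) (𝓝 0) (𝓝 (x₀, 0)) := by
    rw [← hT00]; exact hTc
  have hFs : ∀ᶠ u in 𝓝 0, ContDiffAt ℝ ∞ F u := by
    filter_upwards [hT, htend.eventually hφs] with u h1 h2
    exact h2.comp u (h1.prodMk pr.contDiff.contDiffAt)
  have hF0 : F 0 = x₀ := by simp [F, hT0, hφ0]
  have hFd : ∀ v, fderiv ℝ F 0 v = fderiv ℝ T 0 v + v i • comps e₀ X x₀ := by
    intro v
    have hφd := (hφs.self_of_nhds.differentiableAt hn).hasFDerivAt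
    set L := fderiv ℝ φ (x₀, 0)
    -- The differential of the flow at time zero is the identity in space and `X` in time. This
    -- makes the hypothesis `hinj` the exact condition for `F` to be a local diffeomorphism.
    have hL1 : ∀ w, L (w, 0) = w := by
      intro w
      have h1 : HasFDerivAt (fun x => φ (x, (0 : ℝ))) (L ∘L .inl ℝ E3 ℝ) x₀ :=
        hφd.comp x₀ (hasFDerivAt_prodMk_left x₀ (0 : ℝ))
      have h2 : HasFDerivAt (fun x => φ (x, (0 : ℝ))) (ContinuousLinearMap.id ℝ E3) x₀ := by
        refine (hasFDerivAt_id x₀).congr_of_eventuallyEq ?_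
        have : Tendsto (fun x : E3 => (x, (0 : ℝ))) (𝓝 x₀) (𝓝 (x₀, 0)) :=
          (Continuous.prodMk_left (0 : ℝ)).tendsto x₀
        filter_upwards [this.eventually hφ] with x hx
        exact hx.1
      exact congrArg (fun A : E3 →L[ℝ] E3 => A w) (h1.unique h2)
    have hL2 : ∀ s : ℝ, L (0, s) = s • comps e₀ X x₀ := by
      intro s
      have h1 : HasFDerivAt (fun t : ℝ => φ (x₀, t)) (L ∘L .inr ℝ E3 ℝ) 0 :=
        hφd.comp (0 : ℝ) (hasFDerivAt_prodMk_right x₀ (0 : ℝ))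
      have h2 := hφ.self_of_nhds.2.hasFDerivAt
      simp only [hφ0] at h2
      simpa using congrArg (fun A : ℝ →L[ℝ] E3 => A s) (h1.unique h2)
    have hcomp : HasFDerivAt F (L ∘L ((fderiv ℝ T 0).prod pr)) 0 := by
      have h1 := (hT.self_of_nhds.differentiableAt hn).hasFDerivAt.prodMk (pr.hasFDerivAt (x := 0))
      have h2 : HasFDerivAt φ L ((fun u => (T u, pr u)) 0) := by rw [hT00]; exact hφd
      exact h2.comp (0 : E3) h1
    rw [hcomp.fderiv]
    have h3 : (L ∘L ((fderiv ℝ T 0).prod pr)) v = L ((fderiv ℝ T 0 v, 0) + (0, v i)) := by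
      simp [pr]
    rw [h3, map_add, hL1, hL2]
  have hinv : (fderiv ℝ F 0).IsInvertible := by
    refine isInvertible_of_injective _ ((injective_iff_map_eq_zero _).2 fun v hv => ?_) rfl
    exact hinj v (by rw [← hFd, hv])
  have hW' : W ∩ {u | (φ ((T u), 0) = T u) ∧ HasDerivAt (fun t => φ (T u, t))
      (comps e₀ X (F u)) (u i)} ∈ 𝓝 (0 : E3) := inter_mem hW (htend.eventually hφ)
  obtain ⟨e, he, ε, hε, htgt, hball, hpe, hep, hsymm⟩ :=
    exists_chart he₀ hp hFs hF0 hinv hW'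
  refine ⟨e, he, ε, hε, htgt, hball.trans inter_subset_left, hpe, hep, fun u hu => ?_,
    fun u hu hui => ?_⟩
  · obtain ⟨h1, h2, h3⟩ := hsymm u hu
    have hFdiff := h1.differentiableAt hn
    refine comps_of_fderiv_eq he he₀ (htgt ▸ hu) hFdiff h2 ?_ ?_
    · filter_upwards [Metric.isOpen_ball.mem_nhds hu] with y hy
      exact (hsymm y hy).2.2
    · have h4 : HasDerivAt (fun t : ℝ => F (u + t • basisVec i)) (fderiv ℝ F u (basisVec i)) 0 := by
        have h5 : HasDerivAt (fun t : ℝ => u + t • basisVec i) (basisVec i) 0 := by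
          simpa using ((hasDerivAt_id (0 : ℝ)).smul_const (basisVec i)).const_add u
        have h6 : HasFDerivAt F (fderiv ℝ F u) (u + (0 : ℝ) • basisVec i) := by
          simpa using hFdiff.hasFDerivAt
        exact h6.comp_hasDerivAt 0 h5
      have h7 : HasDerivAt (fun t : ℝ => F (u + t • basisVec i)) (comps e₀ X (F u)) 0 := by
        have h8 := (hball hu).2.2
        have h9 : HasDerivAt (fun t : ℝ => u i + t) 1 0 := (hasDerivAt_id (0 : ℝ)).const_add (u i)
        have h10 : HasDerivAt (fun t => φ (T u, t)) (comps e₀ X (F u)) (u i + 0) := by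
          rwa [add_zero]
        have h11 := h10.scomp (0 : ℝ) h9
        rw [one_smul] at h11
        refine h11.congr_of_eventuallyEq (Eventually.of_forall fun t => ?_)
        simp [F, pr, hTi]
      exact h4.unique h7
  · rw [(hsymm u hu).2.2]
    congr 1
    have : pr u = 0 := hui
    simp only [F, this]
    exact (hball hu).2.1

end FlowBox

/-! ### The coordinate plane in coordinate space -/

section LinearPreliminaries

/-- The inclusion of the coordinate plane `u₂ = 0`. -/
def incl : E2 →L[ℝ] E3 :=
  LinearMap.toContinuousLinearMap
    { toFun := fun c => c 0 • basisVec 0 + c 1 • basisVec 1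
      map_add' := fun c d => by simp only [PiLp.add_apply, add_smul]; abel
      map_smul' := fun a c => by
        simp only [PiLp.smul_apply, smul_eq_mul, mul_smul, smul_add, RingHom.id_apply] }

/-- The projection to the coordinate plane `u₂ = 0`. -/
def planeProj : E3 →L[ℝ] E2 :=
  LinearMap.toContinuousLinearMap
    { toFun := fun u => u 0 • EuclideanSpace.single 0 1 + u 1 • EuclideanSpace.single 1 1
      map_add' := fun c d => by simp only [PiLp.add_apply, add_smul]; abel
      map_smul' := fun a c => by
        simp only [PiLp.smul_apply, smul_eq_mul, mul_smul, smul_add, RingHom.id_apply] }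

theorem incl_apply (c : E2) : incl c = c 0 • basisVec 0 + c 1 • basisVec 1 := rfl

@[simp] theorem incl_apply_zero (c : E2) : incl c 0 = c 0 := by simp [incl_apply]
@[simp] theorem incl_apply_one (c : E2) : incl c 1 = c 1 := by simp [incl_apply]
@[simp] theorem incl_apply_two (c : E2) : incl c 2 = 0 := by simp [incl_apply]

theorem planeProj_apply (u : E3) : planeProj u =
    u 0 • (EuclideanSpace.single 0 1 : E2) + u 1 • (EuclideanSpace.single 1 1 : E2) := rfl

@[simp] theorem planeProj_apply_zero (u : E3) : planeProj u 0 = u 0 := by simp [planeProj_apply]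
@[simp] theorem planeProj_apply_one (u : E3) : planeProj u 1 = u 1 := by simp [planeProj_apply]

@[simp] theorem planeProj_incl (c : E2) : planeProj (incl c) = c := by
  ext i; fin_cases i <;> simp

theorem incl_planeProj (u : E3) : incl (planeProj u) = u - u 2 • basisVec 2 := by
  ext i; fin_cases i <;> simp

theorem incl_planeProj_of_eq_zero {u : E3} (hu : u 2 = 0) : incl (planeProj u) = u := by
  rw [incl_planeProj, hu, zero_smul, sub_zero]

theorem incl_injective : Function.Injective incl :=
  Function.LeftInverse.injective planeProj_incl

theorem eq_incl_add (u : E3) : u = incl (planeProj u) + u 2 • basisVec 2 := by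
  rw [incl_planeProj, sub_add_cancel]

theorem norm_incl (c : E2) : ‖incl c‖ = ‖c‖ := by
  rw [EuclideanSpace.norm_eq, EuclideanSpace.norm_eq, Fin.sum_univ_three, Fin.sum_univ_two]
  simp

theorem incl_mem_ball {c : E2} {ε : ℝ} :
    incl c ∈ Metric.ball (0 : E3) ε ↔ c ∈ Metric.ball (0 : E2) ε := by
  rw [mem_ball_zero_iff, mem_ball_zero_iff, norm_incl]

theorem norm_incl_planeProj_le (u : E3) : ‖incl (planeProj u)‖ ≤ ‖u‖ := by
  rw [EuclideanSpace.norm_eq, EuclideanSpace.norm_eq, Fin.sum_univ_three, Fin.sum_univ_three]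
  refine Real.sqrt_le_sqrt ?_
  simp only [incl_apply_zero, incl_apply_one, incl_apply_two, planeProj_apply_zero,
    planeProj_apply_one, norm_zero]
  nlinarith [sq_nonneg ‖u 2‖]

end LinearPreliminaries

/-! ### The normal direction of a coordinate plane -/

section Gradient

variable {G : E3 → E3 →L[ℝ] E3 →L[ℝ] ℝ} {u : E3}

/-- The gradient of the coordinate `u₂`. -/
def grad (G : E3 → E3 →L[ℝ] E3 →L[ℝ] ℝ) (u : E3) : E3 :=
  (G u).inverse (EuclideanSpace.proj 2)

/-- Definiteness makes the map into the dual injective, and the dimensions agree. -/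
theorem isInvertible_metric (hpos : ∀ v, v ≠ 0 → 0 < G u v v) : (G u).IsInvertible := by
  refine isInvertible_of_injective _ ((injective_iff_map_eq_zero _).2 fun v hv => ?_) ?_
  · by_contra h
    have := hpos v h
    rw [hv] at this
    exact lt_irrefl _ this
  · have h1 : Module.finrank ℝ (E3 →L[ℝ] ℝ) = Module.finrank ℝ (E3 →ₗ[ℝ] ℝ) :=
      (LinearMap.toContinuousLinearMap (𝕜 := ℝ) (E := E3) (F' := ℝ)).finrank_eq.symm
    rw [h1]
    exact Subspace.dual_finrank_eq

theorem metric_grad (hpos : ∀ v, v ≠ 0 → 0 < G u v v) (w : E3) : G u (grad G u) w = w 2 := by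
  obtain ⟨b, hb⟩ := isInvertible_metric hpos
  have : G u (grad G u) = EuclideanSpace.proj 2 := by
    rw [grad, ← hb, ContinuousLinearMap.inverse_equiv]
    exact b.apply_symm_apply _
  rw [this]
  rfl

theorem contDiffAt_grad (hpos : ∀ v, v ≠ 0 → 0 < G u v v) (hG : ContDiffAt ℝ ∞ G u) :
    ContDiffAt ℝ ∞ (grad G) u := by
  obtain ⟨b, hb⟩ := isInvertible_metric hpos
  have h1 : ContDiffAt ℝ ∞ (fun y => (G y).inverse) u :=
    ContDiffAt.comp u (g := ContinuousLinearMap.inverse)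
      (by rw [← hb]; exact contDiffAt_map_inverse b) hG
  exact h1.clm_apply contDiffAt_const

theorem grad_ne_zero (hpos : ∀ v, v ≠ 0 → 0 < G u v v) : grad G u ≠ 0 := by
  intro h
  have := metric_grad hpos (basisVec 2)
  rw [h] at this
  simp at this

/-- The third component of the gradient is its squared length. -/
theorem grad_apply_two_pos (hpos : ∀ v, v ≠ 0 → 0 < G u v v) : 0 < grad G u 2 := by
  rw [← metric_grad hpos]
  exact hpos _ (grad_ne_zero hpos)

theorem metric_grad_incl (hpos : ∀ v, v ≠ 0 → 0 < G u v v) (c : E2) :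
    G u (grad G u) (incl c) = 0 := by
  rw [metric_grad hpos, incl_apply_two]

/-- A vector normal to the coordinate plane is a multiple of the gradient. -/
theorem eq_smul_grad (hpos : ∀ v, v ≠ 0 → 0 < G u v v) {n : E3}
    (hn : ∀ c, G u n (incl c) = 0) : n = G u n (basisVec 2) • grad G u := by
  obtain ⟨b, hb⟩ := isInvertible_metric hpos
  apply b.injective
  have h : ∀ v, b v = G u v := fun v => by rw [← hb]; rfl
  rw [h, h]
  ext w
  rw [map_smul, _root_.smul_apply, metric_grad hpos, smul_eq_mul]
  conv_lhs => rw [eq_incl_add w, map_add, hn, zero_add, map_smul, smul_eq_mul, mul_comm]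

/-- The unit normal field of the coordinate planes `u₂ = const`. -/
def unitNormal (G : E3 → E3 →L[ℝ] E3 →L[ℝ] ℝ) (u : E3) : E3 :=
  (Real.sqrt (grad G u 2))⁻¹ • grad G u

theorem metric_unitNormal_self (hpos : ∀ v, v ≠ 0 → 0 < G u v v) :
    G u (unitNormal G u) (unitNormal G u) = 1 := by
  have h := grad_apply_two_pos hpos
  have h2 := Real.sq_sqrt h.le
  have h3 := Real.sqrt_pos.2 h
  simp only [unitNormal, map_smul, _root_.smul_apply, metric_grad hpos, smul_eq_mul]
  field_simp
  exact h2.symm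

theorem metric_unitNormal_incl (hpos : ∀ v, v ≠ 0 → 0 < G u v v) (c : E2) :
    G u (unitNormal G u) (incl c) = 0 := by
  simp only [unitNormal, map_smul, _root_.smul_apply, metric_grad_incl hpos, smul_zero]

theorem contDiffAt_unitNormal (hpos : ∀ v, v ≠ 0 → 0 < G u v v) (hG : ContDiffAt ℝ ∞ G u) :
    ContDiffAt ℝ ∞ (unitNormal G) u := by
  have h1 := contDiffAt_grad hpos hG
  have h2 : ContDiffAt ℝ ∞ (fun y => grad G y 2) u :=
    (EuclideanSpace.proj (𝕜 := ℝ) (2 : Fin 3)).contDiff.contDiffAt.comp u h1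
  have h := grad_apply_two_pos hpos
  exact ((h2.sqrt h.ne').inv (Real.sqrt_pos.2 h).ne').smul h1

end Gradient

/-! ### Coordinate planes as surfaces -/

section PlaneSurface

/-- The plane, as a surface. -/
abbrev planeSurface : Surface := ⟨E2⟩

variable {M : Type*} [TopologicalSpace M] [ChartedSpace E3 M] [IsManifold (𝓡 3) ∞ M]
  {e : OpenPartialHomeomorph M E3} {ε : ℝ}

/-- The diffeomorphism of the plane onto a disc. -/
abbrev disc (ε : ℝ) : E2 → E2 := OpenPartialHomeomorph.univBall (0 : E2) ε

theorem disc_mem (hε : 0 < ε) (r : E2) : disc ε r ∈ Metric.ball (0 : E2) ε := by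
  rw [← OpenPartialHomeomorph.univBall_target (0 : E2) hε]
  exact (OpenPartialHomeomorph.univBall (0 : E2) ε).map_source (by simp)

theorem fderiv_disc_bijective (hε : 0 < ε) (r : E2) :
    Function.Bijective (fderiv ℝ (disc ε) r) := by
  have hd : HasFDerivAt (disc ε) (fderiv ℝ (disc ε) r) r :=
    ((OpenPartialHomeomorph.contDiff_univBall (n := 1)).differentiable (by simp) r).hasFDerivAt
  have hs : DifferentiableAt ℝ (OpenPartialHomeomorph.univBall (0 : E2) ε).symm (disc ε r) :=
    ((OpenPartialHomeomorph.contDiffOn_univBall_symm (n := 1)).contDiffAt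
      (Metric.isOpen_ball.mem_nhds (disc_mem hε r))).differentiableAt (by simp)
  have hc := hs.hasFDerivAt.comp r hd
  have hid : HasFDerivAt ((OpenPartialHomeomorph.univBall (0 : E2) ε).symm ∘ disc ε)
      (ContinuousLinearMap.id ℝ E2) r := by
    refine (hasFDerivAt_id r).congr_of_eventuallyEq (Eventually.of_forall fun y => ?_)
    exact (OpenPartialHomeomorph.univBall (0 : E2) ε).left_inv (by simp)
  have heq := hc.unique hid
  have hinj : Function.Injective (fderiv ℝ (disc ε) r) := by
    refine Function.LeftInverse.injective
      (g := fderiv ℝ (OpenPartialHomeomorph.univBall (0 : E2) ε).symm (disc ε r)) fun v => ?_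
    exact congrArg (fun L : E2 →L[ℝ] E2 => L v) heq
  exact ⟨hinj, LinearMap.surjective_of_injective (f := (fderiv ℝ (disc ε) r).toLinearMap) hinj⟩

/-- The part of the coordinate plane `u₂ = 0` in a disc, parametrized by the plane. -/
def planeMap (e : OpenPartialHomeomorph M E3) (ε : ℝ) (r : E2) : M :=
  e.symm (incl (disc ε r))

theorem contDiff_incl_disc : ContDiff ℝ ∞ fun r : E2 => incl (disc ε r) :=
  incl.contDiff.comp OpenPartialHomeomorph.contDiff_univBall

theorem incl_disc_mem (hε : 0 < ε) (ht : e.target = Metric.ball 0 ε) (r : E2) :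
    incl (disc ε r) ∈ e.target := by
  rw [ht, incl_mem_ball]; exact disc_mem hε r

theorem contMDiff_planeMap (he : e ∈ IsManifold.maximalAtlas (𝓡 3) ∞ M) (hε : 0 < ε)
    (ht : e.target = Metric.ball 0 ε) : ContMDiff (𝓡 2) (𝓡 3) ∞ (planeMap e ε) := by
  intro r
  exact (contMDiffAt_symm_of_mem_maximalAtlas he (incl_disc_mem hε ht r)).comp (I := 𝓡 2)
    (I' := 𝓡 3) r (contDiff_incl_disc.contMDiff (E := E2) (E' := E3) r)

theorem mfderiv_planeMap (he : e ∈ IsManifold.maximalAtlas (𝓡 3) ∞ M) (hε : 0 < ε)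
    (ht : e.target = Metric.ball 0 ε) (r : E2) (v : TangentSpace (𝓡 2) r) :
    mfderiv (𝓡 2) (𝓡 3) (planeMap e ε) r v =
      frame e (incl (disc ε r)) (incl (fderiv ℝ (disc ε) r v)) := by
  have h1 := mfderiv_comp (I := 𝓡 2) (I' := 𝓡 3) (I'' := 𝓡 3) (r : E2) (g := e.symm)
    (f := fun r : E2 => incl (disc ε r))
    ((contMDiffAt_symm_of_mem_maximalAtlas he (incl_disc_mem hε ht r)).mdifferentiableAt (by simp))
    ((contDiff_incl_disc.differentiable (by simp)) (r : E2)).mdifferentiableAt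
  have h2 : fderiv ℝ (fun r : E2 => incl (disc ε r)) r = incl ∘L fderiv ℝ (disc ε) r :=
    (incl.hasFDerivAt.comp (r : E2) ((OpenPartialHomeomorph.contDiff_univBall (n := 1)).differentiable
      (by simp) r).hasFDerivAt).fderiv
  have h3 : mfderiv (𝓡 2) (𝓡 3) (fun r : E2 => incl (disc ε r)) (r : E2) v =
      incl (fderiv ℝ (disc ε) r v) :=
    (congrArg (fun L : E2 →L[ℝ] E3 => L v) mfderiv_eq_fderiv).trans
      (congrArg (fun L : E2 →L[ℝ] E3 => L v) h2)
  refine (congrArg (fun L : E2 →L[ℝ] E3 => L v) h1).trans ?_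
  exact congrArg (frame e (incl (disc ε r))) h3

theorem planeMap_zero {p : M} (hp : p ∈ e.source)
    (hep : e p = 0) : planeMap e ε (0 : E2) = p := by
  rw [planeMap, disc, OpenPartialHomeomorph.univBall_apply_zero, map_zero, ← hep, e.left_inv hp]

theorem tangentAt_planeMap (he : e ∈ IsManifold.maximalAtlas (𝓡 3) ∞ M) (hε : 0 < ε)
    (ht : e.target = Metric.ball 0 ε) (ξ : Π x : M, TangentSpace (𝓡 3) x) (r : E2) :
    TangentAt (S := planeSurface) (planeMap e ε) ξ r ↔ comps e ξ (incl (disc ε r)) 2 = 0 := by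
  have hu := incl_disc_mem (ε := ε) hε ht r
  constructor
  · rintro ⟨v, hv⟩
    rw [mfderiv_planeMap he hε ht] at hv
    rw [comps_eq_of_frame_eq he hu hv, incl_apply_two]
  · intro h
    obtain ⟨v, hv⟩ := (fderiv_disc_bijective hε r).2 (planeProj (comps e ξ (incl (disc ε r))))
    refine ⟨v, ?_⟩
    refine (mfderiv_planeMap he hε ht r v).trans ?_
    rw [hv, incl_planeProj_of_eq_zero h, frame_comps he hu]
    rfl

variable [RiemannianBundle (fun x : M => TangentSpace (𝓡 3) x)]

theorem orthogonalAt_planeMap (he : e ∈ IsManifold.maximalAtlas (𝓡 3) ∞ M) (hε : 0 < ε)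
    (ht : e.target = Metric.ball 0 ε) (ξ : Π x : M, TangentSpace (𝓡 3) x) (r : E2) :
    OrthogonalAt (S := planeSurface) (planeMap e ε) ξ r ↔ ∀ c, coordMetric e (incl (disc ε r))
      (comps e ξ (incl (disc ε r))) (incl c) = 0 := by
  have hu := incl_disc_mem (ε := ε) hε ht r
  have key : ∀ v : TangentSpace (𝓡 2) r,
      inner ℝ (ξ (planeMap e ε r)) (mfderiv (𝓡 2) (𝓡 3) (planeMap e ε) r v) =
      coordMetric e (incl (disc ε r)) (comps e ξ (incl (disc ε r)))
        (incl (fderiv ℝ (disc ε) r v)) := by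
    intro v
    rw [mfderiv_planeMap he hε ht, coordMetric_apply, frame_comps he hu]
    rfl
  constructor
  · intro h c
    obtain ⟨v, hv⟩ := (fderiv_disc_bijective hε r).2 c
    rw [← hv]
    exact (key v).symm.trans (h v)
  · intro h v
    rw [key]
    exact h _

variable [IsContMDiffRiemannianBundle (𝓡 3) ∞ E3 (fun x : M => TangentSpace (𝓡 3) x)]

/-- If the second fundamental form of a coordinate plane vanishes, the plane is totally geodesic. -/
theorem isTotallyGeodesic_planeMap (he : e ∈ IsManifold.maximalAtlas (𝓡 3) ∞ M) (hε : 0 < ε)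
    (ht : e.target = Metric.ball 0 ε)
    (hII : ∀ c ∈ Metric.ball (0 : E2) ε, ∀ v w : E2, covForm (coordMetric e) (fun _ => incl w)
      (incl c) (incl v) (grad (coordMetric e) (incl c)) = 0) :
    IsTotallyGeodesic (S := planeSurface) (planeMap e ε) := by
  have hpos : ∀ u ∈ e.target, ∀ v, v ≠ 0 → 0 < coordMetric e u v v := fun u hu v hv =>
    coordMetric_pos he hu hv
  set N := ofComps e (unitNormal (coordMetric e)) with hN
  have hNs : SmoothFieldOn N e.source := smoothFieldOn_of_smoothFieldAt fun x hx => by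
    rw [← e.left_inv hx]
    exact smoothFieldAt_ofComps he (e.map_source hx) (contDiffAt_unitNormal
      (hpos _ (e.map_source hx)) (contDiffAt_coordMetric he (e.map_source hx)))
  refine ⟨contMDiff_planeMap he hε ht, fun r => ?_, fun r => ?_⟩
  · refine (injective_iff_map_eq_zero _).2 fun v hv => ?_
    rw [mfderiv_planeMap he hε ht] at hv
    have h1 := frame_injective he (incl_disc_mem hε ht r) (hv.trans (map_zero _).symm)
    have h2 := incl_injective (h1.trans (map_zero _).symm)
    exact (fderiv_disc_bijective hε r).1 (h2.trans (map_zero _).symm)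
  · have hmem : ∀ r : E2, planeMap e ε r ∈ e.source := fun r =>
      e.map_target (incl_disc_mem hε ht r)
    refine ⟨e.source, N, e.open_source, hmem r, hNs, Eventually.of_forall fun r => ⟨?_, fun v => ?_⟩,
      fun v => ?_⟩
    · have hu := incl_disc_mem (ε := ε) hε ht r
      have h1 : inner ℝ (N (planeMap e ε r)) (N (planeMap e ε r)) = (1 : ℝ) := by
        refine (inner_eq_coordMetric he hu N N).trans ?_
        rw [comps_ofComps he hu, metric_unitNormal_self (hpos _ hu)]
      rw [real_inner_self_eq_norm_sq] at h1
      exact (pow_eq_one_iff_of_nonneg (norm_nonneg _) two_ne_zero).1 h1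
    · have hu := incl_disc_mem (ε := ε) hε ht r
      rw [mfderiv_planeMap he hε ht]
      have h1 : N (planeMap e ε r) = frame e _ (comps e N (incl (disc ε r))) :=
        (frame_comps he hu N).symm
      rw [h1]
      refine (coordMetric_apply (e := e) _ _ _).symm.trans ?_
      rw [comps_ofComps he hu, metric_unitNormal_incl (hpos _ hu)]
    · have hu := incl_disc_mem (ε := ε) hε ht r
      set u := incl (disc ε r) with hu_def
      set n := unitNormal (coordMetric e) with hn
      rw [mfderiv_planeMap he hε ht]
      set a := fderiv ℝ (disc ε) r v
      have hGd := differentiableAt_coordMetric he hu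
      have hnd : DifferentiableAt ℝ n u :=
        (contDiffAt_unitNormal (hpos u hu) (contDiffAt_coordMetric he hu)).differentiableAt (by simp)
      have hNc : comps e N =ᶠ[𝓝 u] n := by
        filter_upwards [e.open_target.mem_nhds hu] with y hy
        exact comps_ofComps he hy n
      have hcov : ∀ w, covForm (coordMetric e) (comps e N) u (incl a) w =
          covForm (coordMetric e) n u (incl a) w := by
        intro w
        simp only [covForm, hNc.fderiv_eq, hNc.self_of_nhds]
      -- Differentiating `⟨n, w⟩ = 0` shows that the tangential part of `∇_a n` is minus the second
      -- fundamental form.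
      have h1 : ∀ w : E2, covForm (coordMetric e) n u (incl a) (incl w) = 0 := by
        intro w
        have h := hasFDerivAt_metric_apply (Y := n) (Z := fun _ => incl w) hGd hnd
          (differentiableAt_const _) (eventually_coordMetric_symm u) (incl a)
        have hz : (fun y => coordMetric e y (n y) (incl w)) =ᶠ[𝓝 u] fun _ => 0 := by
          filter_upwards [e.open_target.mem_nhds hu] with y hy
          exact metric_unitNormal_incl (hpos y hy) w
        rw [hz.fderiv_eq] at h
        have h3 : covForm (coordMetric e) (fun _ => incl w) u (incl a) (n u) = 0 := by
          simp only [hn, unitNormal]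
          rw [covForm_smul_right, hII _ (disc_mem hε r), smul_zero]
        simp only [fderiv_fun_const, Pi.zero_apply, _root_.zero_apply, h3] at h
        linarith
      -- Differentiating `⟨n, n⟩ = 1` shows that `∇_a n` has no normal part.
      have h2 : covForm (coordMetric e) n u (incl a) (n u) = 0 := by
        have h := hasFDerivAt_metric_apply (Y := n) (Z := n) hGd hnd
          hnd (eventually_coordMetric_symm u) (incl a)
        have hz : (fun y => coordMetric e y (n y) (n y)) =ᶠ[𝓝 u] fun _ => 1 := by
          filter_upwards [e.open_target.mem_nhds hu] with y hy
          exact metric_unitNormal_self (hpos y hy)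
        rw [hz.fderiv_eq] at h
        simp only [fderiv_fun_const, Pi.zero_apply, _root_.zero_apply] at h
        linarith
      have hall : ∀ w, covForm (coordMetric e) n u (incl a) w = 0 := by
        intro w
        have hn2 : n u 2 ≠ 0 := by
          have := grad_apply_two_pos (hpos u hu)
          simp only [hn, unitNormal, PiLp.smul_apply, smul_eq_mul]
          positivity
        have hw : w = incl (planeProj (w - (w 2 / n u 2) • n u)) + (w 2 / n u 2) • n u := by
          rw [incl_planeProj_of_eq_zero, sub_add_cancel]
          simp only [PiLp.sub_apply, PiLp.smul_apply, smul_eq_mul]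
          field_simp
          simp
        rw [hw, covForm_add_right, h1, covForm_smul_right, h2, smul_zero, add_zero]
      have hfin : ∀ z : TangentSpace (𝓡 3) (e.symm u),
          inner ℝ (nabla N (e.symm u) (frame e u (incl a))) z = 0 := by
        intro z
        obtain ⟨w, rfl⟩ := frame_surjective he hu z
        have h4 := two_inner_nabla he hu (hNs.smoothFieldAt e.open_source (hmem r)) (incl a) w
        rw [hcov, hall] at h4
        linarith
      exact ext_inner_right ℝ fun z => (hfin z).trans (inner_zero_left z).symm

end PlaneSurface

/-! ### Local parametrizations of a surface -/

section LocalParametrization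

/-- The parametrization of a surface around `q` by a chart, sending `0` to `q`. -/
def localParam {S : Surface} (q : S) (c : E2) : S := (chartAt E2 q).symm (chartAt E2 q q + c)

variable {S : Surface} (q : S)

theorem localParam_zero : localParam q 0 = q := by
  rw [localParam, add_zero]
  exact (chartAt E2 q).left_inv (mem_chart_source E2 q)

theorem eventually_mem_target :
    ∀ᶠ c in 𝓝 (0 : E2), chartAt E2 q q + c ∈ (chartAt E2 q).target := by
  have h : Continuous fun c : E2 => chartAt E2 q q + c := by fun_prop
  refine h.continuousAt.eventually ((chartAt E2 q).open_target.mem_nhds ?_)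
  beta_reduce
  rw [add_zero]
  exact mem_chart_target E2 q

variable {q} {c : E2}

theorem contMDiffAt_localParam (hc : chartAt E2 q q + c ∈ (chartAt E2 q).target) :
    ContMDiffAt (𝓡 2) (𝓡 2) ∞ (localParam q) c := by
  have h1 : ContMDiffAt (𝓡 2) (𝓡 2) ∞ (chartAt E2 q).symm (chartAt E2 q q + c) :=
    contMDiffAt_symm_of_mem_maximalAtlas (IsManifold.chart_mem_maximalAtlas q) hc
  have h2 : ContDiff ℝ ∞ fun c : E2 => chartAt E2 q q + c := contDiff_const.add contDiff_id
  exact h1.comp c h2.contMDiff.contMDiffAt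

theorem mfderiv_localParam_bijective (hc : chartAt E2 q q + c ∈ (chartAt E2 q).target) :
    Function.Bijective (mfderiv (𝓡 2) (𝓡 2) (localParam q) c) := by
  have h1 : MDifferentiableAt (𝓡 2) (𝓡 2) (chartAt E2 q).symm (chartAt E2 q q + c) :=
    (contMDiffAt_symm_of_mem_maximalAtlas (n := ∞)
      (IsManifold.chart_mem_maximalAtlas q) hc).mdifferentiableAt (by simp)
  have h2 : HasFDerivAt (fun c : E2 => chartAt E2 q q + c) (ContinuousLinearMap.id ℝ E2) c :=
    (hasFDerivAt_id c).const_add _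
  have h3 := mfderiv_comp c h1 h2.hasMFDerivAt.mdifferentiableAt
  rw [h2.hasMFDerivAt.mfderiv] at h3
  have h4 : Function.Bijective (mfderiv (𝓡 2) (𝓡 2) (chartAt E2 q).symm (chartAt E2 q q + c)) :=
    OpenPartialHomeomorph.MDifferentiable.mfderiv_bijective (mdifferentiable_chart q).symm hc
  have h5 : ⇑(mfderiv (𝓡 2) (𝓡 2) (localParam q) c) =
      mfderiv (𝓡 2) (𝓡 2) (chartAt E2 q).symm (chartAt E2 q q + c) := by
    ext1 v
    exact congrArg (fun L : E2 →L[ℝ] TangentSpace (𝓡 2) (localParam q c) => L v) h3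
  rw [h5]
  exact h4

end LocalParametrization

/-! ### Charts adapted to an immersed surface -/

section Immersion

theorem exists_notMem_range (D : E2 →L[ℝ] E3) : ∃ n : E3, ∀ c, D c ≠ n := by
  by_contra h
  push Not at h
  have h1 : LinearMap.range D.toLinearMap = ⊤ := eq_top_iff.2 fun x _ => h x
  have h2 := LinearMap.finrank_range_le D.toLinearMap
  rw [h1, finrank_top, finrank_euclideanSpace_fin, finrank_euclideanSpace_fin] at h2
  norm_num at h2

variable {M : Type*} [TopologicalSpace M] [ChartedSpace E3 M] [IsManifold (𝓡 3) ∞ M]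
  {e e₀ : OpenPartialHomeomorph M E3} {S : Surface} {q : S} {f : S → M}

theorem mfderiv_localParam_eq (he : e ∈ IsManifold.maximalAtlas (𝓡 3) ∞ M)
    (hf : ContMDiff (𝓡 2) (𝓡 3) ∞ f) {κ : E2 → E3} {c : E2}
    (hc : chartAt E2 q q + c ∈ (chartAt E2 q).target) (hκ : DifferentiableAt ℝ κ c)
    (hκe : κ c ∈ e.target) (hev : ∀ᶠ d in 𝓝 c, f (localParam q d) = e.symm (κ d)) (w : E2) :
    (mfderiv (𝓡 2) (𝓡 3) f (localParam q c) (mfderiv (𝓡 2) (𝓡 2) (localParam q) c w) : E3) =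
      frame e (κ c) (fderiv ℝ κ c w) := by
  have hn : (∞ : WithTop ℕ∞) ≠ 0 := by simp
  have h1 := mfderiv_comp c (hf.mdifferentiableAt hn)
    ((contMDiffAt_localParam hc).mdifferentiableAt hn)
  have h2 := mfderiv_comp c
    ((contMDiffAt_symm_of_mem_maximalAtlas he hκe).mdifferentiableAt hn)
    hκ.mdifferentiableAt
  have h3 : mfderiv (𝓡 2) (𝓡 3) (f ∘ localParam q) c = mfderiv (𝓡 2) (𝓡 3) (e.symm ∘ κ) c :=
    Filter.EventuallyEq.mfderiv_eq hev
  have h4 : (mfderiv (𝓡 2) (𝓡 3) (f ∘ localParam q) c w : E3) =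
      mfderiv (𝓡 2) (𝓡 3) (e.symm ∘ κ) c w := congrArg (fun L : E2 →L[ℝ] E3 => L w) h3
  have h5 := congrArg (fun L : E2 →L[ℝ] E3 => L w) h1
  have h6 := congrArg (fun L : E2 →L[ℝ] E3 => L w) h2
  refine h5.symm.trans (h4.trans (h6.trans ?_))
  change frame e (κ c) (mfderiv (𝓡 2) (𝓡 3) κ c w) = _
  exact congrArg (frame e (κ c)) (congrArg (fun L : E2 →L[ℝ] E3 => L w) mfderiv_eq_fderiv)

/-- The immersion `f` in the local parametrization and the chart `e₀`. -/
def localRep (e₀ : OpenPartialHomeomorph M E3) (f : S → M) (q : S) (c : E2) : E3 :=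
  e₀ (f (localParam q c))

theorem eventually_localRep (he₀ : e₀ ∈ IsManifold.maximalAtlas (𝓡 3) ∞ M)
    (hf : ContMDiff (𝓡 2) (𝓡 3) ∞ f) (hq : f q ∈ e₀.source) :
    ∀ᶠ c in 𝓝 (0 : E2), chartAt E2 q q + c ∈ (chartAt E2 q).target ∧
      ContDiffAt ℝ ∞ (localRep e₀ f q) c ∧ localRep e₀ f q c ∈ e₀.target ∧
      f (localParam q c) = e₀.symm (localRep e₀ f q c) := by
  have h1 : ContinuousAt (fun c => f (localParam q c)) 0 := by
    have h2 := (contMDiffAt_localParam (eventually_mem_target q).self_of_nhds).continuousAt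
    exact hf.continuous.continuousAt.comp h2
  have h3 : ∀ᶠ c in 𝓝 (0 : E2), f (localParam q c) ∈ e₀.source := by
    refine h1.eventually (e₀.open_source.mem_nhds ?_)
    beta_reduce
    rwa [localParam_zero]
  filter_upwards [eventually_mem_target q, h3] with c hc1 hc2
  refine ⟨hc1, ?_, e₀.map_source hc2, (e₀.left_inv hc2).symm⟩
  have h4 := (contMDiffAt_of_mem_maximalAtlas he₀ hc2).comp c
    (hf.contMDiffAt.comp c (contMDiffAt_localParam hc1))
  exact h4.contDiffAt

theorem tangentAt_of_fderiv_eq (he₀ : e₀ ∈ IsManifold.maximalAtlas (𝓡 3) ∞ M)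
    (hf : ContMDiff (𝓡 2) (𝓡 3) ∞ f) (hq : f q ∈ e₀.source) {ξ : Π x : M, TangentSpace (𝓡 3) x}
    {w : E2} (hw : fderiv ℝ (localRep e₀ f q) 0 w = comps e₀ ξ (e₀ (f q))) : TangentAt f ξ q := by
  have hev := eventually_localRep he₀ hf hq
  obtain ⟨h1, h2, h3, h4⟩ := hev.self_of_nhds
  have h5 := mfderiv_localParam_eq he₀ hf h1 (h2.differentiableAt (by simp)) h3
    (hev.mono fun _ h => h.2.2.2) w
  have h6 : localRep e₀ f q 0 = e₀ (f q) := by rw [localRep, localParam_zero]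
  rw [hw, h6, frame_comps he₀ (e₀.map_source hq)] at h5
  have h7 : TangentAt f ξ (localParam q 0) := by
    refine ⟨mfderiv (𝓡 2) (𝓡 2) (localParam q) 0 w, h5.trans ?_⟩
    refine congrArg (fun x => (ξ x : E3)) ?_
    rw [e₀.left_inv hq, localParam_zero]
  rwa [localParam_zero] at h7

theorem fderiv_localRep_injective (he₀ : e₀ ∈ IsManifold.maximalAtlas (𝓡 3) ∞ M)
    (hf : ContMDiff (𝓡 2) (𝓡 3) ∞ f) (hq : f q ∈ e₀.source)
    (hinj : ∀ q, Function.Injective (mfderiv (𝓡 2) (𝓡 3) f q)) :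
    Function.Injective (fderiv ℝ (localRep e₀ f q) 0) := by
  have hev := eventually_localRep he₀ hf hq
  obtain ⟨h1, h2, h3, h4⟩ := hev.self_of_nhds
  refine (injective_iff_map_eq_zero _).2 fun w hw => ?_
  have h5 := mfderiv_localParam_eq he₀ hf h1 (h2.differentiableAt (by simp)) h3
    (hev.mono fun _ h => h.2.2.2) w
  rw [hw, map_zero] at h5
  have h6 := hinj _ (h5.trans (map_zero (mfderiv (𝓡 2) (𝓡 3) f (localParam q 0))).symm)
  exact (mfderiv_localParam_bijective h1).1 (h6.trans (map_zero _).symm)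

theorem tendsto_planeProj : Tendsto planeProj (𝓝 0) (𝓝 0) := by
  have := planeProj.continuous.tendsto 0
  rwa [map_zero] at this

/-- Around a point where the field `ξ` is transversal to the surface `f`, there is a chart in which
`ξ` is the third coordinate field and the surface is the coordinate plane `u₂ = 0`. -/
theorem exists_chart_of_transversal (hf : ContMDiff (𝓡 2) (𝓡 3) ∞ f)
    (hinj : ∀ q, Function.Injective (mfderiv (𝓡 2) (𝓡 3) f q))
    {ξ : Π x : M, TangentSpace (𝓡 3) x} (hξ : SmoothFieldOn ξ univ) (hT : ¬ TangentAt f ξ q) :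
    ∃ e ∈ IsManifold.maximalAtlas (𝓡 3) ∞ M, ∃ ε > 0, e.target = Metric.ball 0 ε ∧
      f q ∈ e.source ∧ e (f q) = 0 ∧
      (∀ u ∈ Metric.ball (0 : E3) ε, comps e ξ u = basisVec 2) ∧
      ∀ c ∈ Metric.ball (0 : E2) ε, f (localParam q c) = e.symm (incl c) ∧
        chartAt E2 q q + c ∈ (chartAt E2 q).target := by
  have he₀ : chartAt E3 (f q) ∈ IsManifold.maximalAtlas (𝓡 3) ∞ M :=
    IsManifold.chart_mem_maximalAtlas _
  set e₀ := chartAt E3 (f q)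
  have hq : f q ∈ e₀.source := mem_chart_source _ _
  have hev := eventually_localRep he₀ hf hq
  have hσ0 : localRep e₀ f q 0 = e₀ (f q) := by rw [localRep, localParam_zero]
  have hd0 := (hev.self_of_nhds.2.1.differentiableAt (by simp)).hasFDerivAt
  -- The surface itself is the slice of the flow box. A kernel vector with nonzero third component
  -- would exhibit `ξ` as tangent to the surface.
  let T : E3 → E3 := fun u => localRep e₀ f q (planeProj u)
  have hTd : ∀ v, fderiv ℝ T 0 v = fderiv ℝ (localRep e₀ f q) 0 (planeProj v) := by
    intro v
    have h1 : HasFDerivAt (localRep e₀ f q) (fderiv ℝ (localRep e₀ f q) 0) (planeProj 0) := by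
      rw [map_zero]; exact hd0
    have h2 : HasFDerivAt T (fderiv ℝ (localRep e₀ f q) 0 ∘L planeProj) 0 :=
      h1.comp (0 : E3) planeProj.hasFDerivAt
    rw [h2.fderiv]
    rfl
  obtain ⟨e, he, ε, hε, ht, hW, hp, hep, hX, hsl⟩ := exists_flowBox he₀ hq hξ 2 (T := T)
    (by
      filter_upwards [tendsto_planeProj.eventually hev] with u hu
      exact hu.2.1.comp u planeProj.contDiff.contDiffAt)
    (by simp only [T, map_zero, hσ0])
    (by
      intro u t
      simp only [T]
      congr 1
      ext i
      fin_cases i <;> simp)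
    (by
      intro v hv
      rw [hTd] at hv
      by_cases h2 : v 2 = 0
      · rw [h2, zero_smul, add_zero] at hv
        have h3 := fderiv_localRep_injective he₀ hf hq hinj (hv.trans (map_zero _).symm)
        rw [eq_incl_add v, h3, h2, map_zero, zero_smul, add_zero]
      · refine absurd (tangentAt_of_fderiv_eq he₀ hf hq (w := (-(v 2)⁻¹) • planeProj v) ?_) hT
        rw [map_smul, eq_neg_of_add_eq_zero_left hv, neg_smul, smul_neg, neg_neg, smul_smul,
          inv_mul_cancel₀ h2, one_smul])
    (tendsto_planeProj.eventually hev)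
  refine ⟨e, he, ε, hε, ht, hp, hep, hX, fun c hc => ?_⟩
  have h1 := hW (incl_mem_ball.2 hc)
  simp only [mem_ofPred_eq, planeProj_incl] at h1
  refine ⟨?_, h1.1⟩
  rw [hsl _ (incl_mem_ball.2 hc) (incl_apply_two c)]
  simp only [T, planeProj_incl]
  exact h1.2.2.2

/-- A chart in which an immersed surface is the coordinate plane `u₂ = 0`. -/
theorem exists_chart_of_immersion (hf : ContMDiff (𝓡 2) (𝓡 3) ∞ f)
    (hinj : ∀ q, Function.Injective (mfderiv (𝓡 2) (𝓡 3) f q)) :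
    ∃ e ∈ IsManifold.maximalAtlas (𝓡 3) ∞ M, ∃ ε > 0, e.target = Metric.ball 0 ε ∧
      f q ∈ e.source ∧ e (f q) = 0 ∧
      ∀ c ∈ Metric.ball (0 : E2) ε, f (localParam q c) = e.symm (incl c) ∧
        chartAt E2 q q + c ∈ (chartAt E2 q).target := by
  have he₀ : chartAt E3 (f q) ∈ IsManifold.maximalAtlas (𝓡 3) ∞ M :=
    IsManifold.chart_mem_maximalAtlas _
  set e₀ := chartAt E3 (f q)
  have hq : f q ∈ e₀.source := mem_chart_source _ _
  have hev := eventually_localRep he₀ hf hq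
  have hσ0 : localRep e₀ f q 0 = e₀ (f q) := by rw [localRep, localParam_zero]
  have hd0 := (hev.self_of_nhds.2.1.differentiableAt (by simp)).hasFDerivAt
  set D := fderiv ℝ (localRep e₀ f q) 0 with hD
  have hDinj : Function.Injective D := fderiv_localRep_injective he₀ hf hq hinj
  obtain ⟨n, hn⟩ := exists_notMem_range D
  -- The surface is thickened along a fixed vector `n` outside its tangent plane at `q`.
  let F : E3 → E3 := fun u => localRep e₀ f q (planeProj u) + u 2 • n
  have hFd : HasFDerivAt F (D ∘L planeProj +
      (EuclideanSpace.proj (𝕜 := ℝ) (2 : Fin 3)).smulRight n) 0 := by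
    have h1 : HasFDerivAt (localRep e₀ f q) D (planeProj 0) := by
      rw [map_zero]; exact hd0
    exact (h1.comp (0 : E3) planeProj.hasFDerivAt).add
      ((EuclideanSpace.proj (𝕜 := ℝ) (2 : Fin 3)).smulRight n).hasFDerivAt
  obtain ⟨e, he, ε, hε, ht, hW, hp, hep, hs⟩ := exists_chart he₀ hq (F := F)
    (by
      filter_upwards [tendsto_planeProj.eventually hev] with u hu
      exact (hu.2.1.comp u planeProj.contDiff.contDiffAt).add
        ((EuclideanSpace.proj (𝕜 := ℝ) (2 : Fin 3)).smulRight n).contDiff.contDiffAt)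
    (by simp [F, hσ0])
    (by
      rw [hFd.fderiv]
      refine isInvertible_of_injective _ ((injective_iff_map_eq_zero _).2 fun v hv => ?_) rfl
      have hv' : D (planeProj v) + v 2 • n = 0 := hv
      by_cases h2 : v 2 = 0
      · rw [h2, zero_smul, add_zero] at hv'
        have h3 := hDinj (hv'.trans (map_zero _).symm)
        rw [eq_incl_add v, h3, h2, map_zero, zero_smul, add_zero]
      · refine absurd ?_ (hn ((-(v 2)⁻¹) • planeProj v))
        rw [map_smul, eq_neg_of_add_eq_zero_left hv', neg_smul, smul_neg, neg_neg, smul_smul,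
          inv_mul_cancel₀ h2, one_smul])
    (tendsto_planeProj.eventually hev)
  refine ⟨e, he, ε, hε, ht, hp, hep, fun c hc => ?_⟩
  have h1 := hW (incl_mem_ball.2 hc)
  simp only [mem_ofPred_eq, planeProj_incl] at h1
  refine ⟨?_, h1.1⟩
  rw [(hs _ (incl_mem_ball.2 hc)).2.2]
  simp only [F, planeProj_incl, incl_apply_two, zero_smul, add_zero]
  exact h1.2.2.2

/-- Tangent spaces at points only proved equal are compared through the common model space `E3`. The
same device serves for `nabla` below. -/
theorem inner_congr [RiemannianBundle (fun x : M => TangentSpace (𝓡 3) x)]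
    {x y : M} (h : x = y) {v w : TangentSpace (𝓡 3) x}
    {v' w' : TangentSpace (𝓡 3) y}
    (hv : (v : E3) = (v' : E3)) (hw : (w : E3) = (w' : E3)) :
    inner ℝ v w = (inner ℝ v' w' : ℝ) := by
  subst h
  have h1 : v = v' := hv
  have h2 : w = w' := hw
  rw [h1, h2]

theorem nabla_congr [RiemannianBundle (fun x : M => TangentSpace (𝓡 3) x)]
    {x y : M} (h : x = y) (N : Π x : M, TangentSpace (𝓡 3) x)
    {v : TangentSpace (𝓡 3) x} {v' : TangentSpace (𝓡 3) y}
    (hv : (v : E3) = (v' : E3)) (h0 : nabla N x v = 0) : nabla N y v' = 0 := by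
  subst h
  have h1 : v = v' := hv
  rw [← h1, h0]

section Consequences

variable {ε : ℝ}

theorem mfderiv_localParam_incl
    (he : e ∈ IsManifold.maximalAtlas (𝓡 3) ∞ M) (ht : e.target = Metric.ball 0 ε)
    (hf : ContMDiff (𝓡 2) (𝓡 3) ∞ f)
    (hpl : ∀ c ∈ Metric.ball (0 : E2) ε, f (localParam q c) = e.symm (incl c) ∧
      chartAt E2 q q + c ∈ (chartAt E2 q).target)
    {c : E2} (hc : c ∈ Metric.ball (0 : E2) ε) (w : E2) :
    (mfderiv (𝓡 2) (𝓡 3) f (localParam q c) (mfderiv (𝓡 2) (𝓡 2) (localParam q) c w) : E3) =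
      frame e (incl c) (incl w) := by
  have h := mfderiv_localParam_eq he hf (hpl c hc).2 incl.differentiableAt
    (by rw [ht]; exact incl_mem_ball.2 hc)
    (by
      filter_upwards [Metric.isOpen_ball.mem_nhds hc] with d hd
      exact (hpl d hd).1) w
  rwa [incl.fderiv] at h

theorem comps_two_of_tangentAt
    (he : e ∈ IsManifold.maximalAtlas (𝓡 3) ∞ M) (ht : e.target = Metric.ball 0 ε)
    (hf : ContMDiff (𝓡 2) (𝓡 3) ∞ f)
    (hpl : ∀ c ∈ Metric.ball (0 : E2) ε, f (localParam q c) = e.symm (incl c) ∧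
      chartAt E2 q q + c ∈ (chartAt E2 q).target)
    {ξ : Π x : M, TangentSpace (𝓡 3) x} {c : E2}
    (hc : c ∈ Metric.ball (0 : E2) ε) (hT : TangentAt f ξ (localParam q c)) :
    comps e ξ (incl c) 2 = 0 := by
  obtain ⟨v, hv⟩ := hT
  obtain ⟨w, rfl⟩ := (mfderiv_localParam_bijective (hpl c hc).2).2 v
  have h := mfderiv_localParam_incl he ht hf hpl hc w
  have hu : incl c ∈ e.target := by rw [ht]; exact incl_mem_ball.2 hc
  have h1 : frame e (incl c) (incl w) = ξ (e.symm (incl c)) :=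
    h.symm.trans (hv.trans (congrArg (fun x => (ξ x : E3)) (hpl c hc).1))
  rw [comps_eq_of_frame_eq he hu h1]
  exact incl_apply_two w

variable [RiemannianBundle (fun x : M => TangentSpace (𝓡 3) x)]

theorem orthogonalAt_iff
    (he : e ∈ IsManifold.maximalAtlas (𝓡 3) ∞ M) (ht : e.target = Metric.ball 0 ε)
    (hf : ContMDiff (𝓡 2) (𝓡 3) ∞ f)
    (hpl : ∀ c ∈ Metric.ball (0 : E2) ε, f (localParam q c) = e.symm (incl c) ∧
      chartAt E2 q q + c ∈ (chartAt E2 q).target)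
    {ξ : Π x : M, TangentSpace (𝓡 3) x} {c : E2}
    (hc : c ∈ Metric.ball (0 : E2) ε) : OrthogonalAt f ξ (localParam q c) ↔
    ∀ w, coordMetric e (incl c) (comps e ξ (incl c)) (incl w) = 0 := by
  have hu : incl c ∈ e.target := by rw [ht]; exact incl_mem_ball.2 hc
  have key : ∀ w : E2, inner ℝ (ξ (f (localParam q c))) (mfderiv (𝓡 2) (𝓡 3) f (localParam q c)
      (mfderiv (𝓡 2) (𝓡 2) (localParam q) c w)) =
      coordMetric e (incl c) (comps e ξ (incl c)) (incl w) := by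
    intro w
    rw [coordMetric_apply, frame_comps he hu]
    exact inner_congr (hpl c hc).1 (congrArg (fun x => (ξ x : E3)) (hpl c hc).1)
      (mfderiv_localParam_incl he ht hf hpl hc w)
  constructor
  · intro h w
    rw [← key]
    exact h _
  · intro h v
    obtain ⟨w, rfl⟩ := (mfderiv_localParam_bijective (hpl c hc).2).2 v
    exact (key w).trans (h w)

variable [IsContMDiffRiemannianBundle (𝓡 3) ∞ E3 (fun x : M => TangentSpace (𝓡 3) x)]

/-- The second fundamental form of a totally geodesic surface vanishes. -/
theorem covForm_incl_eq_zero
    (he : e ∈ IsManifold.maximalAtlas (𝓡 3) ∞ M) (ht : e.target = Metric.ball 0 ε)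
    (hf : ContMDiff (𝓡 2) (𝓡 3) ∞ f)
    (hpl : ∀ c ∈ Metric.ball (0 : E2) ε, f (localParam q c) = e.symm (incl c) ∧
      chartAt E2 q q + c ∈ (chartAt E2 q).target)
    (hTG : IsTotallyGeodesic f) {c : E2}
    (hc : c ∈ Metric.ball (0 : E2) ε) (v w : E2) {n : E3}
    (hn : ∀ w, coordMetric e (incl c) n (incl w) = 0) :
    covForm (coordMetric e) (fun _ => incl w) (incl c) (incl v) n = 0 := by
  have hu : incl c ∈ e.target := by rw [ht]; exact incl_mem_ball.2 hc
  obtain ⟨U, N, hU, hfU, hN, hNev, hN0⟩ := hTG.2.2 (localParam q c)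
  have hpt := (hpl c hc).1
  have hNs : SmoothFieldAt N (e.symm (incl c)) := by
    rw [← hpt]; exact hN.smoothFieldAt hU hfU
  have hpos : ∀ v, v ≠ 0 → 0 < coordMetric e (incl c) v v := fun v hv => coordMetric_pos he hu hv
  have hcont : ContinuousAt (localParam q) c := (contMDiffAt_localParam (hpl c hc).2).continuousAt
  have hnorm : ∀ᶠ d in 𝓝 c, d ∈ Metric.ball (0 : E2) ε ∧ ‖N (e.symm (incl d))‖ = 1 ∧
      ∀ w, coordMetric e (incl d) (comps e N (incl d)) (incl w) = 0 := by
    filter_upwards [hcont.eventually hNev, Metric.isOpen_ball.mem_nhds hc] with d hd hd2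
    refine ⟨hd2, ?_, ?_⟩
    · rw [← (hpl d hd2).1]; exact hd.1
    · exact (orthogonalAt_iff he ht hf hpl hd2).1 hd.2
  have hNd : DifferentiableAt ℝ (comps e N) (incl c) :=
    (contDiffAt_comps he hu hNs).differentiableAt (by simp)
  have h1 := hasFDerivAt_metric_apply (Y := fun _ => incl w) (differentiableAt_coordMetric he hu)
    (differentiableAt_const _) hNd (eventually_coordMetric_symm (incl c)) (incl v)
  -- The extension `N` is normal only at points of the surface, so the product may be differentiated
  -- only in directions tangent to it.
  have h2 : fderiv ℝ (fun y => coordMetric e y (incl w) (comps e N y)) (incl c) (incl v) = 0 := by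
    have hd : DifferentiableAt ℝ (fun y => coordMetric e y (incl w) (comps e N y)) (incl c) :=
      ((differentiableAt_coordMetric he hu).clm_apply (differentiableAt_const _)).clm_apply hNd
    have h3 := hd.hasFDerivAt.comp c incl.hasFDerivAt
    have h4 : HasFDerivAt ((fun y => coordMetric e y (incl w) (comps e N y)) ∘ incl)
        (0 : E2 →L[ℝ] ℝ) c := by
      refine (hasFDerivAt_const (0 : ℝ) c).congr_of_eventuallyEq ?_
      filter_upwards [hnorm] with d hd
      simp only [Function.comp_apply]
      rw [coordMetric_symm]
      exact hd.2.2 w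
    exact congrArg (fun L : E2 →L[ℝ] ℝ => L v) (h3.unique h4)
  have h5 : covForm (coordMetric e) (comps e N) (incl c) (incl v) (incl w) = 0 := by
    rw [← two_inner_nabla he hu hNs]
    have h6 := nabla_congr hpt N (mfderiv_localParam_incl he ht hf hpl hc v) (hN0 _)
    rw [h6, inner_zero_left, mul_zero]
  rw [h2, h5, add_zero] at h1
  have h7 : covForm (coordMetric e) (fun _ => incl w) (incl c) (incl v) (comps e N (incl c))
      = 0 := by linarith
  -- The normal line is one-dimensional: `N` is a nonzero multiple of the gradient, and any normal
  -- vector `n` is a multiple of it.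
  have h8 := eq_smul_grad hpos hnorm.self_of_nhds.2.2
  have h9 : coordMetric e (incl c) (comps e N (incl c)) (basisVec 2) ≠ 0 := by
    intro h0
    rw [h0, zero_smul] at h8
    have h10 := frame_comps he hu N
    rw [h8, map_zero] at h10
    have := hnorm.self_of_nhds.2.1
    rw [← h10, norm_zero] at this
    exact zero_ne_one this
  rw [h8, covForm_smul_right, smul_eq_mul] at h7
  rw [eq_smul_grad hpos hn, covForm_smul_right, (mul_eq_zero.1 h7).resolve_left h9, smul_zero]

end Consequences

end Immersion

/-! ### Skew maps and the cross product in dimension three -/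

section CrossProduct

variable {V : Type*} [NormedAddCommGroup V] [InnerProductSpace ℝ V]
  [h : Fact (Module.finrank ℝ V = 3)]

theorem exists_orthonormalBasis_of_pair {n a : V} (hn : ‖n‖ = 1) (ha : ‖a‖ = 1)
    (hna : inner ℝ n a = (0 : ℝ)) : ∃ b : OrthonormalBasis (Fin 3) ℝ V, b 0 = n ∧ b 1 = a := by
  have : FiniteDimensional ℝ V := .of_finrank_pos (by rw [h.out]; norm_num)
  have ho : Orthonormal ℝ (({0, 1} : Set (Fin 3)).domRestrict ![n, a, 0]) := by
    have han : inner ℝ a n = (0 : ℝ) := by rw [real_inner_comm]; exact hna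
    constructor
    · rintro ⟨i, hi⟩
      rcases hi with rfl | rfl
      · simpa [domRestrict] using hn
      · simpa [domRestrict] using ha
    · rintro ⟨i, hi⟩ ⟨j, hj⟩ hij
      rcases hi with rfl | rfl <;> rcases hj with rfl | rfl <;> simp_all [domRestrict]
  obtain ⟨b, hb⟩ := ho.exists_orthonormalBasis_extension_of_card_eq (by simp [h.out])
  exact ⟨b, by simpa using hb 0 (by simp), by simpa using hb 1 (by simp)⟩

theorem exists_orthogonal_unit {n : V} (hn : ‖n‖ = 1) :
    ∃ a : V, ‖a‖ = 1 ∧ inner ℝ n a = (0 : ℝ) := by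
  have : FiniteDimensional ℝ V := .of_finrank_pos (by rw [h.out]; norm_num)
  have ho : Orthonormal ℝ (({0} : Set (Fin 3)).domRestrict ![n, 0, 0]) := by
    constructor
    · rintro ⟨i, hi⟩
      rcases hi with rfl
      simpa [domRestrict] using hn
    · rintro ⟨i, hi⟩ ⟨j, hj⟩ hij
      rcases hi with rfl
      rcases hj with rfl
      simp_all
  obtain ⟨b, hb⟩ := ho.exists_orthonormalBasis_extension_of_card_eq (by simp [h.out])
  have h0 : b 0 = n := by simpa using hb 0 (by simp)
  exact ⟨b 1, b.orthonormal.1 1, by rw [← h0]; exact b.orthonormal.2 (by decide)⟩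

/-- A skew-symmetric map with range orthogonal to the first vector of an orthonormal basis is
determined by one number. -/
theorem inner_skew_eq {A : V → V} (hA : ∀ v w, inner ℝ (A v) w + inner ℝ (A w) v = (0 : ℝ))
    (b : OrthonormalBasis (Fin 3) ℝ V) (hn : ∀ v, inner ℝ (A v) (b 0) = (0 : ℝ)) (v w : V) :
    inner ℝ (A v) w =
      (inner ℝ (b 1) v * inner ℝ (b 2) w - inner ℝ (b 2) v * inner ℝ (b 1) w) *
        inner ℝ (A (b 1)) (b 2) := by
  have key : ∀ x y, inner ℝ (A x) y = inner ℝ (b 0) y * inner ℝ (A x) (b 0) +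
      inner ℝ (b 1) y * inner ℝ (A x) (b 1) + inner ℝ (b 2) y * inner ℝ (A x) (b 2) := by
    intro x y
    nth_rewrite 1 [← b.sum_repr' y]
    simp only [Fin.sum_univ_three, inner_add_right, real_inner_smul_right]
  have h1 := key v w
  have h2 := key (b 1) v
  have h3 := key (b 2) v
  have h4 := hA v (b 1)
  have h5 := hA v (b 2)
  have h6 := hA (b 1) (b 1)
  have h7 := hA (b 2) (b 2)
  have h8 := hA (b 1) (b 2)
  rw [hn] at h1 h2 h3
  have h9 : inner ℝ (A (b 1)) (b 1) = (0 : ℝ) := by linarith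
  have h10 : inner ℝ (A (b 2)) (b 2) = (0 : ℝ) := by linarith
  rw [h9] at h2
  rw [h10] at h3
  have h11 : inner ℝ (A v) (b 1) = -inner ℝ (A (b 1)) v := by linarith
  have h12 : inner ℝ (A v) (b 2) = -inner ℝ (A (b 2)) v := by linarith
  have h13 : inner ℝ (A (b 2)) (b 1) = -inner ℝ (A (b 1)) (b 2) := by linarith
  rw [h1, h11, h12, h2, h3, h13]
  ring

theorem inner_cross_skew (o : Orientation ℝ V (Fin 3)) (n v w : V) :
    inner ℝ (cross o v n) w + inner ℝ (cross o w n) v = (0 : ℝ) := by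
  rw [inner_cross, inner_cross]
  have h1 := o.volumeForm.map_swap ![v, n, w] (show (0 : Fin 3) ≠ 2 by decide)
  have h2 : (![v, n, w] : Fin 3 → V) ∘ Equiv.swap 0 2 = ![w, n, v] := by
    ext i
    fin_cases i <;> simp [Equiv.swap_apply_def]
  rw [h2] at h1
  rw [h1, add_neg_cancel]

theorem inner_cross_self (o : Orientation ℝ V (Fin 3)) (n v : V) :
    inner ℝ (cross o v n) n = (0 : ℝ) := by
  rw [inner_cross]
  exact o.volumeForm.map_eq_zero_of_eq _ (i := 1) (j := 2) (by simp) (by decide)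

theorem inner_cross_ne_zero (o : Orientation ℝ V (Fin 3)) (b : OrthonormalBasis (Fin 3) ℝ V) :
    inner ℝ (cross o (b 1) (b 0)) (b 2) ≠ (0 : ℝ) := by
  rw [inner_cross]
  have h1 := o.abs_volumeForm_apply_of_orthonormal b
  have h2 := o.volumeForm.map_swap ⇑b (show (0 : Fin 3) ≠ 1 by decide)
  have h3 : ⇑b ∘ Equiv.swap 0 1 = ![b 1, b 0, b 2] := by
    ext i
    fin_cases i <;> simp [Equiv.swap_apply_def]
  rw [h3] at h2
  rw [h2]
  intro h0
  rw [neg_eq_zero.1 h0] at h1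
  simp at h1

theorem cross_ne_zero (o : Orientation ℝ V (Fin 3)) {n v : V} (hn : ‖n‖ = 1) (hv : v ≠ 0)
    (hnv : inner ℝ n v = (0 : ℝ)) : cross o v n ≠ 0 := by
  have hv' : ‖v‖ ≠ 0 := norm_ne_zero_iff.2 hv
  obtain ⟨b, h0, h1⟩ := exists_orthonormalBasis_of_pair (a := ‖v‖⁻¹ • v) hn
    (by rw [norm_smul, norm_inv, norm_norm, inv_mul_cancel₀ hv'])
    (by rw [real_inner_smul_right, hnv, mul_zero])
  intro hc
  have h2 := inner_cross_ne_zero o b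
  have h3 := inner_cross_skew o n v (b 2)
  have h4 := inner_cross_skew o n (b 1) (b 2)
  rw [hc, inner_zero_left, zero_add] at h3
  rw [h1, real_inner_smul_right, h3, mul_zero, add_zero, ← h1, ← h0] at h4
  exact h2 h4

/-- Both `A` and `v ↦ v × n` are skew with range orthogonal to `n`, so by `inner_skew_eq` each is
determined by one number. The factor `t` is the quotient of these numbers. -/
theorem exists_eq_smul_cross (o : Orientation ℝ V (Fin 3)) {A : V → V} {n : V} (hn : ‖n‖ = 1)
    (hA : ∀ v w, inner ℝ (A v) w + inner ℝ (A w) v = (0 : ℝ))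
    (hAn : ∀ v, inner ℝ (A v) n = (0 : ℝ)) : ∃ t : ℝ, ∀ v, A v = t • cross o v n := by
  obtain ⟨a, ha, hna⟩ := exists_orthogonal_unit hn
  obtain ⟨b, rfl, rfl⟩ := exists_orthonormalBasis_of_pair hn ha hna
  have h0 := inner_cross_ne_zero o b
  refine ⟨inner ℝ (A (b 1)) (b 2) / inner ℝ (cross o (b 1) (b 0)) (b 2), fun v => ?_⟩
  refine ext_inner_right ℝ fun w => ?_
  have h1 := inner_skew_eq hA b hAn v w
  have h2 := inner_skew_eq (inner_cross_skew o (b 0)) b (inner_cross_self o (b 0)) v w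
  rw [h1, real_inner_smul_left, h2]
  field_simp

end CrossProduct

/-! ### The function `τ` -/

section KillingGeometry

variable {M : Type*} [TopologicalSpace M] [ChartedSpace E3 M] [IsManifold (𝓡 3) ∞ M]
  [RiemannianBundle (fun x : M => TangentSpace (𝓡 3) x)]
  [IsContMDiffRiemannianBundle (𝓡 3) ∞ E3 (fun x : M => TangentSpace (𝓡 3) x)]
  {ξ : Π x : M, TangentSpace (𝓡 3) x}

theorem SmoothFieldOn.smoothFieldAt_univ (hξ : SmoothFieldOn ξ univ) (x : M) :
    SmoothFieldAt ξ x := hξ.smoothFieldAt isOpen_univ (mem_univ x)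

theorem exists_chart_symm_eq (x : M) :
    ∃ e ∈ IsManifold.maximalAtlas (𝓡 3) ∞ M, ∃ u ∈ e.target, e.symm u = x :=
  ⟨chartAt E3 x, IsManifold.chart_mem_maximalAtlas x, chartAt E3 x x, mem_chart_target _ _,
    (chartAt E3 x).left_inv (mem_chart_source _ _)⟩

theorem IsKillingOn.inner_nabla_skew (hξ : IsKillingOn ξ univ) (x : M)
    (v w : TangentSpace (𝓡 3) x) :
    inner ℝ (nabla ξ x v) w + inner ℝ (nabla ξ x w) v = (0 : ℝ) := by
  obtain ⟨e, he, u, hu, rfl⟩ := exists_chart_symm_eq x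
  obtain ⟨v, rfl⟩ := frame_surjective he hu v
  obtain ⟨w, rfl⟩ := frame_surjective he hu w
  have h1 := two_inner_nabla he hu (hξ.1.smoothFieldAt_univ _) v w
  have h2 := two_inner_nabla he hu (hξ.1.smoothFieldAt_univ _) w v
  have h3 := hξ.covForm_skew isOpen_univ he hu (mem_univ _) v w
  linarith

theorem inner_nabla_unit (hξ : IsKillingOn ξ univ) (hunit : ∀ x, ‖ξ x‖ = 1) (x : M)
    (v : TangentSpace (𝓡 3) x) : inner ℝ (nabla ξ x v) (ξ x) = (0 : ℝ) := by
  obtain ⟨e, he, u, hu, rfl⟩ := exists_chart_symm_eq x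
  obtain ⟨v, rfl⟩ := frame_surjective he hu v
  have h1 := two_inner_nabla he hu (hξ.1.smoothFieldAt_univ _) v (comps e ξ u)
  rw [covForm_unit_right hξ hunit he hu, frame_comps he hu] at h1
  linarith

theorem existsUnique_isTau (hξ : IsKillingOn ξ univ) (hunit : ∀ x, ‖ξ x‖ = 1)
    (o : Π x : M, Orientation ℝ (TangentSpace (𝓡 3) x) (Fin 3)) : ∃! τ : M → ℝ, IsTau o ξ τ := by
  choose τ hτ using fun x => exists_eq_smul_cross (o x) (A := nabla ξ x) (hunit x)
    (hξ.inner_nabla_skew x) (inner_nabla_unit hξ hunit x)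
  refine ⟨τ, hτ, fun σ hσ => funext fun x => ?_⟩
  obtain ⟨a, ha, hna⟩ := exists_orthogonal_unit (hunit x)
  have h0 := cross_ne_zero (o x) (hunit x) (norm_ne_zero_iff.1 (by rw [ha]; exact one_ne_zero)) hna
  exact smul_left_injective ℝ h0 ((hσ x a).symm.trans (hτ x a))

theorem IsTau.nabla_eq_zero {o : Π x : M, Orientation ℝ (TangentSpace (𝓡 3) x) (Fin 3)}
    {τ : M → ℝ} (hτ : IsTau o ξ τ) {x : M} (hx : τ x = 0) (v : TangentSpace (𝓡 3) x) :
    nabla ξ x v = 0 := by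
  rw [hτ x v, hx, zero_smul]

/-- One nonzero direction orthogonal to `ξ` suffices to detect `τ`, because its cross product with
`ξ` does not vanish. -/
theorem IsTau.eq_zero {o : Π x : M, Orientation ℝ (TangentSpace (𝓡 3) x) (Fin 3)}
    {τ : M → ℝ} (hτ : IsTau o ξ τ) (hunit : ∀ x, ‖ξ x‖ = 1) {x : M} {v : TangentSpace (𝓡 3) x}
    (hv : v ≠ 0) (hvξ : inner ℝ (ξ x) v = (0 : ℝ)) (h0 : nabla ξ x v = 0) : τ x = 0 :=
  (smul_eq_zero.1 ((hτ x v).symm.trans h0)).resolve_right (cross_ne_zero (o x) (hunit x) hv hvξ)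

end KillingGeometry

/-! ### Riemannian metrics on the plane -/

section PlaneMetric

/-- The constant is the minimum of `B v v` on the unit circle. The bound gives the boundedness of
unit balls that a Riemannian metric must satisfy. -/
theorem exists_pos_mul_sq_le {B : E2 →L[ℝ] E2 →L[ℝ] ℝ} (hB : ∀ v, v ≠ 0 → 0 < B v v) :
    ∃ m > 0, ∀ v, m * ‖v‖ ^ 2 ≤ B v v := by
  have hc : Continuous fun v => B v v := by fun_prop
  obtain ⟨v₀, hv₀, hmin⟩ := (isCompact_sphere (0 : E2) 1).exists_isMinOn
    (NormedSpace.sphere_nonempty.2 zero_le_one) hc.continuousOn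
  have hv₀' : v₀ ≠ 0 := by
    rintro rfl
    simp at hv₀
  refine ⟨B v₀ v₀, hB _ hv₀', fun v => ?_⟩
  by_cases hv : v = 0
  · simp [hv]
  have hn : ‖v‖ ≠ 0 := norm_ne_zero_iff.2 hv
  have h1 : B v₀ v₀ ≤ B (‖v‖⁻¹ • v) (‖v‖⁻¹ • v) := hmin (by simp [norm_smul, hn])
  rw [map_smul, map_smul, _root_.smul_apply, smul_eq_mul, smul_eq_mul] at h1
  calc B v₀ v₀ * ‖v‖ ^ 2 ≤ (‖v‖⁻¹ * (‖v‖⁻¹ * B v v)) * ‖v‖ ^ 2 := by gcongr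
    _ = B v v := by field_simp

/-- The preferred trivialization of the tangent bundle of the plane is the identity on fibres, so
the section in coordinates is `B` itself. -/
theorem contMDiff_metricSection {B : E2 → E2 →L[ℝ] E2 →L[ℝ] ℝ} (hB : ContDiff ℝ ∞ B) :
    ContMDiff (𝓡 2) ((𝓡 2).prod 𝓘(ℝ, E2 →L[ℝ] E2 →L[ℝ] ℝ)) ∞ (fun b : E2 =>
      TotalSpace.mk' (E2 →L[ℝ] E2 →L[ℝ] ℝ)
        (E := fun b : E2 => TangentSpace (𝓡 2) b →L[ℝ] TangentSpace (𝓡 2) b →L[ℝ] ℝ) b (B b)) := by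
  intro x
  refine (contMDiffAt_section _).2 ?_
  refine (hB.contMDiff.contMDiffAt (x := x)).congr_of_eventuallyEq
    (Eventually.of_forall fun y => ContinuousLinearMap.ext fun v =>
      ContinuousLinearMap.ext fun w => ?_)
  set t := trivializationAt E2 (fun b : E2 => TangentSpace (𝓡 2) b) x
  have hy : y ∈ t.baseSet := mem_univ y
  refine (inCoordinates_apply_eq₂ (F₁ := E2) (F₂ := E2) (F₃ := ℝ)
    (E₁ := fun b : E2 => TangentSpace (𝓡 2) b) (E₂ := fun b : E2 => TangentSpace (𝓡 2) b)
    (E₃ := fun _ : E2 => ℝ) (x₀ := x) (x := y) (ϕ := B y) hy hy (mem_univ _)).trans ?_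
  have h1 : ∀ v : E2, t.symm y v = v := fun v =>
    (Bundle.Trivialization.symmL_apply (R := ℝ) t hy v).symm.trans
      (congrArg (fun L : E2 →L[ℝ] E2 => L v) (TangentBundle.symmL_model_space (𝕜 := ℝ) x y))
  have h2 := congrArg (fun L : ℝ →ₗ[ℝ] ℝ => L (B y (t.symm y v) (t.symm y w)))
    (Bundle.Trivial.linearMapAt_trivialization ℝ E2 ℝ y)
  exact h2.trans (congrArg₂ (fun a b : E2 => B y a b) (h1 v) (h1 w))

/-- A Riemannian metric on the plane. -/
def planeMetric {B : E2 → E2 →L[ℝ] E2 →L[ℝ] ℝ} (hB : ContDiff ℝ ∞ B)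
    (hs : ∀ q v w, B q v w = B q w v) (hp : ∀ q v, v ≠ 0 → 0 < B q v v) :
    ContMDiffRiemannianMetric (𝓡 2) ∞ E2 (fun q : planeSurface => TangentSpace (𝓡 2) q) where
  inner q := (B q : E2 →L[ℝ] E2 →L[ℝ] ℝ)
  symm q v w := hs q v w
  pos q v hv := hp q v hv
  isVonNBounded q := by
    change Bornology.IsVonNBounded ℝ {v : E2 | B q v v < 1}
    obtain ⟨m, hm, hmv⟩ := exists_pos_mul_sq_le (hp q)
    refine (NormedSpace.isVonNBounded_iff' ℝ).2 ⟨m⁻¹ + 1, fun v hv => ?_⟩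
    have h1 : m * ‖v‖ ^ 2 < 1 := (hmv v).trans_lt hv
    have h2 : ‖v‖ ^ 2 < m⁻¹ := by
      rw [← one_div, lt_div_iff₀ hm, mul_comm]
      exact h1
    nlinarith [norm_nonneg v]
  contMDiff := contMDiff_metricSection hB

end PlaneMetric

/-! ### Surfaces orthogonal to the Killing field -/

section Orthogonal

variable {M : Type*} [TopologicalSpace M] [ChartedSpace E3 M] [IsManifold (𝓡 3) ∞ M]
  [RiemannianBundle (fun x : M => TangentSpace (𝓡 3) x)]
  [IsContMDiffRiemannianBundle (𝓡 3) ∞ E3 (fun x : M => TangentSpace (𝓡 3) x)]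
  {ξ : Π x : M, TangentSpace (𝓡 3) x} {e : OpenPartialHomeomorph M E3}

theorem coordMetric_unit (hunit : ∀ x, ‖ξ x‖ = 1) (he : e ∈ IsManifold.maximalAtlas (𝓡 3) ∞ M)
    {u : E3} (hu : u ∈ e.target) : coordMetric e u (comps e ξ u) (comps e ξ u) = 1 := by
  rw [coordMetric_apply, frame_comps he hu, real_inner_self_eq_norm_sq, hunit, one_pow]

/-- A function that vanishes on a coordinate plane has no derivative along it. -/
theorem fderiv_incl_eq_zero {h : E3 → ℝ} {c : E2} (hd : DifferentiableAt ℝ h (incl c))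
    (h0 : ∀ᶠ d in 𝓝 c, h (incl d) = 0) (v : E2) : fderiv ℝ h (incl c) (incl v) = 0 := by
  have h3 := hd.hasFDerivAt.comp c incl.hasFDerivAt
  have h4 : HasFDerivAt (h ∘ incl) (0 : E2 →L[ℝ] ℝ) c :=
    (hasFDerivAt_const (0 : ℝ) c).congr_of_eventuallyEq h0
  exact congrArg (fun L : E2 →L[ℝ] ℝ => L v) (h3.unique h4)

/-- A unit Killing field is parallel along a surface orthogonal to it. -/
theorem nabla_eq_zero_of_orthogonal (hξ : IsKillingOn ξ univ) (hunit : ∀ x, ‖ξ x‖ = 1)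
    {S : Surface} {f : S → M} (hf : ContMDiff (𝓡 2) (𝓡 3) ∞ f)
    (hinj : ∀ q, Function.Injective (mfderiv (𝓡 2) (𝓡 3) f q)) (horth : ∀ r, OrthogonalAt f ξ r)
    (q : S) (z : TangentSpace (𝓡 3) (f q)) : nabla ξ (f q) z = 0 := by
  obtain ⟨e, he, ε, hε, ht, hq, hq0, hpl⟩ := exists_chart_of_immersion (q := q) hf hinj
  have h0 : (0 : E2) ∈ Metric.ball (0 : E2) ε := Metric.mem_ball_self hε
  have hfq : f q = e.symm (incl 0) := by rw [map_zero, ← hq0, e.left_inv hq]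
  have hu : incl 0 ∈ e.target := by rw [ht]; exact incl_mem_ball.2 h0
  have hξs : DifferentiableAt ℝ (comps e ξ) (incl 0) :=
    (contDiffAt_comps he hu (hξ.1.smoothFieldAt_univ _)).differentiableAt (by simp)
  have hort : ∀ c ∈ Metric.ball (0 : E2) ε, ∀ w,
      coordMetric e (incl c) (comps e ξ (incl c)) (incl w) = 0 := fun c hc =>
    (orthogonalAt_iff he ht hf hpl hc).1 (horth _)
  have hG := differentiableAt_coordMetric (M := M) he hu
  have key : ∀ v w, covForm (coordMetric e) (comps e ξ) (incl 0) (incl v) (incl w) =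
      - covForm (coordMetric e) (fun _ => incl w) (incl 0) (incl v) (comps e ξ (incl 0)) := by
    intro v w
    have h1 := hasFDerivAt_metric_apply (Z := fun _ => incl w) hG hξs (differentiableAt_const _)
      (eventually_coordMetric_symm _) (incl v)
    rw [fderiv_incl_eq_zero ((hG.clm_apply hξs).clm_apply (differentiableAt_const _))
      (by
        filter_upwards [Metric.isOpen_ball.mem_nhds h0] with d hd
        exact hort d hd w)] at h1
    linarith
  -- By `key` the form is minus the second fundamental form, hence symmetric; by the Killing
  -- equation it is skew.
  have hplane : ∀ v w, covForm (coordMetric e) (comps e ξ) (incl 0) (incl v) (incl w) = 0 := by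
    intro v w
    have h1 := key v w
    have h2 := key w v
    rw [covForm_const_swap hG (eventually_coordMetric_symm _)] at h2
    have h3 := hξ.covForm_skew isOpen_univ he hu (mem_univ _) (incl v) (incl w)
    linarith
  have hξ2 : comps e ξ (incl 0) 2 ≠ 0 := by
    intro h
    have h1 := hort 0 h0 (planeProj (comps e ξ (incl 0)))
    rw [incl_planeProj_of_eq_zero h, coordMetric_unit hunit he hu] at h1
    exact one_ne_zero h1
  have hdec : ∀ z : E3, ∃ (c : E2) (t : ℝ), z = incl c + t • comps e ξ (incl 0) := by
    intro z
    refine ⟨planeProj (z - (z 2 / comps e ξ (incl 0) 2) • comps e ξ (incl 0)),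
      z 2 / comps e ξ (incl 0) 2, ?_⟩
    rw [incl_planeProj_of_eq_zero, sub_add_cancel]
    rw [PiLp.sub_apply, PiLp.smul_apply, smul_eq_mul, div_mul_cancel₀ _ hξ2, sub_self]
  refine nabla_congr hfq.symm ξ (v := (z : E3)) rfl ?_
  refine ext_inner_right ℝ fun w => ?_
  obtain ⟨z', hz'⟩ := frame_surjective he hu (z : E3)
  obtain ⟨w, rfl⟩ := frame_surjective he hu w
  obtain ⟨c, t, rfl⟩ := hdec z'
  obtain ⟨d, s, rfl⟩ := hdec w
  have h1 := two_inner_nabla he hu (hξ.1.smoothFieldAt_univ _) (incl c + t • comps e ξ (incl 0))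
    (incl d + s • comps e ξ (incl 0))
  rw [covForm_add_right, covForm_smul_right, covForm_unit_right hξ hunit he hu, covForm_add_left,
    covForm_smul_left, covForm_unit_left hξ hunit he hu, hplane, smul_zero, smul_zero, add_zero,
    add_zero, hz'] at h1
  rw [inner_zero_left]
  linarith

theorem isTotallyGeodesic_of_orthogonal (hξ : IsKillingOn ξ univ) (hunit : ∀ x, ‖ξ x‖ = 1)
    {S : Surface} {f : S → M} (hf : ContMDiff (𝓡 2) (𝓡 3) ∞ f)
    (hinj : ∀ q, Function.Injective (mfderiv (𝓡 2) (𝓡 3) f q))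
    (horth : ∀ r, OrthogonalAt f ξ r) : IsTotallyGeodesic f :=
  ⟨hf, hinj, fun q => ⟨univ, ξ, isOpen_univ, mem_univ _, hξ.1,
    Eventually.of_forall fun r => ⟨hunit _, horth r⟩,
    fun _ => nabla_eq_zero_of_orthogonal hξ hunit hf hinj horth q _⟩⟩

/-- The surface is the slice of the product at the height `t` of `p`. Orthogonality to `ξ` alone
makes it totally geodesic. -/
theorem IsLocalProductAt.exists_orthogonal_surface (hξ : IsKillingOn ξ univ)
    (hunit : ∀ x, ‖ξ x‖ = 1) {p : M} (h : IsLocalProductAt ξ p) :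
    ∃ (S : Surface) (f : S → M) (q : S), IsTotallyGeodesic f ∧ f q = p ∧
      ∀ r, OrthogonalAt f ξ r := by
  obtain ⟨S, h, a, b, Φ, hs, hp, hΦ, -, hin, hξΦ⟩ := h
  obtain ⟨⟨q, t⟩, hqt, rfl⟩ : ∃ y ∈ Φ.source, Φ y = p :=
    ⟨Φ.symm p, Φ.map_target hp, Φ.right_inv hp⟩
  have ht : ∀ r : S, (r, t) ∈ Φ.source := by
    intro r
    rw [hs] at hqt ⊢
    exact ⟨mem_univ _, hqt.2⟩
  have hat : ∀ r : S, ContMDiffAt ((𝓡 2).prod 𝓘(ℝ, ℝ)) (𝓡 3) ∞ Φ (r, t) := fun r =>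
    hΦ.contMDiffAt (Φ.open_source.mem_nhds (ht r))
  have hf : ContMDiff (𝓡 2) (𝓡 3) ∞ fun r : S => Φ (r, t) := fun r =>
    (hat r).comp r (contMDiff_id.prodMk contMDiff_const).contMDiffAt
  have hfd : ∀ (r : S) (v : TangentSpace (𝓡 2) r),
      mfderiv (𝓡 2) (𝓡 3) (fun r : S => Φ (r, t)) r v =
        mfderiv ((𝓡 2).prod 𝓘(ℝ, ℝ)) (𝓡 3) Φ (r, t) (v, (0 : ℝ)) := by
    intro r v
    have h1 := mfderiv_prod_eq_add_apply (v := ((v, (0 : ℝ)) : E2 × ℝ))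
      ((hat r).mdifferentiableAt (by simp))
    refine Eq.trans ?_ h1.symm
    exact ((congrArg (_ + ·) (map_zero _)).trans (add_zero _)).symm
  have horth : ∀ r, OrthogonalAt (fun r : S => Φ (r, t)) ξ r := by
    intro r v
    obtain ⟨c, hc⟩ := hξΦ _ (ht r)
    rw [hfd]
    refine (congrArg (fun z => inner ℝ z _) hc).trans ?_
    refine (hin _ (ht r) _ _ _ _).trans ?_
    rw [map_zero, _root_.zero_apply, mul_zero, add_zero]
  refine ⟨S, fun r => Φ (r, t), q,
    isTotallyGeodesic_of_orthogonal hξ hunit hf (fun r => ?_) horth, rfl, horth⟩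
  refine (injective_iff_map_eq_zero _).2 fun v hv => ?_
  by_contra hv0
  have h1 := hin _ (ht r) v v 0 0
  rw [← hfd, hv, inner_zero_left, mul_zero, add_zero] at h1
  exact (h.pos r v hv0).ne h1

end Orthogonal

/-! ### Invariance of the metric along a straightened Killing field -/

section Invariance

/-- A function on a ball without derivative in the direction `c` is constant along `c`. -/
theorem eq_of_fderiv_apply_eq_zero {F : Type*} [NormedAddCommGroup F] [NormedSpace ℝ F] {ε : ℝ}
    {H : E3 → F} {c : E3} (hH : ∀ u ∈ Metric.ball (0 : E3) ε, DifferentiableAt ℝ H u)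
    (h0 : ∀ u ∈ Metric.ball (0 : E3) ε, fderiv ℝ H u c = 0) {u : E3} {t : ℝ}
    (hu : u ∈ Metric.ball (0 : E3) ε) (hut : u + t • c ∈ Metric.ball (0 : E3) ε) :
    H (u + t • c) = H u := by
  have hmem : ∀ s ∈ Icc (0 : ℝ) 1, u + s • (t • c) ∈ Metric.ball (0 : E3) ε := fun s hs => by
    have := (convex_ball (0 : E3) ε).add_smul_sub_mem hu hut hs
    rwa [add_sub_cancel_left] at this
  have hd : ∀ s ∈ Icc (0 : ℝ) 1, HasDerivAt (fun s : ℝ => H (u + s • (t • c))) 0 s := by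
    intro s hs
    have h1 : HasDerivAt (fun s : ℝ => u + s • (t • c)) (t • c) s := by
      simpa using ((hasDerivAt_id s).smul_const (t • c)).const_add u
    have h2 := (hH _ (hmem s hs)).hasFDerivAt.comp_hasDerivAt s h1
    rwa [map_smul, h0 _ (hmem s hs), smul_zero] at h2
  have h := constant_of_has_deriv_right_zero (fun s hs => (hd s hs).continuousAt.continuousWithinAt)
    (fun s hs => (hd s (Ico_subset_Icc_self hs)).hasDerivWithinAt) 1 (by simp)
  simpa using h

variable {M : Type*} [TopologicalSpace M] [ChartedSpace E3 M] [IsManifold (𝓡 3) ∞ M]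
  [RiemannianBundle (fun x : M => TangentSpace (𝓡 3) x)]
  [IsContMDiffRiemannianBundle (𝓡 3) ∞ E3 (fun x : M => TangentSpace (𝓡 3) x)]
  {e : OpenPartialHomeomorph M E3}

/-- For a field with constant components `c`, the Lie derivative of the metric is just its
derivative in the direction `c`. -/
theorem IsKillingOn.fderiv_coordMetric_eq_zero {X : Π x : M, TangentSpace (𝓡 3) x} {U : Set M}
    (hX : IsKillingOn X U) (hU : IsOpen U) (he : e ∈ IsManifold.maximalAtlas (𝓡 3) ∞ M) {u c : E3}
    (hu : u ∈ e.target) (huU : e.symm u ∈ U) (hc : ∀ᶠ y in 𝓝 u, comps e X y = c) :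
    fderiv ℝ (coordMetric e) u c = 0 := by
  refine ContinuousLinearMap.ext fun v => ContinuousLinearMap.ext fun w => ?_
  have h := hX.add_swap_eq_zero hU he hu huU v w
  have h1 : fderiv ℝ (comps e X) u = 0 := by
    rw [Filter.EventuallyEq.fderiv_eq hc, fderiv_const_apply]
  simpa [h1, hc.self_of_nhds] using h

end Invariance

/-! ### Local Riemannian products -/

section Product

variable {M : Type*} [TopologicalSpace M] [ChartedSpace E3 M] [IsManifold (𝓡 3) ∞ M]
  {e : OpenPartialHomeomorph M E3}

theorem mfderiv_symm_comp {F : Type*} [NormedAddCommGroup F] [NormedSpace ℝ F]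
    (he : e ∈ IsManifold.maximalAtlas (𝓡 3) ∞ M) {κ : F → E3} {κ' : F →L[ℝ] E3} {x : F}
    (hκ : HasFDerivAt κ κ' x) (hx : κ x ∈ e.target) (v : F) :
    (mfderiv 𝓘(ℝ, F) (𝓡 3) (fun y => e.symm (κ y)) x v : E3) = frame e (κ x) (κ' v) := by
  have h1 := mfderiv_comp x
    ((contMDiffAt_symm_of_mem_maximalAtlas he hx).mdifferentiableAt (by simp))
    hκ.hasMFDerivAt.mdifferentiableAt
  rw [hκ.hasMFDerivAt.mfderiv] at h1
  exact congrArg (fun L : F →L[ℝ] E3 => L v) h1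

/-- The decomposition of `E3` as the product of the coordinate plane `u₂ = 0` and the third
coordinate axis. -/
def planeProdLine : (E2 × ℝ) ≃L[ℝ] E3 :=
  ContinuousLinearEquiv.equivOfInverse
    (incl.coprod (ContinuousLinearMap.toSpanSingleton ℝ (basisVec 2)))
    (planeProj.prod (EuclideanSpace.proj (𝕜 := ℝ) (2 : Fin 3)))
    (fun x => by
      refine Prod.ext ?_ ?_
      · ext i; fin_cases i <;> simp
      · simp)
    (fun u => by
      have := eq_incl_add u
      simpa using this.symm)

/-- The parametrization of a neighbourhood in `M` by the product of the plane and an interval. -/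
def productChart (e : OpenPartialHomeomorph M E3) (δ : ℝ) : OpenPartialHomeomorph (E2 × ℝ) M :=
  ((OpenPartialHomeomorph.univBall (0 : E2) δ).prod
    (OpenPartialHomeomorph.ofSet (Ioo (-δ) δ) isOpen_Ioo)).trans
    (planeProdLine.toHomeomorph.toOpenPartialHomeomorph.trans e.symm)

theorem productChart_apply (δ : ℝ) (y : E2 × ℝ) :
    productChart e δ y = e.symm (incl (disc δ y.1) + y.2 • basisVec 2) := rfl

theorem norm_basisVec (i : Fin 3) : ‖basisVec i‖ = 1 := by
  simp [basisVec]

/-- A cylinder of radius and half-height `δ` fits into the ball of radius `2 * δ`; this is why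
product charts ask for a target of that size. -/
theorem incl_add_mem_ball {δ : ℝ} {c : E2} {t : ℝ} (hc : c ∈ Metric.ball (0 : E2) δ)
    (ht : t ∈ Ioo (-δ) δ) : incl c + t • basisVec 2 ∈ Metric.ball (0 : E3) (2 * δ) := by
  rw [mem_ball_zero_iff] at hc ⊢
  refine (norm_add_le _ _).trans_lt ?_
  rw [norm_incl, norm_smul, Real.norm_eq_abs, norm_basisVec, mul_one]
  have := abs_lt.2 ht
  linarith

theorem productChart_source {δ : ℝ} (hδ : 0 < δ) (ht : e.target = Metric.ball 0 (2 * δ)) :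
    (productChart e δ).source = univ ×ˢ Ioo (-δ) δ := by
  ext y
  simp only [productChart, OpenPartialHomeomorph.trans_source, OpenPartialHomeomorph.prod_source,
    OpenPartialHomeomorph.univBall_source, OpenPartialHomeomorph.ofSet_source,
    Homeomorph.toOpenPartialHomeomorph_source, univ_inter, mem_inter_iff, mem_preimage,
    OpenPartialHomeomorph.symm_source, ht, and_iff_left_iff_imp]
  intro h
  exact incl_add_mem_ball (disc_mem hδ y.1) h.2

theorem productChart_target {δ : ℝ} (hδ : 0 < δ) {x : M} (hx : x ∈ (productChart e δ).target) :
    x ∈ e.source ∧ planeProj (e x) ∈ Metric.ball (0 : E2) δ := by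
  rw [productChart, OpenPartialHomeomorph.trans_target, OpenPartialHomeomorph.trans_target] at hx
  refine ⟨hx.1.1, ?_⟩
  have := hx.2.1
  rwa [OpenPartialHomeomorph.univBall_target _ hδ] at this

variable {δ : ℝ}

theorem contMDiffOn_productChart (he : e ∈ IsManifold.maximalAtlas (𝓡 3) ∞ M) (hδ : 0 < δ)
    (ht : e.target = Metric.ball 0 (2 * δ)) :
    ContMDiffOn ((𝓡 2).prod 𝓘(ℝ, ℝ)) (𝓡 3) ∞ (productChart e δ) (productChart e δ).source := by
  intro y hy
  rw [productChart_source hδ ht] at hy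
  have h1 : ContMDiff ((𝓡 2).prod 𝓘(ℝ, ℝ)) (𝓡 3) ∞
      fun y : E2 × ℝ => incl (disc δ y.1) + y.2 • basisVec 2 :=
    (contDiff_incl_disc.contMDiff.comp contMDiff_fst).add
      (contMDiff_snd.smul contMDiff_const)
  exact ((contMDiffAt_symm_of_mem_maximalAtlas he
    (ht ▸ incl_add_mem_ball (disc_mem hδ y.1) hy.2)).comp y h1.contMDiffAt).contMDiffWithinAt

theorem contMDiffOn_productChart_symm (he : e ∈ IsManifold.maximalAtlas (𝓡 3) ∞ M) (hδ : 0 < δ) :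
    ContMDiffOn (𝓡 3) ((𝓡 2).prod 𝓘(ℝ, ℝ)) ∞ (productChart e δ).symm (productChart e δ).target := by
  intro x hx
  obtain ⟨h1, h2⟩ := productChart_target hδ hx
  have h3 := contMDiffAt_of_mem_maximalAtlas he h1
  have h4 : ContDiffAt ℝ ∞ (fun u : E3 => (OpenPartialHomeomorph.univBall (0 : E2) δ).symm
      (planeProj u)) (e x) :=
    (OpenPartialHomeomorph.contDiffOn_univBall_symm.contDiffAt
      (Metric.isOpen_ball.mem_nhds h2)).comp _ planeProj.contDiff.contDiffAt
  have h5 : ContDiffAt ℝ ∞ (fun u : E3 => u 2) (e x) :=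
    (EuclideanSpace.proj (𝕜 := ℝ) (2 : Fin 3)).contDiff.contDiffAt
  exact ((h4.contMDiffAt.comp x h3).prodMk (h5.contMDiffAt.comp x h3)).contMDiffWithinAt

theorem mfderiv_productChart (he : e ∈ IsManifold.maximalAtlas (𝓡 3) ∞ M) (hδ : 0 < δ)
    (ht : e.target = Metric.ball 0 (2 * δ)) {y : E2 × ℝ} (hy : y ∈ (productChart e δ).source)
    (v : E2) (s : ℝ) :
    (mfderiv ((𝓡 2).prod 𝓘(ℝ, ℝ)) (𝓡 3) (productChart e δ) y (v, s) : E3) =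
      frame e (incl (disc δ y.1) + y.2 • basisVec 2)
        (incl (fderiv ℝ (disc δ) y.1 v) + s • basisVec 2) := by
  have h1 := mfderiv_prod_eq_add_apply (v := ((v, s) : E2 × ℝ))
    (((contMDiffOn_productChart he hδ ht).contMDiffAt
      ((productChart e δ).open_source.mem_nhds hy)).mdifferentiableAt (by simp))
  rw [productChart_source hδ ht] at hy
  have hu : incl (disc δ y.1) + y.2 • basisVec 2 ∈ e.target :=
    ht ▸ incl_add_mem_ball (disc_mem hδ y.1) hy.2
  have h2 : HasFDerivAt (fun q : E2 => incl (disc δ q) + y.2 • basisVec 2)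
      (incl ∘L fderiv ℝ (disc δ) y.1) y.1 :=
    (incl.hasFDerivAt.comp y.1 ((OpenPartialHomeomorph.contDiff_univBall (n := 1)).differentiable
      (by simp) y.1).hasFDerivAt).add_const _
  have h3 : HasFDerivAt (fun t : ℝ => incl (disc δ y.1) + t • basisVec 2)
      (ContinuousLinearMap.toSpanSingleton ℝ (basisVec 2)) y.2 :=
    (ContinuousLinearMap.toSpanSingleton ℝ (basisVec 2)).hasFDerivAt.const_add _
  have h4 := mfderiv_symm_comp he h2 hu v
  have h5 := mfderiv_symm_comp he h3 hu s
  refine h1.trans ?_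
  rw [map_add]
  exact congrArg₂ (fun a b : E3 => a + b) h4 h5

variable [RiemannianBundle (fun x : M => TangentSpace (𝓡 3) x)]
  [IsContMDiffRiemannianBundle (𝓡 3) ∞ E3 (fun x : M => TangentSpace (𝓡 3) x)]
  {ξ : Π x : M, TangentSpace (𝓡 3) x}

theorem isLocalProductAt_of_chart (he : e ∈ IsManifold.maximalAtlas (𝓡 3) ∞ M) (hδ : 0 < δ)
    (ht : e.target = Metric.ball 0 (2 * δ)) {p : M} (hp : p ∈ e.source) (hp0 : e p = 0)
    (hξ : ∀ u ∈ e.target, comps e ξ u = basisVec 2)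
    (hG : ∀ u ∈ e.target, coordMetric e u = coordMetric e (incl (planeProj u)))
    (hG1 : ∀ u ∈ e.target, coordMetric e u (basisVec 2) (basisVec 2) = 1)
    (hG0 : ∀ c ∈ Metric.ball (0 : E2) δ, ∀ w,
      coordMetric e (incl c) (basisVec 2) (incl w) = 0) : IsLocalProductAt ξ p := by
  have hmem : ∀ q : E2, incl (disc δ q) ∈ e.target := fun q => by
    have := incl_add_mem_ball (disc_mem hδ q) (t := 0) (by simp [hδ])
    rwa [zero_smul, add_zero, ← ht] at this
  let L : E2 → E2 →L[ℝ] E3 := fun q => incl ∘L fderiv ℝ (disc δ) q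
  -- The metric induced on the coordinate plane, pulled back from the disc to the whole plane.
  let B : E2 → E2 →L[ℝ] E2 →L[ℝ] ℝ := fun q =>
    (coordMetric e (incl (disc δ q))).bilinearComp (L q) (L q)
  have hBa : ∀ q v w, B q v w = coordMetric e (incl (disc δ q)) (incl (fderiv ℝ (disc δ) q v))
    (incl (fderiv ℝ (disc δ) q w)) := fun q v w => rfl
  have hB : ContDiff ℝ ∞ B := by
    refine contDiff_clm_apply_iff.2 fun v => contDiff_clm_apply_iff.2 fun w => ?_
    have h1 : ContDiff ℝ ∞ fun q => fderiv ℝ (disc δ) q :=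
      OpenPartialHomeomorph.contDiff_univBall.fderiv_right (m := ∞) (n := ∞) (by simp)
    have h2 : ContDiff ℝ ∞ fun q => coordMetric e (incl (disc δ q)) :=
      contDiff_iff_contDiffAt.2 fun q =>
        ContDiffAt.comp (g := coordMetric e) (f := fun q => incl (disc δ q)) q
          (contDiffAt_coordMetric he (hmem q)) contDiff_incl_disc.contDiffAt
    simp only [hBa]
    exact (h2.clm_apply (incl.contDiff.comp (h1.clm_apply contDiff_const))).clm_apply
      (incl.contDiff.comp (h1.clm_apply contDiff_const))
  have hin : ∀ y ∈ (productChart e δ).source, ∀ (v w : E2) (s t : ℝ),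
      coordMetric e (incl (disc δ y.1) + y.2 • basisVec 2)
        (incl (fderiv ℝ (disc δ) y.1 v) + s • basisVec 2)
        (incl (fderiv ℝ (disc δ) y.1 w) + t • basisVec 2) = B y.1 v w + s * t := by
    intro y hy v w s t
    rw [productChart_source hδ ht] at hy
    rw [hG _ (ht ▸ incl_add_mem_ball (disc_mem hδ y.1) hy.2)]
    have h1 : incl (planeProj (incl (disc δ y.1) + y.2 • basisVec 2)) = incl (disc δ y.1) := by
      ext i; fin_cases i <;> simp
    have h2 := hG0 _ (disc_mem hδ y.1)
    rw [h1, hBa]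
    have h3 : ∀ w, coordMetric e (incl (disc δ y.1)) (incl w) (basisVec 2) = 0 := fun w => by
      rw [coordMetric_symm, h2]
    simp only [map_add, map_smul, _root_.add_apply, _root_.smul_apply, smul_eq_mul, h2, h3,
      hG1 _ (hmem y.1)]
    ring
  refine ⟨planeSurface, planeMetric hB (fun q v w => ?_) (fun q v hv => ?_), -δ, δ,
    productChart e δ, productChart_source hδ ht, ?_, contMDiffOn_productChart he hδ ht,
    contMDiffOn_productChart_symm he hδ, fun y hy v w s t => ?_, fun y hy => ⟨1, ?_⟩⟩
  · rw [hBa, hBa, coordMetric_symm]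
  · rw [hBa]
    refine coordMetric_pos he (hmem q) fun h => hv ?_
    exact (fderiv_disc_bijective hδ q).1 ((incl_injective (h.trans (map_zero _).symm)).trans
      (map_zero _).symm)
  · have h1 : productChart e δ (0, 0) = p := by
      rw [productChart_apply]
      change e.symm (incl (disc δ 0) + (0 : ℝ) • basisVec 2) = p
      rw [disc, OpenPartialHomeomorph.univBall_apply_zero, map_zero, zero_smul, add_zero, ← hp0,
        e.left_inv hp]
    rw [← h1]
    refine (productChart e δ).map_source ?_
    rw [productChart_source hδ ht]
    exact ⟨mem_univ _, by simp [hδ]⟩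
  · refine Eq.trans ?_ (hin y hy v w s t)
    rw [coordMetric_apply]
    exact inner_congr rfl (mfderiv_productChart he hδ ht hy v s)
      (mfderiv_productChart he hδ ht hy w t)
  · have h1 := mfderiv_productChart he hδ ht hy 0 1
    have hy' := hy
    rw [productChart_source hδ ht] at hy'
    have hu : incl (disc δ y.1) + y.2 • basisVec 2 ∈ e.target :=
      ht ▸ incl_add_mem_ball (disc_mem hδ y.1) hy'.2
    refine Eq.trans ?_ h1.symm
    rw [map_zero, map_zero, zero_add, one_smul]
    exact (frame_comps he hu ξ).symm.trans (congrArg (frame e _) (hξ _ hu))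

/-- In the flow box of `ξ` over the surface, the metric is invariant under translation, `ξ` is a
unit field, and the mixed terms vanish on the slice, hence everywhere. The metric is therefore `h +
dt²`. -/
theorem isLocalProductAt_of_orthogonal (hξ : IsKillingOn ξ univ) (hunit : ∀ x, ‖ξ x‖ = 1)
    {S : Surface} {f : S → M} (hf : IsTotallyGeodesic f) (horth : ∀ r, OrthogonalAt f ξ r) (q : S) :
    IsLocalProductAt ξ (f q) := by
  have hT : ¬ TangentAt f ξ q := by
    rintro ⟨v, hv⟩
    have h := horth q v
    rw [hv, real_inner_self_eq_norm_sq, hunit] at h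
    norm_num at h
  obtain ⟨e, he, ε, hε, ht, hq, hq0, hX, hpl⟩ := exists_chart_of_transversal hf.1 hf.2.1 hξ.1 hT
  rw [← ht] at hX
  have hev : ∀ u ∈ e.target, ∀ᶠ y in 𝓝 u, comps e ξ y = basisVec 2 := fun u hu => by
    filter_upwards [e.open_target.mem_nhds hu] with y hy using hX y hy
  refine isLocalProductAt_of_chart he (half_pos hε) (by rw [ht]; congr 1; ring) hq hq0 hX ?_ ?_ ?_
  · intro u hu
    have hu' : incl (planeProj u) ∈ Metric.ball (0 : E3) ε := by
      rw [mem_ball_zero_iff]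
      rw [ht, mem_ball_zero_iff] at hu
      exact (norm_incl_planeProj_le u).trans_lt hu
    have h1 := eq_of_fderiv_apply_eq_zero (H := coordMetric e) (c := basisVec 2) (t := u 2)
      (fun u hu => differentiableAt_coordMetric he (ht ▸ hu))
      (fun u hu => hξ.fderiv_coordMetric_eq_zero isOpen_univ he (ht ▸ hu) (mem_univ _)
        (hev u (ht ▸ hu))) hu' (by rw [← eq_incl_add, ← ht]; exact hu)
    rwa [← eq_incl_add] at h1
  · intro u hu
    have h1 := coordMetric_unit hunit he hu
    rwa [hX u hu] at h1
  · intro c hc w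
    have hc' : c ∈ Metric.ball (0 : E2) ε := Metric.ball_subset_ball (by linarith) hc
    have h1 := (orthogonalAt_iff he ht hf.1 hpl hc').1 (horth _) w
    rwa [hX _ (ht ▸ incl_mem_ball.2 hc')] at h1

end Product

/-! ### Fields tangent to a coordinate plane -/

section TangentialFields

variable {G : E3 → E3 →L[ℝ] E3 →L[ℝ] ℝ} {u : E3}

theorem covForm_congr {Y Y' : E3 → E3} (h : Y =ᶠ[𝓝 u] Y') (v w : E3) :
    covForm G Y u v w = covForm G Y' u v w := by
  rw [covForm, covForm, h.fderiv_eq, h.self_of_nhds]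

theorem covForm_eq_add_const (Y : E3 → E3) (v w : E3) :
    covForm G Y u v w = 2 * G u (fderiv ℝ Y u v) w + covForm G (fun _ => Y u) u v w := by
  rw [covForm_const, covForm]
  ring

/-- A field tangent to a totally geodesic coordinate plane has covariant derivatives tangent
to it. -/
theorem covForm_tangential_eq_zero {Y : E3 → E3} {c : E2} (hY : DifferentiableAt ℝ Y (incl c))
    (hY2 : ∀ᶠ d in 𝓝 c, Y (incl d) 2 = 0) {n : E3} (hn : ∀ w, G (incl c) n (incl w) = 0)
    (hsymm : ∀ v w, G (incl c) v w = G (incl c) w v)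
    (hII : ∀ v w, covForm G (fun _ => incl w) (incl c) (incl v) n = 0) (v : E2) :
    covForm G Y (incl c) (incl v) n = 0 := by
  have h1 : fderiv ℝ Y (incl c) (incl v) 2 = 0 := by
    have h2 := fderiv_incl_eq_zero (h := fun u => Y u 2)
      ((EuclideanSpace.proj (𝕜 := ℝ) (2 : Fin 3)).differentiableAt.comp _ hY) hY2 v
    have h3 : HasFDerivAt (fun u => Y u 2)
      ((EuclideanSpace.proj (𝕜 := ℝ) (2 : Fin 3)) ∘L fderiv ℝ Y (incl c)) (incl c) :=
      (EuclideanSpace.proj (𝕜 := ℝ) (2 : Fin 3)).hasFDerivAt.comp _ hY.hasFDerivAt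
    rwa [h3.fderiv] at h2
  rw [covForm_eq_add_const, ← incl_planeProj_of_eq_zero h1, hsymm, hn,
    ← incl_planeProj_of_eq_zero hY2.self_of_nhds, hII, mul_zero, add_zero]

/-- A vector is a combination of an orthonormal pair tangent to the plane and the normal. -/
theorem exists_plane_decomposition (hpos : ∀ v, v ≠ 0 → 0 < G u v v)
    (hsymm : ∀ v w, G u v w = G u w v) {a b : E3} (ha2 : a 2 = 0) (hb2 : b 2 = 0)
    (ha : G u a a = 1) (hb : G u b b = 1) (hab : G u a b = 0) (z : E3) :
    ∃ r s t : ℝ, z = r • a + s • b + t • grad G u := by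
  have hli : LinearIndependent ℝ ![planeProj a, planeProj b] := by
    refine LinearIndependent.pair_iff.2 fun r s hrs => ?_
    have h1 : r • a + s • b = 0 := by
      have := congrArg incl hrs
      rwa [map_add, map_smul, map_smul, incl_planeProj_of_eq_zero ha2,
        incl_planeProj_of_eq_zero hb2, map_zero] at this
    have h2 := congrArg (fun x => G u x a) h1
    have h3 := congrArg (fun x => G u x b) h1
    simp only [map_add, map_smul, _root_.add_apply, _root_.smul_apply, ha, hb, hab, hsymm b a,
      smul_eq_mul, map_zero, _root_.zero_apply] at h2 h3
    constructor <;> linarith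
  have h2 := (grad_apply_two_pos hpos).ne'
  have hspan := hli.span_eq_top_of_card_eq_finrank (by simp)
  have hmem : planeProj (z - (z 2 / grad G u 2) • grad G u) ∈
      Submodule.span ℝ (range ![planeProj a, planeProj b]) := hspan ▸ Submodule.mem_top
  rw [Matrix.range_cons_cons_empty, Submodule.mem_span_pair] at hmem
  obtain ⟨r, s, hrs⟩ := hmem
  refine ⟨r, s, z 2 / grad G u 2, ?_⟩
  have h3 := congrArg incl hrs
  rw [map_add, map_smul, map_smul, incl_planeProj_of_eq_zero ha2, incl_planeProj_of_eq_zero hb2,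
    incl_planeProj_of_eq_zero] at h3
  · rw [h3, sub_add_cancel]
  · rw [PiLp.sub_apply, PiLp.smul_apply, smul_eq_mul, div_mul_cancel₀ _ h2, sub_self]

theorem exists_not_parallel {a : E3} (ha2 : a 2 = 0) (ha : a ≠ 0) :
    ∃ w : E2, ∀ k : ℝ, incl w ≠ k • a := by
  -- A quarter turn of the planar part of `a` in the coordinates.
  refine ⟨!₂[-a 1, a 0], fun k hk => ha ?_⟩
  have h0 := congrArg (fun x : E3 => x 0) hk
  have h1 := congrArg (fun x : E3 => x 1) hk
  simp at h0 h1
  have h3 : (1 + k ^ 2) * a 0 = 0 := by linear_combination h1 - k * h0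
  have h4 : a 0 = 0 := (mul_eq_zero.1 h3).resolve_left (by positivity)
  have h5 : a 1 = 0 := by rw [h4] at h0; linarith
  ext i
  fin_cases i
  · exact h4
  · exact h5
  · exact ha2

/-- A unit field orthogonal to a unit field `X` tangent to the plane, and itself tangent to the
plane. -/
theorem exists_unit_orthogonal_field {X : E3 → E3}
    (hG : ∀ᶠ u in 𝓝 0, ContDiffAt ℝ ∞ G u) (hX : ∀ᶠ u in 𝓝 0, ContDiffAt ℝ ∞ X u)
    (hpos : ∀ v, v ≠ 0 → 0 < G 0 v v)
    (hX1 : ∀ᶠ u in 𝓝 0, G u (X u) (X u) = 1) (hX2 : ∀ᶠ c in 𝓝 (0 : E2), X (incl c) 2 = 0) :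
    ∃ Y : E3 → E3, (∀ᶠ u in 𝓝 0, ContDiffAt ℝ ∞ Y u ∧ G u (Y u) (Y u) = 1 ∧ G u (Y u) (X u) = 0) ∧
      ∀ᶠ c in 𝓝 (0 : E2), Y (incl c) 2 = 0 := by
  have hX20 : X 0 2 = 0 := by have := hX2.self_of_nhds; rwa [map_zero] at this
  obtain ⟨w, hw⟩ := exists_not_parallel hX20 (fun h => by
    have := hX1.self_of_nhds
    rw [h, map_zero] at this
    simp at this)
  -- Gram–Schmidt applied to `X` and a constant vector of the plane. Where `X` is tangent to the
  -- plane, so is `Z`.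
  let Z : E3 → E3 := fun u => incl w - G u (incl w) (X u) • X u
  let n : E3 → ℝ := fun u => G u (Z u) (Z u)
  have hZs : ∀ᶠ u in 𝓝 0, ContDiffAt ℝ ∞ Z u := by
    filter_upwards [hG, hX] with u h1 h2
    exact contDiffAt_const.sub (((h1.clm_apply contDiffAt_const).clm_apply h2).smul h2)
  have hns : ∀ᶠ u in 𝓝 0, ContDiffAt ℝ ∞ n u := by
    filter_upwards [hG, hZs] with u h1 h2
    exact (h1.clm_apply h2).clm_apply h2
  have hn0 : 0 < n 0 := hpos _ fun h => hw _ (sub_eq_zero.1 h)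
  have hn : ∀ᶠ u in 𝓝 0, 0 < n u := hns.self_of_nhds.continuousAt.eventually (lt_mem_nhds hn0)
  refine ⟨fun u => (Real.sqrt (n u))⁻¹ • Z u, ?_, ?_⟩
  · filter_upwards [hZs, hns, hn, hX1] with u h1 h2 h3 h4
    refine ⟨((h2.sqrt h3.ne').inv (Real.sqrt_pos.2 h3).ne').smul h1, ?_, ?_⟩
    · simp only [map_smul, _root_.smul_apply, smul_eq_mul]
      have h5 := Real.sq_sqrt h3.le
      have h6 := (Real.sqrt_pos.2 h3).ne'
      change (√(n u))⁻¹ * ((√(n u))⁻¹ * n u) = 1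
      field_simp
      exact h5.symm
    · simp only [map_smul, _root_.smul_apply, smul_eq_mul, Z, map_sub, _root_.sub_apply, h4]
      ring
  · filter_upwards [hX2] with c hc
    simp [Z, hc]

end TangentialFields

/-! ### From a surface tangent to the Killing field to a geodesic -/

section TangentSurface

variable {M : Type*} [TopologicalSpace M] [ChartedSpace E3 M] [IsManifold (𝓡 3) ∞ M]
  [RiemannianBundle (fun x : M => TangentSpace (𝓡 3) x)]
  [IsContMDiffRiemannianBundle (𝓡 3) ∞ E3 (fun x : M => TangentSpace (𝓡 3) x)]
  {ξ : Π x : M, TangentSpace (𝓡 3) x} {e : OpenPartialHomeomorph M E3}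

theorem nabla_frame_eq_zero (he : e ∈ IsManifold.maximalAtlas (𝓡 3) ∞ M) {u : E3}
    (hu : u ∈ e.target) {Y : Π x : M, TangentSpace (𝓡 3) x} (hY : SmoothFieldAt Y (e.symm u))
    {v : E3} (h : ∀ w, covForm (coordMetric e) (comps e Y) u v w = 0) :
    nabla Y (e.symm u) (frame e u v) = 0 := by
  refine ext_inner_right ℝ fun w => ?_
  obtain ⟨w, rfl⟩ := frame_surjective he hu w
  have h1 := two_inner_nabla he hu hY v w
  rw [h w] at h1
  rw [inner_zero_left]
  linarith

theorem covForm_eq_zero_of_nabla (he : e ∈ IsManifold.maximalAtlas (𝓡 3) ∞ M) {u : E3}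
    (hu : u ∈ e.target) {Y : Π x : M, TangentSpace (𝓡 3) x} (hY : SmoothFieldAt Y (e.symm u))
    {v : E3} (h : nabla Y (e.symm u) (frame e u v) = 0) (w : E3) :
    covForm (coordMetric e) (comps e Y) u v w = 0 := by
  rw [← two_inner_nabla he hu hY v w, h, inner_zero_left, mul_zero]

theorem velocity_symm_comp (he : e ∈ IsManifold.maximalAtlas (𝓡 3) ∞ M) {γ : ℝ → M} {κ : ℝ → E3}
    {κ' : E3} {s : ℝ} (hκ : HasDerivAt κ κ' s) (hs : κ s ∈ e.target)
    (hγ : ∀ᶠ r in 𝓝 s, γ r = e.symm (κ r)) : (velocity γ s : E3) = frame e (κ s) κ' := by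
  have h1 := mfderiv_symm_comp he hκ.hasFDerivAt hs (1 : ℝ)
  have h2 : mfderiv 𝓘(ℝ, ℝ) (𝓡 3) γ s = mfderiv 𝓘(ℝ, ℝ) (𝓡 3) (fun r => e.symm (κ r)) s :=
    Filter.EventuallyEq.mfderiv_eq hγ
  refine (congrArg (fun L : ℝ →L[ℝ] E3 => L 1) h2).trans (h1.trans ?_)
  simp

/-- A totally geodesic surface tangent to `ξ` contains a geodesic orthogonal to `ξ`, along which
`ξ` is parallel. -/
theorem exists_geodesic_of_tangent (hξ : IsKillingOn ξ univ) (hunit : ∀ x, ‖ξ x‖ = 1)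
    {S : Surface} {f : S → M} (hf : IsTotallyGeodesic f) (htan : ∀ r, TangentAt f ξ r) (q : S) :
    ∃ (γ : ℝ → M) (δ : ℝ), 0 < δ ∧ IsGeodesicOn γ (-δ) δ ∧ γ 0 = f q ∧
      ∀ s ∈ Ioo (-δ) δ, velocity γ s ≠ 0 ∧ inner ℝ (velocity γ s) (ξ (γ s)) = (0 : ℝ) ∧
        nabla ξ (γ s) (velocity γ s) = 0 := by
  obtain ⟨e, he, ε, hε, ht, hq, hq0, hpl⟩ := exists_chart_of_immersion (q := q) hf.1 hf.2.1
  have hball : Metric.ball (0 : E3) ε ∈ 𝓝 0 := Metric.ball_mem_nhds _ hε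
  have htar : ∀ᶠ u in 𝓝 (0 : E3), u ∈ e.target := ht ▸ hball
  have hXs : ∀ u ∈ e.target, ContDiffAt ℝ ∞ (comps e ξ) u := fun u hu =>
    contDiffAt_comps he hu (hξ.1.smoothFieldAt_univ _)
  have hX2 : ∀ c ∈ Metric.ball (0 : E2) ε, comps e ξ (incl c) 2 = 0 := fun c hc =>
    comps_two_of_tangentAt he ht hf.1 hpl hc (htan _)
  have h0t : (0 : E3) ∈ e.target := htar.self_of_nhds
  obtain ⟨Y, hY, hY2⟩ := exists_unit_orthogonal_field (G := coordMetric e) (X := comps e ξ)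
    (htar.mono fun u hu => contDiffAt_coordMetric he hu) (htar.mono hXs)
    (fun v hv => coordMetric_pos he h0t hv)
    (htar.mono fun u hu => coordMetric_unit hunit he hu)
    (by filter_upwards [Metric.ball_mem_nhds (0 : E2) hε] with c hc using hX2 c hc)
  obtain ⟨r, hr, hrY⟩ := Metric.eventually_nhds_iff_ball.1 (hY.and htar)
  obtain ⟨r', hr', hrY2⟩ := Metric.eventually_nhds_iff_ball.1
    (hY2.and (Metric.ball_mem_nhds (0 : E2) hε))
  set ρ := min r r' with hρ
  have hρ0 : 0 < ρ := lt_min hr hr'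
  have hYρ : ∀ c ∈ Metric.ball (0 : E2) ρ, ContDiffAt ℝ ∞ (fun c => planeProj (Y (incl c))) c := by
    intro c hc
    have h1 := (hrY (incl c) (incl_mem_ball.2 (Metric.ball_subset_ball (min_le_left _ _) hc))).1.1
    exact planeProj.contDiff.contDiffAt.comp c (h1.comp c incl.contDiff.contDiffAt)
  -- The flow is taken inside the plane, so that the curve lies on the surface by construction.
  obtain ⟨φ, hφs, hφ0, hφ⟩ := exists_smooth_flow (fun c => planeProj (Y (incl c))) 0
    (Metric.ball_mem_nhds (0 : E2) hρ0) (fun c hc => (hYρ c hc).contDiffWithinAt)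
  have htend : Tendsto (fun t : ℝ => ((0 : E2), t)) (𝓝 0) (𝓝 ((0 : E2), (0 : ℝ))) :=
    (Continuous.prodMk_right (0 : E2)).tendsto 0
  have hcont : Tendsto (fun t : ℝ => φ (0, t)) (𝓝 0) (𝓝 0) := by
    have h1 := hφs.self_of_nhds.continuousAt.tendsto.comp htend
    rwa [hφ0] at h1
  obtain ⟨δ, hδ, hδφ⟩ := Metric.eventually_nhds_iff_ball.1 ((htend.eventually (hφs.and hφ)).and
    (hcont.eventually (Metric.ball_mem_nhds (0 : E2) hρ0)))
  rw [Real.ball_eq_Ioo, zero_sub, zero_add] at hδφ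
  let κ : ℝ → E2 := fun t => φ (0, t)
  have hκρ : ∀ s ∈ Ioo (-δ) δ, κ s ∈ Metric.ball (0 : E2) ρ := fun s hs => (hδφ s hs).2
  have hκr : ∀ s ∈ Ioo (-δ) δ, incl (κ s) ∈ Metric.ball (0 : E3) r := fun s hs =>
    incl_mem_ball.2 (Metric.ball_subset_ball (min_le_left _ _) (hκρ s hs))
  have hκt : ∀ s ∈ Ioo (-δ) δ, incl (κ s) ∈ e.target := fun s hs => (hrY _ (hκr s hs)).2
  have hκε : ∀ s ∈ Ioo (-δ) δ, κ s ∈ Metric.ball (0 : E2) ε := fun s hs =>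
    incl_mem_ball.1 (ht ▸ hκt s hs)
  have hY2ev : ∀ s ∈ Ioo (-δ) δ, ∀ᶠ d in 𝓝 (κ s), Y (incl d) 2 = 0 := fun s hs => by
    filter_upwards [Metric.isOpen_ball.mem_nhds (hκρ s hs)] with d hd
    exact (hrY2 d (Metric.ball_subset_ball (min_le_right _ _) hd)).1
  have hκd : ∀ s ∈ Ioo (-δ) δ, HasDerivAt (fun s => incl (κ s)) (Y (incl (κ s))) s := by
    intro s hs
    have h1 := incl.hasFDerivAt.comp_hasDerivAt s (hδφ s hs).1.2.2
    have h2 : incl (planeProj (Y (incl (κ s)))) = Y (incl (κ s)) :=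
      incl_planeProj_of_eq_zero (hY2ev s hs).self_of_nhds
    rw [← h2]
    exact h1
  let γ : ℝ → M := fun s => e.symm (incl (κ s))
  have hvel : ∀ s ∈ Ioo (-δ) δ, (velocity γ s : E3) = frame e (incl (κ s)) (Y (incl (κ s))) :=
    fun s hs => velocity_symm_comp he (hκd s hs) (hκt s hs) (Eventually.of_forall fun _ => rfl)
  have hpos : ∀ s ∈ Ioo (-δ) δ, ∀ v, v ≠ 0 → 0 < coordMetric e (incl (κ s)) v v :=
    fun s hs v hv => coordMetric_pos he (hκt s hs) hv
  have hYat : ∀ s ∈ Ioo (-δ) δ, ContDiffAt ℝ ∞ Y (incl (κ s)) := fun s hs =>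
    (hrY _ (hκr s hs)).1.1
  have hYev : ∀ s ∈ Ioo (-δ) δ, ∀ᶠ u in 𝓝 (incl (κ s)), coordMetric e u (Y u) (Y u) = 1 ∧
      coordMetric e u (Y u) (comps e ξ u) = 0 := fun s hs => by
    filter_upwards [Metric.isOpen_ball.mem_nhds (hκr s hs)] with u hu using (hrY u hu).1.2
  have hII : ∀ s ∈ Ioo (-δ) δ, ∀ v w, covForm (coordMetric e) (fun _ => incl w) (incl (κ s))
      (incl v) (grad (coordMetric e) (incl (κ s))) = 0 := fun s hs v w =>
    covForm_incl_eq_zero he ht hf.1 hpl hf (hκε s hs) v w (metric_grad_incl (hpos s hs))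
  have hspan : ∀ s ∈ Ioo (-δ) δ, ∀ Z : E3 → E3, ∀ v,
      covForm (coordMetric e) Z (incl (κ s)) v (Y (incl (κ s))) = 0 →
      covForm (coordMetric e) Z (incl (κ s)) v (comps e ξ (incl (κ s))) = 0 →
      covForm (coordMetric e) Z (incl (κ s)) v (grad (coordMetric e) (incl (κ s))) = 0 →
      ∀ w, covForm (coordMetric e) Z (incl (κ s)) v w = 0 := by
    intro s hs Z v h1 h2 h3 w
    obtain ⟨a, b, c, rfl⟩ := exists_plane_decomposition (hpos s hs)
      (fun v w => coordMetric_symm _ v w) (hY2ev s hs).self_of_nhds (hX2 _ (hκε s hs))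
      (hYev s hs).self_of_nhds.1 (coordMetric_unit hunit he (hκt s hs))
      (hYev s hs).self_of_nhds.2 w
    rw [covForm_add_right, covForm_add_right, covForm_smul_right, covForm_smul_right,
      covForm_smul_right, h1, h2, h3]
    simp
  -- The component of `∇_Y ξ` along `Y` vanishes by skewness, that along `ξ` by unit length, and the
  -- normal one because the surface is totally geodesic.
  have hXcov : ∀ s ∈ Ioo (-δ) δ, ∀ w,
      covForm (coordMetric e) (comps e ξ) (incl (κ s)) (Y (incl (κ s))) w = 0 := by
    intro s hs
    refine hspan s hs _ _ ?_ (covForm_unit_right hξ hunit he (hκt s hs) _) ?_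
    · have := hξ.covForm_skew isOpen_univ he (hκt s hs) (mem_univ _) (Y (incl (κ s)))
        (Y (incl (κ s)))
      linarith
    · have h1 := covForm_tangential_eq_zero ((hXs _ (hκt s hs)).differentiableAt (by simp))
        (by
          filter_upwards [Metric.isOpen_ball.mem_nhds (hκε s hs)] with d hd using hX2 d hd)
        (metric_grad_incl (hpos s hs)) (fun v w => coordMetric_symm _ v w) (hII s hs)
        (planeProj (Y (incl (κ s))))
      rwa [incl_planeProj_of_eq_zero (hY2ev s hs).self_of_nhds] at h1
  -- Likewise for `∇_Y Y`; its component along `ξ` is `-⟨Y, ∇_Y ξ⟩`, which vanishes by `hXcov`.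
  have hYcov : ∀ s ∈ Ioo (-δ) δ, ∀ w,
      covForm (coordMetric e) Y (incl (κ s)) (Y (incl (κ s))) w = 0 := by
    intro s hs
    have hG := differentiableAt_coordMetric (M := M) he (hκt s hs)
    have hYd := (hYat s hs).differentiableAt (by simp)
    refine hspan s hs _ _ ?_ ?_ ?_
    · have h1 := hasFDerivAt_metric_apply hG hYd hYd (eventually_coordMetric_symm _)
        (Y (incl (κ s)))
      have h2 : (fun u => coordMetric e u (Y u) (Y u)) =ᶠ[𝓝 (incl (κ s))] fun _ => 1 :=
        (hYev s hs).mono fun _ h => h.1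
      rw [h2.fderiv_eq, fderiv_const_apply, _root_.zero_apply] at h1
      linarith
    · have h1 := hasFDerivAt_metric_apply hG hYd ((hXs _ (hκt s hs)).differentiableAt (by simp))
        (eventually_coordMetric_symm _) (Y (incl (κ s)))
      have h2 : (fun u => coordMetric e u (Y u) (comps e ξ u)) =ᶠ[𝓝 (incl (κ s))] fun _ => 0 :=
        (hYev s hs).mono fun _ h => h.2
      rw [h2.fderiv_eq, fderiv_const_apply, _root_.zero_apply, hXcov s hs] at h1
      linarith
    · have h1 := covForm_tangential_eq_zero hYd (hY2ev s hs) (metric_grad_incl (hpos s hs))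
        (fun v w => coordMetric_symm _ v w) (hII s hs) (planeProj (Y (incl (κ s))))
      rwa [incl_planeProj_of_eq_zero (hY2ev s hs).self_of_nhds] at h1
  refine ⟨γ, δ, hδ, ⟨?_, fun s hs => ⟨e.source ∩ e ⁻¹' Metric.ball 0 r, ofComps e Y,
    e.isOpen_inter_preimage Metric.isOpen_ball, ?_, ?_, ?_, ?_⟩⟩, ?_, fun s hs => ⟨?_, ?_, ?_⟩⟩
  · intro s hs
    have h1 : ContDiffAt ℝ ∞ (fun s => incl (κ s)) s := incl.contDiff.contDiffAt.comp s
      ((hδφ s hs).1.1.comp s (contDiffAt_const.prodMk contDiffAt_id))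
    exact ((contMDiffAt_symm_of_mem_maximalAtlas he (hκt s hs)).comp s
      h1.contMDiffAt).contMDiffWithinAt
  · refine ⟨e.map_target (hκt s hs), ?_⟩
    rw [mem_preimage, e.right_inv (hκt s hs)]
    exact hκr s hs
  · refine smoothFieldOn_of_smoothFieldAt fun x hx => ?_
    have := smoothFieldAt_ofComps he (e.map_source hx.1) (hrY _ hx.2).1.1
    rwa [e.left_inv hx.1] at this
  · filter_upwards [isOpen_Ioo.mem_nhds hs] with t ht
    exact (frame_eq_ofComps he (hκt t ht) Y).symm.trans (hvel t ht).symm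
  · refine nabla_congr rfl _ (hvel s hs).symm ?_
    refine nabla_frame_eq_zero he (hκt s hs) (smoothFieldAt_ofComps he (hκt s hs) (hYat s hs)) ?_
    intro w
    rw [covForm_congr (Y' := Y)]
    · exact hYcov s hs w
    · filter_upwards [e.open_target.mem_nhds (hκt s hs)] with u hu
      exact comps_ofComps he hu Y
  · change e.symm (incl (φ (0, 0))) = f q
    rw [hφ0, map_zero, ← hq0, e.left_inv hq]
  · intro h0
    have h1 := (hvel s hs).symm.trans h0
    have h2 := frame_injective he (hκt s hs) (h1.trans (map_zero (frame e (incl (κ s)))).symm)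
    have h3 := (hYev s hs).self_of_nhds.1
    rw [h2, map_zero] at h3
    simp at h3
  · refine Eq.trans ?_ (hYev s hs).self_of_nhds.2
    rw [coordMetric_apply]
    exact inner_congr rfl (hvel s hs) (frame_comps he (hκt s hs) ξ).symm
  · exact nabla_congr rfl _ (hvel s hs).symm (nabla_frame_eq_zero he (hκt s hs)
      (hξ.1.smoothFieldAt_univ _) (hXcov s hs))

end TangentSurface

/-! ### From a geodesic to a surface tangent to the Killing field -/

section GeodesicSweep

theorem exists_notMem_span_pair (a b : E3) : ∃ n : E3, ∀ r s : ℝ, r • a + s • b ≠ n := by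
  obtain ⟨n, hn⟩ := exists_notMem_range
    ((EuclideanSpace.proj (𝕜 := ℝ) (0 : Fin 2)).smulRight a +
      (EuclideanSpace.proj (𝕜 := ℝ) (1 : Fin 2)).smulRight b)
  refine ⟨n, fun r s => ?_⟩
  simpa using hn !₂[r, s]

variable {M : Type*} [TopologicalSpace M] [ChartedSpace E3 M] [IsManifold (𝓡 3) ∞ M]
  [RiemannianBundle (fun x : M => TangentSpace (𝓡 3) x)]
  [IsContMDiffRiemannianBundle (𝓡 3) ∞ E3 (fun x : M => TangentSpace (𝓡 3) x)]
  {ξ : Π x : M, TangentSpace (𝓡 3) x}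

/-- A chart in which `ξ` is the second coordinate field and a given curve transversal to `ξ` is the
first coordinate axis. -/
theorem exists_chart_of_curve (hξ : SmoothFieldOn ξ univ) {γ : ℝ → M} {a b t₀ : ℝ}
    (hγ : ContMDiffOn 𝓘(ℝ, ℝ) (𝓡 3) ∞ γ (Ioo a b)) (ht₀ : t₀ ∈ Ioo a b)
    (htr : ∀ r s : ℝ, r • velocity γ t₀ + s • ξ (γ t₀) = 0 → r = 0 ∧ s = 0) :
    ∃ e ∈ IsManifold.maximalAtlas (𝓡 3) ∞ M, ∃ ε > 0, e.target = Metric.ball 0 ε ∧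
      γ t₀ ∈ e.source ∧ e (γ t₀) = 0 ∧ (∀ u ∈ Metric.ball (0 : E3) ε, comps e ξ u = basisVec 1) ∧
      ∀ s ∈ Ioo (-ε) ε, t₀ + s ∈ Ioo a b ∧ γ (t₀ + s) = e.symm (s • basisVec 0) := by
  have he₀ : chartAt E3 (γ t₀) ∈ IsManifold.maximalAtlas (𝓡 3) ∞ M :=
    IsManifold.chart_mem_maximalAtlas _
  set e₀ := chartAt E3 (γ t₀)
  have hp : γ t₀ ∈ e₀.source := mem_chart_source _ _
  have hat : ∀ s ∈ Ioo a b, ContMDiffAt 𝓘(ℝ, ℝ) (𝓡 3) ∞ γ s := fun s hs =>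
    hγ.contMDiffAt (isOpen_Ioo.mem_nhds hs)
  let κ : ℝ → E3 := fun s => e₀ (γ (t₀ + s))
  have hev : ∀ᶠ s in 𝓝 (0 : ℝ), t₀ + s ∈ Ioo a b ∧ γ (t₀ + s) ∈ e₀.source := by
    have h1 : Tendsto (fun s : ℝ => t₀ + s) (𝓝 0) (𝓝 t₀) := by
      have : Continuous fun s : ℝ => t₀ + s := by fun_prop
      simpa using this.tendsto 0
    exact (h1.eventually (isOpen_Ioo.mem_nhds ht₀)).and
      (h1.eventually ((hat t₀ ht₀).continuousAt.eventually (e₀.open_source.mem_nhds hp)))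
  have hκs : ∀ s, t₀ + s ∈ Ioo a b ∧ γ (t₀ + s) ∈ e₀.source → ContDiffAt ℝ ∞ κ s := by
    intro s hs
    have h1 : ContDiff ℝ ∞ fun s : ℝ => t₀ + s := contDiff_const.add contDiff_id
    exact ((contMDiffAt_of_mem_maximalAtlas he₀ hs.2).comp s
      ((hat _ hs.1).comp s h1.contMDiff.contMDiffAt)).contDiffAt
  have hκ0 : κ 0 = e₀ (γ t₀) := by simp only [κ, add_zero]
  have hκd : HasDerivAt κ (deriv κ 0) 0 :=
    ((hκs 0 hev.self_of_nhds).differentiableAt (by simp)).hasDerivAt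
  have hvel : (velocity γ t₀ : E3) = frame e₀ (e₀ (γ t₀)) (deriv κ 0) := by
    have h1 : HasDerivAt (fun s => κ (s - t₀)) (deriv κ 0) t₀ := by
      refine HasDerivAt.comp_sub_const t₀ t₀ ?_
      rwa [sub_self]
    have h2 := velocity_symm_comp he₀ (γ := γ) h1
      (by simp only [sub_self, hκ0]; exact e₀.map_source hp)
      (by
        filter_upwards [(hat t₀ ht₀).continuousAt.eventually (e₀.open_source.mem_nhds hp)] with s hs
        simp only [κ, add_sub_cancel]
        exact (e₀.left_inv hs).symm)
    exact h2.trans (congrArg (fun x : E3 => (frame e₀ x (deriv κ 0) : E3))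
      (by rw [sub_self, hκ0]))
  have hind : ∀ r s : ℝ, r • deriv κ 0 + s • comps e₀ ξ (e₀ (γ t₀)) = 0 → r = 0 ∧ s = 0 := by
    intro r s h
    have h1 := congrArg (frame e₀ (e₀ (γ t₀))) h
    rw [map_add, map_smul, map_smul, map_zero, frame_comps he₀ (e₀.map_source hp)] at h1
    refine htr r s (Eq.trans ?_ h1)
    exact congrArg₂ (fun x y : E3 => r • x + s • y) hvel
      (congrArg (fun x => (ξ x : E3)) (e₀.left_inv hp).symm)
  obtain ⟨ν, hν⟩ := exists_notMem_span_pair (deriv κ 0) (comps e₀ ξ (e₀ (γ t₀)))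
  -- The slice contains the curve as its first axis; `ν` is any vector independent of the velocity
  -- and `ξ`.
  let T : E3 → E3 := fun u => κ (u 0) + u 2 • ν
  have htend : Tendsto (fun u : E3 => u 0) (𝓝 0) (𝓝 0) :=
    (EuclideanSpace.proj (𝕜 := ℝ) (0 : Fin 3)).continuous.tendsto 0
  have hTd : HasFDerivAt T ((EuclideanSpace.proj (𝕜 := ℝ) (0 : Fin 3)).smulRight (deriv κ 0) +
      (EuclideanSpace.proj (𝕜 := ℝ) (2 : Fin 3)).smulRight ν) 0 := by
    have h1 : HasFDerivAt (fun u : E3 => κ (u 0))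
        ((EuclideanSpace.proj (𝕜 := ℝ) (0 : Fin 3)).smulRight (deriv κ 0)) 0 := by
      refine (HasFDerivAt.comp (g := κ) (f := fun u : E3 => u 0) (0 : E3) hκd.hasFDerivAt
        (EuclideanSpace.proj (𝕜 := ℝ) (0 : Fin 3)).hasFDerivAt).congr_fderiv ?_
      ext1 v
      simp
    exact h1.add ((EuclideanSpace.proj (𝕜 := ℝ) (2 : Fin 3)).smulRight ν).hasFDerivAt
  obtain ⟨e, he, ε, hε, ht, hW, hpe, hep, hX, hsl⟩ := exists_flowBox he₀ hp hξ 1 (T := T)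
    (by
      filter_upwards [htend.eventually hev] with u hu
      exact ((hκs _ hu).comp u
        (EuclideanSpace.proj (𝕜 := ℝ) (0 : Fin 3)).contDiff.contDiffAt).add
        ((EuclideanSpace.proj (𝕜 := ℝ) (2 : Fin 3)).smulRight ν).contDiff.contDiffAt)
    (by simp [T, hκ0])
    (by intro u t; simp [T])
    (by
      intro v hv
      rw [hTd.fderiv] at hv
      have hv' : v 0 • deriv κ 0 + v 2 • ν + v 1 • comps e₀ ξ (e₀ (γ t₀)) = 0 := hv
      have h2 : v 2 = 0 := by
        by_contra h2
        refine hν (-(v 2)⁻¹ * v 0) (-(v 2)⁻¹ * v 1) ?_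
        have h3 : v 0 • deriv κ 0 + v 1 • comps e₀ ξ (e₀ (γ t₀)) = -(v 2 • ν) := by
          rw [eq_neg_iff_add_eq_zero, ← hv']; abel
        rw [mul_smul, mul_smul, ← smul_add, h3, neg_smul, smul_neg, neg_neg, smul_smul,
          inv_mul_cancel₀ h2, one_smul]
      rw [h2, zero_smul, add_zero] at hv'
      obtain ⟨h0, h1⟩ := hind _ _ hv'
      ext i
      fin_cases i
      · exact h0
      · exact h1
      · exact h2)
    (htend.eventually hev)
  refine ⟨e, he, ε, hε, ht, hpe, hep, hX, fun s hs => ?_⟩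
  have hm : s • basisVec 0 ∈ Metric.ball (0 : E3) ε := by
    rw [mem_ball_zero_iff, norm_smul, norm_basisVec, mul_one, Real.norm_eq_abs]
    exact abs_lt.2 hs
  have h1 := hW hm
  simp only [mem_ofPred_eq] at h1
  have h0 : (s • basisVec 0 : E3) 0 = s := by simp
  rw [h0] at h1
  refine ⟨h1.1, ?_⟩
  rw [hsl _ hm (by simp)]
  simp only [T, h0]
  simp only [κ, PiLp.smul_apply, PiLp.single_apply]
  simpa using (e₀.left_inv h1.2).symm

/-- The values agree on a neighbourhood of `u`, so the first derivatives agree too, and with them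
the coefficients of the connection. -/
theorem coordMetric_translate {e : OpenPartialHomeomorph M E3} {ε : ℝ} {c : E3}
    (he : e ∈ IsManifold.maximalAtlas (𝓡 3) ∞ M) (ht : e.target = Metric.ball 0 ε)
    (h0 : ∀ u ∈ Metric.ball (0 : E3) ε, fderiv ℝ (coordMetric e) u c = 0) {u : E3} {t : ℝ}
    (hu : u ∈ Metric.ball (0 : E3) ε) (hut : u + t • c ∈ Metric.ball (0 : E3) ε) :
    coordMetric e (u + t • c) = coordMetric e u ∧
      fderiv ℝ (coordMetric e) (u + t • c) = fderiv ℝ (coordMetric e) u := by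
  have key : ∀ y ∈ Metric.ball (0 : E3) ε, y + t • c ∈ Metric.ball (0 : E3) ε →
      coordMetric e (y + t • c) = coordMetric e y := fun y hy hyt =>
    eq_of_fderiv_apply_eq_zero (fun u hu => differentiableAt_coordMetric he (ht ▸ hu)) h0 hy hyt
  refine ⟨key u hu hut, ?_⟩
  rw [← fderiv_comp_add_right]
  refine Filter.EventuallyEq.fderiv_eq ?_
  have hc : Continuous fun y : E3 => y + t • c := by fun_prop
  filter_upwards [Metric.isOpen_ball.mem_nhds hu,
    hc.continuousAt.eventually (Metric.isOpen_ball.mem_nhds hut)] with y h1 h2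
  exact key y h1 h2

theorem covForm_const_bilinear {G : E3 → E3 →L[ℝ] E3 →L[ℝ] ℝ} {u : E3}
    (hG : DifferentiableAt ℝ G u) (hs : ∀ᶠ y in 𝓝 u, ∀ v w, G y v w = G y w v) {a b n : E3}
    (haa : covForm G (fun _ => a) u a n = 0) (hab : covForm G (fun _ => b) u a n = 0)
    (hbb : covForm G (fun _ => b) u b n = 0) (v₀ v₁ w₀ w₁ : ℝ) :
    covForm G (fun _ => w₀ • a + w₁ • b) u (v₀ • a + v₁ • b) n = 0 := by
  have hba : covForm G (fun _ => a) u b n = 0 := by rw [covForm_const_swap hG hs, hab]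
  rw [covForm_add_left, covForm_smul_left, covForm_smul_left, covForm_const_swap hG hs,
    covForm_const_swap hG hs _ b, covForm_add_left, covForm_smul_left, covForm_smul_left,
    covForm_add_left, covForm_smul_left, covForm_smul_left, haa, hab, hba, hbb]
  simp

/-- The flow of `ξ` sweeps a totally geodesic surface out of a geodesic along which `ξ` is
parallel. -/
theorem exists_tangent_surface_of_geodesic (hξ : IsKillingOn ξ univ) (hunit : ∀ x, ‖ξ x‖ = 1)
    {γ : ℝ → M} {a b t₀ : ℝ} (hγ : IsGeodesicOn γ a b) (ht₀ : t₀ ∈ Ioo a b)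
    (hv0 : velocity γ t₀ ≠ 0) (horth : inner ℝ (velocity γ t₀) (ξ (γ t₀)) = (0 : ℝ))
    (hpar : ∀ s ∈ Ioo a b, ∀ v, nabla ξ (γ s) v = 0) :
    ∃ (S : Surface) (f : S → M) (q : S), IsTotallyGeodesic f ∧ f q = γ t₀ ∧
      ∀ r, TangentAt f ξ r := by
  have htr : ∀ r s : ℝ, r • velocity γ t₀ + s • ξ (γ t₀) = 0 → r = 0 ∧ s = 0 := by
    intro r s h
    have h1 := congrArg (fun x => inner ℝ x (ξ (γ t₀))) h
    simp only [inner_add_left, real_inner_smul_left, horth, real_inner_self_eq_norm_sq, hunit,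
      inner_zero_left] at h1
    have hs : s = 0 := by linarith
    rw [hs, zero_smul, add_zero] at h
    exact ⟨(smul_eq_zero.1 h).resolve_right hv0, hs⟩
  obtain ⟨e, he, ε, hε, ht, hp, hep, hX, hax⟩ := exists_chart_of_curve hξ.1 hγ.1 ht₀ htr
  have hev : ∀ u ∈ Metric.ball (0 : E3) ε, ∀ᶠ y in 𝓝 u, comps e ξ y = basisVec 1 := fun u hu => by
    filter_upwards [Metric.isOpen_ball.mem_nhds hu] with y hy using hX y hy
  have hinv : ∀ u ∈ Metric.ball (0 : E3) ε, fderiv ℝ (coordMetric e) u (basisVec 1) = 0 :=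
    fun u hu => hξ.fderiv_coordMetric_eq_zero isOpen_univ he (ht ▸ hu) (mem_univ _) (hev u hu)
  -- On the axis all covariant derivatives between `∂₀` and `∂₁` vanish: `∇ ∂₁ = 0` since `ξ` is
  -- parallel there, `∇_{∂₀} ∂₀ = 0` since the curve is a geodesic, and `∇_{∂₁} ∂₀` by symmetry. The
  -- last argument `n` is arbitrary.
  have haxis : ∀ s ∈ Ioo (-ε) ε, ∀ v w n, covForm (coordMetric e) (fun _ => incl w)
      (s • basisVec 0) (incl v) n = 0 := by
    intro s hs v w n
    obtain ⟨hs1, hs2⟩ := hax s hs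
    have hball : s • basisVec 0 ∈ Metric.ball (0 : E3) ε := by
      rw [mem_ball_zero_iff, norm_smul, norm_basisVec, mul_one, Real.norm_eq_abs]
      exact abs_lt.2 hs
    have hu : s • basisVec 0 ∈ e.target := ht ▸ hball
    have hξcov : ∀ v, covForm (coordMetric e) (fun _ => basisVec 1) (s • basisVec 0) v n = 0 := by
      intro v
      rw [← covForm_congr (hev _ hball)]
      refine covForm_eq_zero_of_nabla he hu (hξ.1.smoothFieldAt_univ _) ?_ n
      exact nabla_congr hs2 ξ rfl (hpar _ hs1 _)
    obtain ⟨U, V, hU, hγU, hV, hVv, hV0⟩ := hγ.2 (t₀ + s) hs1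
    have hvel : ∀ᶠ r in 𝓝 s, (velocity γ (t₀ + r) : E3) =
        frame e (r • basisVec 0) (basisVec 0) := by
      filter_upwards [isOpen_Ioo.mem_nhds hs] with r hr
      have hball' : r • basisVec 0 ∈ e.target := by
        rw [ht, mem_ball_zero_iff, norm_smul, norm_basisVec, mul_one, Real.norm_eq_abs]
        exact abs_lt.2 hr
      have h1 : HasDerivAt (fun r : ℝ => (r - t₀) • basisVec 0) (basisVec 0) (t₀ + r) := by
        simpa using ((hasDerivAt_id (t₀ + r)).sub_const t₀).smul_const (basisVec 0)
      have h2 := velocity_symm_comp he (γ := γ) h1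
        (by simp only [add_sub_cancel_left]; exact hball')
        (by
          have hc : Tendsto (fun x : ℝ => x - t₀) (𝓝 (t₀ + r)) (𝓝 r) := by
            have : Continuous fun x : ℝ => x - t₀ := by fun_prop
            simpa using this.tendsto (t₀ + r)
          filter_upwards [hc.eventually (isOpen_Ioo.mem_nhds hr)] with x hx
          have := (hax _ hx).2
          rwa [add_sub_cancel] at this)
      exact h2.trans (congrArg (fun x : E3 => (frame e x (basisVec 0) : E3))
        (by rw [add_sub_cancel_left]))
    have hcomp : ∀ᶠ r in 𝓝 s, comps e V (r • basisVec 0) = basisVec 0 := by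
      have hc : Tendsto (fun x : ℝ => t₀ + x) (𝓝 s) (𝓝 (t₀ + s)) :=
        (continuous_const.add continuous_id).tendsto s
      filter_upwards [hvel, hc.eventually hVv, isOpen_Ioo.mem_nhds hs] with r h1 h2 hr
      have hball' : r • basisVec 0 ∈ e.target := by
        rw [ht, mem_ball_zero_iff, norm_smul, norm_basisVec, mul_one, Real.norm_eq_abs]
        exact abs_lt.2 hr
      refine comps_eq_of_frame_eq he hball' ?_
      refine h1.symm.trans (h2.symm.trans ?_)
      exact congrArg (fun x => (V x : E3)) (hax r hr).2
    have hVs : SmoothFieldAt V (e.symm (s • basisVec 0)) := by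
      rw [← hs2]; exact hV.smoothFieldAt hU hγU
    have hVd : DifferentiableAt ℝ (comps e V) (s • basisVec 0) :=
      (contDiffAt_comps he hu hVs).differentiableAt (by simp)
    have hγcov : covForm (coordMetric e) (fun _ => basisVec 0) (s • basisVec 0) (basisVec 0) n
        = 0 := by
      have h1 : covForm (coordMetric e) (comps e V) (s • basisVec 0) (basisVec 0) n = 0 :=
        covForm_eq_zero_of_nabla he hu hVs (nabla_congr hs2 V hvel.self_of_nhds hV0) n
      -- The extension `V` is known to equal `∂₀` only along the axis, so only its derivative in the
      -- direction of the axis is controlled, which is all that is needed.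
      have h2 : fderiv ℝ (comps e V) (s • basisVec 0) (basisVec 0) = 0 := by
        have h3 : HasDerivAt (fun r : ℝ => r • basisVec 0) (basisVec 0) s := by
          simpa using (hasDerivAt_id s).smul_const (basisVec 0)
        have h4 := hVd.hasFDerivAt.comp_hasDerivAt s h3
        exact h4.unique ((hasDerivAt_const s (basisVec 0)).congr_of_eventuallyEq hcomp)
      rwa [covForm_eq_add_const, h2, map_zero, _root_.zero_apply, mul_zero, zero_add,
        hcomp.self_of_nhds] at h1
    rw [incl_apply, incl_apply]
    exact covForm_const_bilinear (differentiableAt_coordMetric he hu)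
      (eventually_coordMetric_symm _) hγcov (hξcov _) (hξcov _) _ _ _ _
  refine ⟨planeSurface, planeMap e ε, (0 : E2), isTotallyGeodesic_planeMap he hε ht ?_,
    planeMap_zero hp hep, fun r => ?_⟩
  · intro c hc v w
    have h1 : incl c ∈ Metric.ball (0 : E3) ε := incl_mem_ball.2 hc
    have hc0 : c 0 ∈ Ioo (-ε) ε := by
      rw [mem_ball_zero_iff] at hc
      have := (PiLp.norm_apply_le c 0).trans_lt hc
      exact abs_lt.1 this
    have h2 : c 0 • basisVec 0 ∈ Metric.ball (0 : E3) ε := by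
      rw [mem_ball_zero_iff, norm_smul, norm_basisVec, mul_one, Real.norm_eq_abs]
      exact abs_lt.2 hc0
    -- Invariance under the flow of `ξ` carries the vanishing from the axis to the whole plane.
    have h3 := coordMetric_translate he ht hinv h2 (t := c 1) (by rwa [← incl_apply])
    rw [← incl_apply] at h3
    have h4 := haxis (c 0) hc0 v w (grad (coordMetric e) (incl c))
    rw [covForm_const] at h4 ⊢
    rw [h3.2]
    exact h4
  · refine (tangentAt_planeMap he hε ht ξ r).2 ?_
    rw [hX _ (incl_mem_ball.2 (disc_mem hε r))]
    simp

end GeodesicSweep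

/-! ### Derivatives along lines -/

section CoordinateCalculus

variable {G : E3 → E3 →L[ℝ] E3 →L[ℝ] ℝ} {u : E3}

theorem fderiv_metric_const (hG : DifferentiableAt ℝ G u) (c v w : E3) :
    fderiv ℝ (fun y => G y v w) u c = fderiv ℝ G u c v w := by
  have h := ((hG.hasFDerivAt.clm_apply (hasFDerivAt_const v u)).clm_apply
    (hasFDerivAt_const w u)).fderiv
  rw [h]
  simp

theorem covForm_sub {X Y : E3 → E3} (hX : DifferentiableAt ℝ X u) (hY : DifferentiableAt ℝ Y u)
    (v w : E3) : covForm G (fun y => X y - Y y) u v w = covForm G X u v w - covForm G Y u v w := by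
  simp only [covForm]
  rw [fderiv_fun_sub hX hY]
  simp only [_root_.sub_apply, map_sub]
  ring

theorem fderiv_apply_eq_zero_of_line {F : Type*} [NormedAddCommGroup F] [NormedSpace ℝ F]
    {h : E3 → F} {c : E3} (hd : DifferentiableAt ℝ h u)
    (hc : ∀ᶠ t in 𝓝 (0 : ℝ), h (u + t • c) = h u) : fderiv ℝ h u c = 0 := by
  have h1 : HasDerivAt (fun t : ℝ => u + t • c) c 0 := by
    simpa using ((hasDerivAt_id (0 : ℝ)).smul_const c).const_add u
  have h2 : HasFDerivAt h (fderiv ℝ h u) (u + (0 : ℝ) • c) := by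
    rw [zero_smul, add_zero]; exact hd.hasFDerivAt
  exact (h2.comp_hasDerivAt 0 h1).unique ((hasDerivAt_const 0 (h u)).congr_of_eventuallyEq hc)

theorem eventually_line_mem {s : Set E3} (hs : IsOpen s) (hu : u ∈ s) (c : E3) :
    ∀ᶠ t in 𝓝 (0 : ℝ), u + t • c ∈ s := by
  have h : Continuous fun t : ℝ => u + t • c := by fun_prop
  refine h.continuousAt.eventually (hs.mem_nhds ?_)
  simpa using hu

end CoordinateCalculus

/-! ### From adapted coordinates to a totally geodesic surface -/

section AdaptedCoordinates

variable {M : Type*} [TopologicalSpace M] [ChartedSpace E3 M] [IsManifold (𝓡 3) ∞ M]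
  [RiemannianBundle (fun x : M => TangentSpace (𝓡 3) x)]
  [IsContMDiffRiemannianBundle (𝓡 3) ∞ E3 (fun x : M => TangentSpace (𝓡 3) x)]
  {ξ : Π x : M, TangentSpace (𝓡 3) x}

/-- The translation of a chart, sending a given point to the origin. -/
theorem exists_centered_chart {e : OpenPartialHomeomorph M E3}
    (he : e ∈ IsManifold.maximalAtlas (𝓡 3) ∞ M) {p : M} (hp : p ∈ e.source) :
    ∃ e' ∈ IsManifold.maximalAtlas (𝓡 3) ∞ M, ∃ ε > 0, e'.target = Metric.ball 0 ε ∧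
      p ∈ e'.source ∧ e' p = 0 ∧ ∀ u ∈ Metric.ball (0 : E3) ε, e p + u ∈ e.target ∧
        e'.symm u = e.symm (e p + u) ∧ ∀ v, (frame e' u v : E3) = frame e (e p + u) v := by
  have hF : ∀ u : E3, HasFDerivAt (fun u : E3 => e p + u) (ContinuousLinearMap.id ℝ E3) u :=
    fun u => (hasFDerivAt_id u).const_add _
  obtain ⟨e', he', ε, hε, ht, -, hp', hp0, hs⟩ := exists_chart he hp (F := fun u => e p + u)
    (Eventually.of_forall fun u => (contDiff_const.add contDiff_id).contDiffAt) (add_zero _)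
    (by rw [(hF 0).fderiv]; exact ⟨ContinuousLinearEquiv.refl ℝ E3, rfl⟩) univ_mem
  refine ⟨e', he', ε, hε, ht, hp', hp0, fun u hu => ⟨(hs u hu).2.1, (hs u hu).2.2, fun v => ?_⟩⟩
  have h1 := frame_comp he (hF u).differentiableAt (hs u hu).2.1
    (by filter_upwards [Metric.isOpen_ball.mem_nhds hu] with y hy using (hs y hy).2.2) v
  rwa [(hF u).fderiv] at h1

/-- The surface is the plane through `p` on which `z` is constant. It is totally geodesic because
the metric is diagonal and independent of `z`. -/
theorem HasAdaptedCoordinatesAt.exists_surface {p : M} (h : HasAdaptedCoordinatesAt ξ p) :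
    ∃ (S : Surface) (f : S → M) (q : S), IsTotallyGeodesic f ∧ f q = p ∧
      ¬ OrthogonalAt f ξ q ∧ ¬ TangentAt f ξ q := by
  obtain ⟨e₀, he₀, θ, hp₀, -, hg, hξ⟩ := h
  obtain ⟨e, he, ε, hε, ht, hp, hp0, hs⟩ := exists_centered_chart he₀ hp₀
  have hG : ∀ u ∈ Metric.ball (0 : E3) ε, ∀ v w, coordMetric e u v w =
      v 0 * w 0 + Real.sin (θ (e₀ p 0 + u 0)) ^ 2 * (v 1 * w 1)
          + Real.cos (θ (e₀ p 0 + u 0)) ^ 2 * (v 2 * w 2) := by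
    intro u hu v w
    obtain ⟨h1, h2, h3⟩ := hs u hu
    have h4 := hg _ h1 v w
    rw [PiLp.add_apply] at h4
    rw [coordMetric_apply, ← h4]
    exact inner_congr h2 (h3 v) (h3 w)
  have hX : ∀ u ∈ Metric.ball (0 : E3) ε, comps e ξ u = basisVec 1 + basisVec 2 := by
    intro u hu
    obtain ⟨h1, h2, h3⟩ := hs u hu
    refine comps_eq_of_frame_eq he (ht ▸ hu) ?_
    refine (h3 _).trans ?_
    rw [map_add]
    exact (hξ _ h1).symm.trans (congrArg (fun x => (ξ x : E3)) h2.symm)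
  have hpos : ∀ u ∈ Metric.ball (0 : E3) ε, ∀ v, v ≠ 0 → 0 < coordMetric e u v v :=
    fun u hu v hv => coordMetric_pos he (ht ▸ hu) hv
  have hb : ∀ i, basisVec i ≠ 0 := fun i h => by
    have := norm_basisVec i
    rw [h, norm_zero] at this
    exact zero_ne_one this
  refine ⟨planeSurface, planeMap e ε, (0 : E2), isTotallyGeodesic_planeMap he hε ht ?_,
    planeMap_zero hp hp0, ?_, ?_⟩
  · intro c hc v w
    have hu := incl_mem_ball.2 hc
    have hd := differentiableAt_coordMetric (M := M) he (ht ▸ hu : incl c ∈ e.target)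
    have hII : covForm (coordMetric e) (fun _ => incl w) (incl c) (incl v) (basisVec 2) = 0 := by
      have h1 : ∀ a b : E2,
          fderiv ℝ (coordMetric e) (incl c) (incl a) (incl b) (basisVec 2) = 0 := by
        intro a b
        rw [← fderiv_metric_const hd]
        refine fderiv_apply_eq_zero_of_line
          ((hd.clm_apply (differentiableAt_const _)).clm_apply (differentiableAt_const _)) ?_
        filter_upwards [eventually_line_mem Metric.isOpen_ball hu (incl a)] with t ht
        rw [hG _ ht, hG _ hu]
        simp
      have h2 : fderiv ℝ (coordMetric e) (incl c) (basisVec 2) (incl v) (incl w) = 0 := by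
        rw [← fderiv_metric_const hd]
        refine fderiv_apply_eq_zero_of_line
          ((hd.clm_apply (differentiableAt_const _)).clm_apply (differentiableAt_const _)) ?_
        filter_upwards [eventually_line_mem Metric.isOpen_ball hu (basisVec 2)] with t ht
        rw [hG _ ht, hG _ hu]
        simp
      rw [covForm_const, h1, h1, h2, add_zero, sub_zero]
    have h3 := eq_smul_grad (hpos _ hu) (n := basisVec 2) (fun c => by rw [hG _ hu]; simp)
    rw [h3, covForm_smul_right, smul_eq_mul] at hII
    exact (mul_eq_zero.1 hII).resolve_left (hpos _ hu _ (hb 2)).ne'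
  · rw [orthogonalAt_planeMap he hε ht]
    push Not
    -- The direction `∂_y`: its product with `ξ` is `sin² θ`, which is positive as the squared
    -- length of `∂_y`.
    refine ⟨!₂[0, 1], ?_⟩
    have hu : incl (disc ε 0) ∈ Metric.ball (0 : E3) ε := incl_mem_ball.2 (disc_mem hε 0)
    have h1 := hpos _ hu _ (hb 1)
    rw [hG _ hu] at h1
    rw [hX _ hu, hG _ hu]
    simp at h1 ⊢
    exact fun h0 => by simp [h0] at h1
  · rw [tangentAt_planeMap he hε ht]
    have hu : incl (disc ε 0) ∈ Metric.ball (0 : E3) ε := incl_mem_ball.2 (disc_mem hε 0)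
    rw [hX _ hu]
    simp

theorem IsKillingOn.mono {X : Π x : M, TangentSpace (𝓡 3) x} {U V : Set M} (hX : IsKillingOn X U)
    (h : V ⊆ U) : IsKillingOn X V :=
  ⟨ContMDiffOn.mono hX.1 h, fun Y Z W hW hWV => hX.2 Y Z W hW (hWV.trans h)⟩

end AdaptedCoordinates

/-! ### The normal part of the Killing field -/

section NormalField

variable {G : E3 → E3 →L[ℝ] E3 →L[ℝ] ℝ} {u : E3}

/-- The field normal to the planes `u₂ = const` with third component `1`. -/
def normalField (G : E3 → E3 →L[ℝ] E3 →L[ℝ] ℝ) (u : E3) : E3 := (grad G u 2)⁻¹ • grad G u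

theorem normalField_apply_two (hpos : ∀ v, v ≠ 0 → 0 < G u v v) : normalField G u 2 = 1 := by
  rw [normalField, PiLp.smul_apply, smul_eq_mul, inv_mul_cancel₀ (grad_apply_two_pos hpos).ne']

theorem metric_normalField (hpos : ∀ v, v ≠ 0 → 0 < G u v v) (w : E3) :
    G u (normalField G u) w = (grad G u 2)⁻¹ * w 2 := by
  rw [normalField, map_smul, _root_.smul_apply, metric_grad hpos, smul_eq_mul]

theorem contDiffAt_normalField (hpos : ∀ v, v ≠ 0 → 0 < G u v v) (hG : ContDiffAt ℝ ∞ G u) :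
    ContDiffAt ℝ ∞ (normalField G) u := by
  have h1 := contDiffAt_grad hpos hG
  have h2 : ContDiffAt ℝ ∞ (fun y => grad G y 2) u :=
    (EuclideanSpace.proj (𝕜 := ℝ) (2 : Fin 3)).contDiff.contDiffAt.comp u h1
  exact (h2.inv (grad_apply_two_pos hpos).ne').smul h1

theorem normalField_ne_zero (hpos : ∀ v, v ≠ 0 → 0 < G u v v) : normalField G u ≠ 0 := by
  intro h
  have := normalField_apply_two hpos
  rw [h] at this
  simp at this

/-- If `∂₂` is a unit Killing field and the planes `u₂ = const` are totally geodesic, their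
normal field is a Killing field. -/
theorem covForm_normalField_skew (hpos : ∀ᶠ y in 𝓝 u, ∀ v, v ≠ 0 → 0 < G y v v)
    (hG : ContDiffAt ℝ ∞ G u) (hs : ∀ᶠ y in 𝓝 u, ∀ v w, G y v w = G y w v)
    (hinv : ∀ᶠ t in 𝓝 (0 : ℝ), G (u + t • basisVec 2) = G u)
    (hξ : ∀ w, covForm G (fun _ => basisVec 2) u (basisVec 2) w = 0)
    (hII : ∀ v w, covForm G (fun _ => incl w) u (incl v) (grad G u) = 0) (v w : E3) :
    covForm G (normalField G) u v w = - covForm G (normalField G) u w v := by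
  have hp := hpos.self_of_nhds
  have hGd : DifferentiableAt ℝ G u := hG.differentiableAt (by simp)
  have hNd : DifferentiableAt ℝ (normalField G) u :=
    (contDiffAt_normalField hp hG).differentiableAt (by simp)
  have hprod : ∀ c z, fderiv ℝ (fun y => G y (normalField G y) c) u z =
      (covForm G (normalField G) u z c + covForm G (fun _ => c) u z (normalField G u)) / 2 :=
    fun c z => hasFDerivAt_metric_apply hGd hNd (differentiableAt_const c) hs z
  have hpl : ∀ (b : E2) (z : E3), covForm G (normalField G) u z (incl b) =
      - covForm G (fun _ => incl b) u z (normalField G u) := by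
    intro b z
    have h1 := hprod (incl b) z
    have h2 : (fun y => G y (normalField G y) (incl b)) =ᶠ[𝓝 u] fun _ => 0 :=
      hpos.mono fun y hy => by
        simp only [metric_normalField hy, incl_apply_two, mul_zero]
    rw [h2.fderiv_eq, fderiv_const_apply, _root_.zero_apply] at h1
    linarith
  have hIIN : ∀ a b, covForm G (fun _ => incl b) u (incl a) (normalField G u) = 0 := by
    intro a b
    rw [normalField, covForm_smul_right, hII, smul_zero]
  -- Tangential against tangential: the second fundamental form, which vanishes.
  have hpp : ∀ a b, covForm G (normalField G) u (incl a) (incl b) = 0 := by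
    intro a b
    rw [hpl, hIIN, neg_zero]
  -- The field is the normal part of `∂₂`, so its product with `∂₂` is its squared length.
  have hself : ∀ z, fderiv ℝ (fun y => G y (normalField G y) (basisVec 2)) u z =
      covForm G (normalField G) u z (normalField G u) := by
    intro z
    have h1 := hasFDerivAt_metric_apply hGd hNd hNd hs z
    have h2 : (fun y => G y (normalField G y) (basisVec 2)) =ᶠ[𝓝 u]
        fun y => G y (normalField G y) (normalField G y) :=
      hpos.mono fun y hy => by
        simp only [metric_normalField hy, normalField_apply_two hy]
        simp
    rw [h2.fderiv_eq, h1]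
    ring
  -- With `N` the normal field, differentiating `⟨N, ∂₂⟩ = ⟨N, N⟩` along `a` gives `⟨N, ∇_a ∂₂⟩ =
  -- ⟨∇_a N, N⟩`, which is `⟨∇_a N, ∂₂⟩` by `hpp`. Absence of torsion turns the left side into `⟨N,
  -- ∇_{∂₂} a⟩ = -⟨∇_{∂₂} N, a⟩`.
  have hmixed : ∀ a, covForm G (normalField G) u (incl a) (basisVec 2) =
      - covForm G (normalField G) u (basisVec 2) (incl a) := by
    intro a
    have h1 := hprod (basisVec 2) (incl a)
    rw [hself] at h1
    have h2 : covForm G (normalField G) u (incl a) (basisVec 2) =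
        covForm G (normalField G) u (incl a) (normalField G u) := by
      have h3 : (basisVec 2 - normalField G u) 2 = 0 := by
        rw [PiLp.sub_apply, normalField_apply_two hp]
        simp
      have h4 : basisVec 2 = incl (planeProj (basisVec 2 - normalField G u)) + normalField G u := by
        rw [incl_planeProj_of_eq_zero h3, sub_add_cancel]
      rw [h4, covForm_add_right, hpp, zero_add]
    rw [hpl a, covForm_const_swap hGd hs]
    linarith
  have h22 : covForm G (normalField G) u (basisVec 2) (basisVec 2) = 0 := by
    have h1 := hprod (basisVec 2) (basisVec 2)
    rw [hξ, fderiv_apply_eq_zero_of_line ((hGd.clm_apply hNd).clm_apply (differentiableAt_const _))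
      (hinv.mono fun t ht => by simp only [normalField, grad, ht])] at h1
    linarith
  rw [eq_incl_add v, eq_incl_add w]
  simp only [covForm_add_left, covForm_add_right, covForm_smul_left, covForm_smul_right, hpp, h22,
    hmixed, smul_eq_mul]
  ring

end NormalField

/-! ### From a transversal surface to two Killing fields -/

section KillingDecomposition

variable {M : Type*} [TopologicalSpace M] [ChartedSpace E3 M] [IsManifold (𝓡 3) ∞ M]
  [RiemannianBundle (fun x : M => TangentSpace (𝓡 3) x)]
  [IsContMDiffRiemannianBundle (𝓡 3) ∞ E3 (fun x : M => TangentSpace (𝓡 3) x)]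
  {ξ : Π x : M, TangentSpace (𝓡 3) x}

/-- The translates of the surface under the flow of `ξ` are totally geodesic, and `ξ` is split into
its parts tangent and normal to them. The normal part is Killing by `covForm_normalField_skew`,
hence so is the difference. -/
theorem hasKillingDecompositionAt_of_surface (hξ : IsKillingOn ξ univ) (hunit : ∀ x, ‖ξ x‖ = 1)
    {S : Surface} {f : S → M} (hf : IsTotallyGeodesic f) {q : S} (hO : ¬ OrthogonalAt f ξ q)
    (hT : ¬ TangentAt f ξ q) : HasKillingDecompositionAt ξ (f q) := by
  obtain ⟨e, he, ε, hε, ht, hq, hq0, hX, hpl⟩ := exists_chart_of_transversal hf.1 hf.2.1 hξ.1 hT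
  have hev : ∀ u ∈ Metric.ball (0 : E3) ε, ∀ᶠ y in 𝓝 u, comps e ξ y = basisVec 2 := fun u hu => by
    filter_upwards [Metric.isOpen_ball.mem_nhds hu] with y hy using hX y hy
  have hinv : ∀ u ∈ Metric.ball (0 : E3) ε, fderiv ℝ (coordMetric e) u (basisVec 2) = 0 :=
    fun u hu => hξ.fderiv_coordMetric_eq_zero isOpen_univ he (ht ▸ hu) (mem_univ _) (hev u hu)
  have hpos : ∀ u ∈ Metric.ball (0 : E3) ε, ∀ v, v ≠ 0 → 0 < coordMetric e u v v :=
    fun u hu v hv => coordMetric_pos he (ht ▸ hu) hv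
  have hII : ∀ u ∈ Metric.ball (0 : E3) ε, ∀ v w, covForm (coordMetric e) (fun _ => incl w) u
      (incl v) (grad (coordMetric e) u) = 0 := by
    intro u hu v w
    have hu' : incl (planeProj u) ∈ Metric.ball (0 : E3) ε := by
      rw [mem_ball_zero_iff] at hu ⊢
      exact (norm_incl_planeProj_le u).trans_lt hu
    have h1 := coordMetric_translate he ht hinv hu' (t := u 2) (by rwa [← eq_incl_add])
    rw [← eq_incl_add] at h1
    have h2 := covForm_incl_eq_zero he ht hf.1 hpl hf (incl_mem_ball.1 hu') v w
      (metric_grad_incl (hpos _ hu'))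
    rw [covForm_const] at h2 ⊢
    rw [grad, h1.1, h1.2]
    exact h2
  set N := normalField (coordMetric e) with hN
  have hNs : ∀ u ∈ Metric.ball (0 : E3) ε, ContDiffAt ℝ ∞ N u := fun u hu =>
    contDiffAt_normalField (hpos u hu) (contDiffAt_coordMetric he (ht ▸ hu))
  have hline : ∀ u ∈ Metric.ball (0 : E3) ε, ∀ᶠ t in 𝓝 (0 : ℝ),
      coordMetric e (u + t • basisVec 2) = coordMetric e u := fun u hu => by
    filter_upwards [eventually_line_mem Metric.isOpen_ball hu (basisVec 2)] with t htu
    exact (coordMetric_translate he ht hinv hu htu).1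
  have hskew : ∀ u ∈ Metric.ball (0 : E3) ε, ∀ v w, covForm (coordMetric e) N u v w =
      - covForm (coordMetric e) N u w v := fun u hu =>
    covForm_normalField_skew
      (by filter_upwards [Metric.isOpen_ball.mem_nhds hu] with y hy using hpos y hy)
      (contDiffAt_coordMetric he (ht ▸ hu)) (eventually_coordMetric_symm u) (hline u hu)
      (fun w => by
        rw [← covForm_congr (hev u hu)]
        have := covForm_unit_left hξ hunit he (ht ▸ hu : u ∈ e.target) w
        rwa [hX u hu] at this)
      (hII u hu)
  have hsmooth : ∀ {v : E3 → E3}, (∀ u ∈ Metric.ball (0 : E3) ε, ContDiffAt ℝ ∞ v u) →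
      SmoothFieldOn (ofComps e v) e.source := fun hv =>
    smoothFieldOn_of_smoothFieldAt fun x hx => by
      have := smoothFieldAt_ofComps he (e.map_source hx) (hv _ (ht ▸ e.map_source hx))
      rwa [e.left_inv hx] at this
  have hcomps : ∀ (v : E3 → E3), ∀ u ∈ e.target, comps e (ofComps e v) =ᶠ[𝓝 u] v := fun v u hu => by
    filter_upwards [e.open_target.mem_nhds hu] with y hy using comps_ofComps he hy v
  have hKill : ∀ {v : E3 → E3}, (∀ u ∈ Metric.ball (0 : E3) ε, ContDiffAt ℝ ∞ v u) →
      (∀ u ∈ Metric.ball (0 : E3) ε, ∀ a b, covForm (coordMetric e) v u a b =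
        - covForm (coordMetric e) v u b a) → IsKillingOn (ofComps e v) e.source := fun hv hsk =>
    isKillingOn_of_covForm_skew he (hsmooth hv) fun u hu a b => by
      rw [covForm_congr (hcomps _ u hu), covForm_congr (hcomps _ u hu), hsk u (ht ▸ hu)]
  let A : E3 → E3 := fun u => basisVec 2 - N u
  have hAs : ∀ u ∈ Metric.ball (0 : E3) ε, ContDiffAt ℝ ∞ A u := fun u hu =>
    contDiffAt_const.sub (hNs u hu)
  have hKN := hKill hNs hskew
  have hKA : IsKillingOn (ofComps e A) e.source := hKill hAs fun u hu a b => by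
    have hd := (hNs u hu).differentiableAt (by simp)
    have h1 := hξ.covForm_skew isOpen_univ he (ht ▸ hu : u ∈ e.target) (mem_univ _) a b
    rw [covForm_congr (hev u hu), covForm_congr (hev u hu)] at h1
    rw [covForm_sub (differentiableAt_const _) hd, covForm_sub (differentiableAt_const _) hd, h1,
      hskew u hu a b]
    ring
  have h0 : (0 : E3) ∈ Metric.ball (0 : E3) ε := Metric.mem_ball_self hε
  -- If the tangential part vanished at `q`, then `ξ` would be orthogonal to the surface there. By
  -- continuity it has no zeros nearby.
  have hA0 : A 0 ≠ 0 := by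
    intro h
    have h1 : basisVec 2 = N 0 := sub_eq_zero.1 h
    refine hO ?_
    have h2 := (orthogonalAt_iff he ht hf.1 hpl (c := 0) (Metric.mem_ball_self hε) (ξ := ξ)).2
      (fun w => by
        rw [map_zero, hX 0 h0, h1, hN, metric_normalField (hpos 0 h0), incl_apply_two, mul_zero])
    rwa [localParam_zero] at h2
  obtain ⟨r, hr, hrA⟩ := Metric.eventually_nhds_iff_ball.1
    ((hAs 0 h0).continuousAt.eventually_ne hA0)
  refine ⟨e.source ∩ e ⁻¹' Metric.ball 0 r, ofComps e A, ofComps e N,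
    e.isOpen_inter_preimage Metric.isOpen_ball, ⟨hq, ?_⟩, hKA.mono inter_subset_left,
    hKN.mono inter_subset_left, fun x hx => ?_⟩
  · rw [mem_preimage, hq0]
    exact Metric.mem_ball_self hr
  obtain ⟨hx, hxr⟩ := hx
  obtain ⟨u, hu, rfl⟩ : ∃ u ∈ e.target, e.symm u = x := ⟨e x, e.map_source hx, e.left_inv hx⟩
  have hub : u ∈ Metric.ball (0 : E3) ε := ht ▸ hu
  rw [mem_preimage, e.right_inv hu] at hxr
  have hne : ∀ {v : E3 → E3}, v u ≠ 0 → ofComps e v (e.symm u) ≠ 0 := fun {v} hv h => by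
    rw [← frame_eq_ofComps he hu] at h
    exact hv (frame_injective he hu (h.trans (map_zero _).symm))
  refine ⟨?_, ?_, hne (hrA u hxr), hne (normalField_ne_zero (hpos u hub)), ?_⟩
  · rw [← frame_eq_ofComps he hu, ← frame_eq_ofComps he hu, ← map_add, sub_add_cancel, ← hX u hub,
      frame_comps he hu]
  · rw [← frame_eq_ofComps he hu, ← frame_eq_ofComps he hu, ← coordMetric_apply, coordMetric_symm,
      hN, metric_normalField (hpos u hub), PiLp.sub_apply, hN, normalField_apply_two (hpos u hub)]
    simp
  · have h1 := comps_mlieBracket he hu (smoothFieldAt_ofComps he hu (hAs u hub))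
      (smoothFieldAt_ofComps he hu (hNs u hub))
    rw [← frame_comps he hu (mlieBracket (𝓡 3) _ _), h1, (hcomps A u hu).fderiv_eq,
      (hcomps N u hu).fderiv_eq,
      (hcomps A u hu).self_of_nhds, (hcomps N u hu).self_of_nhds]
    have hd := (hNs u hub).differentiableAt (n := ∞) (by simp)
    have h2 : fderiv ℝ A u = - fderiv ℝ N u := by
      have : HasFDerivAt A (0 - fderiv ℝ N u) u := (hasFDerivAt_const _ u).sub hd.hasFDerivAt
      rw [this.fderiv, zero_sub]
    -- The bracket of `∂₂ - N` and `N` is that of `∂₂` and `N`, and `N` is built from the invariant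
    -- metric.
    have h3 : fderiv ℝ N u (basisVec 2) = 0 := fderiv_apply_eq_zero_of_line hd
      ((hline u hub).mono fun t h => by simp only [hN, normalField, grad, h])
    rw [h2, _root_.neg_apply, sub_neg_eq_add, ← map_add, sub_add_cancel, h3, map_zero]

end KillingDecomposition

/-! ### Orthogonal frames and brackets -/

section OrthogonalFrame

variable {G : E3 → E3 →L[ℝ] E3 →L[ℝ] ℝ} {u : E3}

/-- The linear map sending the standard basis to `a`, `b`, `c`. -/
def frameMap (a b c : E3) : E3 →L[ℝ] E3 :=
  (EuclideanSpace.proj (𝕜 := ℝ) (0 : Fin 3)).smulRight a +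
    (EuclideanSpace.proj (𝕜 := ℝ) (1 : Fin 3)).smulRight b +
    (EuclideanSpace.proj (𝕜 := ℝ) (2 : Fin 3)).smulRight c

theorem frameMap_apply (a b c v : E3) : frameMap a b c v = v 0 • a + v 1 • b + v 2 • c := rfl

theorem metric_frameMap (hs : ∀ v w, G u v w = G u w v) {a b c : E3} (hab : G u a b = 0)
    (hac : G u a c = 0) (hbc : G u b c = 0) (v w : E3) :
    G u (frameMap a b c v) (frameMap a b c w) =
      G u a a * (v 0 * w 0) + G u b b * (v 1 * w 1) + G u c c * (v 2 * w 2) := by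
  simp only [frameMap_apply, map_add, map_smul, _root_.add_apply, _root_.smul_apply, smul_eq_mul,
    hab, hac, hbc, hs b a, hs c a, hs c b]
  ring

theorem isInvertible_frameMap (hpos : ∀ v, v ≠ 0 → 0 < G u v v) (hs : ∀ v w, G u v w = G u w v)
    {a b c : E3} (ha : a ≠ 0) (hb : b ≠ 0) (hc : c ≠ 0) (hab : G u a b = 0) (hac : G u a c = 0)
    (hbc : G u b c = 0) : (frameMap a b c).IsInvertible := by
  refine isInvertible_of_injective _ ((injective_iff_map_eq_zero _).2 fun v hv => ?_) rfl
  have h : ∀ w : E3,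
      G u a a * (v 0 * w 0) + G u b b * (v 1 * w 1) + G u c c * (v 2 * w 2) = 0 := fun w => by
    rw [← metric_frameMap hs hab hac hbc, hv, map_zero, _root_.zero_apply]
  ext i
  fin_cases i
  · simpa [(hpos a ha).ne'] using h (basisVec 0)
  · simpa [(hpos b hb).ne'] using h (basisVec 1)
  · simpa [(hpos c hc).ne'] using h (basisVec 2)

/-- A vector orthogonal to an orthogonal frame vanishes. -/
theorem eq_zero_of_metric_eq_zero (hpos : ∀ v, v ≠ 0 → 0 < G u v v)
    (hs : ∀ v w, G u v w = G u w v) {a b c : E3} (ha : a ≠ 0) (hb : b ≠ 0) (hc : c ≠ 0)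
    (hab : G u a b = 0) (hac : G u a c = 0) (hbc : G u b c = 0) {z : E3} (hza : G u z a = 0)
    (hzb : G u z b = 0) (hzc : G u z c = 0) : z = 0 := by
  obtain ⟨L, hL⟩ := isInvertible_frameMap hpos hs ha hb hc hab hac hbc
  obtain ⟨v, hv⟩ := L.surjective z
  have h1 : frameMap a b c v = z := by rw [← hL]; exact hv
  by_contra hz
  refine (hpos z hz).ne' ?_
  nth_rewrite 2 [← h1]
  simp only [frameMap_apply, map_add, map_smul, hza, hzb, hzc, smul_zero, add_zero]

/-- A unit field orthogonal to two orthogonal fields without zeros. -/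
theorem exists_unit_orthogonal_to_pair {A B : E3 → E3} {x₀ : E3}
    (hG : ∀ᶠ u in 𝓝 x₀, ContDiffAt ℝ ∞ G u) (hA : ∀ᶠ u in 𝓝 x₀, ContDiffAt ℝ ∞ A u)
    (hB : ∀ᶠ u in 𝓝 x₀, ContDiffAt ℝ ∞ B u) (hpos : ∀ᶠ u in 𝓝 x₀, ∀ v, v ≠ 0 → 0 < G u v v)
    (hs : ∀ u v w, G u v w = G u w v) (hA0 : ∀ᶠ u in 𝓝 x₀, A u ≠ 0) (hB0 : ∀ᶠ u in 𝓝 x₀, B u ≠ 0)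
    (hAB : ∀ᶠ u in 𝓝 x₀, G u (A u) (B u) = 0) :
    ∃ E : E3 → E3, ∀ᶠ u in 𝓝 x₀, ContDiffAt ℝ ∞ E u ∧ G u (E u) (E u) = 1 ∧
      G u (E u) (A u) = 0 ∧ G u (E u) (B u) = 0 := by
  obtain ⟨z, hz⟩ := exists_notMem_span_pair (A x₀) (B x₀)
  -- Gram–Schmidt applied to a vector outside the span of `A x₀` and `B x₀`.
  let Z : E3 → E3 := fun u =>
    z - ((G u z (A u) / G u (A u) (A u)) • A u + (G u z (B u) / G u (B u) (B u)) • B u)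
  let n : E3 → ℝ := fun u => G u (Z u) (Z u)
  have hZs : ∀ᶠ u in 𝓝 x₀, ContDiffAt ℝ ∞ Z u := by
    filter_upwards [hG, hA, hB, hpos, hA0, hB0] with u h1 h2 h3 h4 h5 h6
    have hz := h1.clm_apply (contDiffAt_const (c := z))
    exact contDiffAt_const.sub
      ((((hz.clm_apply h2).div ((h1.clm_apply h2).clm_apply h2) (h4 _ h5).ne').smul h2).add
        (((hz.clm_apply h3).div ((h1.clm_apply h3).clm_apply h3) (h4 _ h6).ne').smul h3))
  have hns : ∀ᶠ u in 𝓝 x₀, ContDiffAt ℝ ∞ n u := by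
    filter_upwards [hG, hZs] with u h1 h2
    exact (h1.clm_apply h2).clm_apply h2
  have hn0 : 0 < n x₀ := hpos.self_of_nhds _ fun h => hz _ _ (sub_eq_zero.1 h).symm
  have hn : ∀ᶠ u in 𝓝 x₀, 0 < n u := hns.self_of_nhds.continuousAt.eventually (lt_mem_nhds hn0)
  refine ⟨fun u => (Real.sqrt (n u))⁻¹ • Z u, ?_⟩
  filter_upwards [hZs, hns, hn, hpos, hA0, hB0, hAB] with u h1 h2 h3 h4 hA0 hB0 hAB
  have hBA : G u (B u) (A u) = 0 := by rw [hs, hAB]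
  refine ⟨((h2.sqrt h3.ne').inv (Real.sqrt_pos.2 h3).ne').smul h1, ?_, ?_, ?_⟩
  · simp only [map_smul, _root_.smul_apply, smul_eq_mul]
    have h5 := Real.sq_sqrt h3.le
    have h6 := (Real.sqrt_pos.2 h3).ne'
    change (√(n u))⁻¹ * ((√(n u))⁻¹ * n u) = 1
    field_simp
    exact h5.symm
  · simp only [map_smul, _root_.smul_apply, smul_eq_mul, Z, map_sub, map_add, _root_.sub_apply,
      _root_.add_apply, hBA, div_mul_cancel₀ _ (h4 _ hA0).ne']
    ring
  · simp only [map_smul, _root_.smul_apply, smul_eq_mul, Z, map_sub, map_add, _root_.sub_apply,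
      _root_.add_apply, hAB, div_mul_cancel₀ _ (h4 _ hB0).ne']
    ring

/-- The bracket of vector fields on coordinate space. -/
def bracket (A Y : E3 → E3) (u : E3) : E3 := fderiv ℝ Y u (A u) - fderiv ℝ A u (Y u)

/-- The flow of a Killing field preserves the metric, infinitesimally. -/
theorem fderiv_metric_apply_of_killing {A Y Z : E3 → E3} (hG : DifferentiableAt ℝ G u)
    (hY : DifferentiableAt ℝ Y u) (hZ : DifferentiableAt ℝ Z u)
    (hK : ∀ v w, fderiv ℝ G u (A u) v w + G u (fderiv ℝ A u v) w + G u v (fderiv ℝ A u w) = 0) :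
    fderiv ℝ (fun y => G y (Y y) (Z y)) u (A u) =
      G u (bracket A Y u) (Z u) + G u (Y u) (bracket A Z u) := by
  have h := ((hG.hasFDerivAt.clm_apply hY.hasFDerivAt).clm_apply hZ.hasFDerivAt).fderiv
  rw [h]
  have h1 := hK (Y u) (Z u)
  simp only [_root_.add_apply, ContinuousLinearMap.comp_apply, ContinuousLinearMap.flip_apply,
    bracket, map_sub, _root_.sub_apply]
  linarith

/-- A Killing field commutes with the unit normal of a pair of orthogonal fields commuting
with it. -/
theorem bracket_eq_zero {A B E X : E3 → E3} (hpos : ∀ v, v ≠ 0 → 0 < G u v v)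
    (hs : ∀ v w, G u v w = G u w v) (hG : DifferentiableAt ℝ G u) (hA : DifferentiableAt ℝ A u)
    (hB : DifferentiableAt ℝ B u) (hE : DifferentiableAt ℝ E u) (hA0 : A u ≠ 0) (hB0 : B u ≠ 0)
    (hAB : G u (A u) (B u) = 0) (hEE : ∀ᶠ y in 𝓝 u, G y (E y) (E y) = 1)
    (hEA : ∀ᶠ y in 𝓝 u, G y (E y) (A y) = 0) (hEB : ∀ᶠ y in 𝓝 u, G y (E y) (B y) = 0)
    (hK : ∀ v w, fderiv ℝ G u (X u) v w + G u (fderiv ℝ X u v) w + G u v (fderiv ℝ X u w) = 0)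
    (hXA : bracket X A u = 0) (hXB : bracket X B u = 0) : bracket X E u = 0 := by
  have hE0 : E u ≠ 0 := fun h => by
    have := hEE.self_of_nhds
    rw [h, map_zero] at this
    simp at this
  have hd : ∀ {h : E3 → ℝ} {k : ℝ}, (∀ᶠ y in 𝓝 u, h y = k) → fderiv ℝ h u (X u) = 0 := by
    intro h k hk
    rw [Filter.EventuallyEq.fderiv_eq hk, fderiv_const_apply, _root_.zero_apply]
  -- Differentiating the constant products of `E` with `E`, `A` and `B` along `X` shows that `[X,
  -- E]` is orthogonal to the whole frame.
  have h1 := fderiv_metric_apply_of_killing hG hE hE hK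
  have h2 := fderiv_metric_apply_of_killing hG hE hA hK
  have h3 := fderiv_metric_apply_of_killing hG hE hB hK
  rw [hd hEE, hs (E u)] at h1
  rw [hd hEA, hXA, map_zero, add_zero] at h2
  rw [hd hEB, hXB, map_zero, add_zero] at h3
  exact eq_zero_of_metric_eq_zero hpos hs hE0 hA0 hB0 hEA.self_of_nhds hEB.self_of_nhds hAB
    (by linarith) h2.symm h3.symm

theorem bracket_self (A : E3 → E3) : bracket A A u = 0 := sub_self _

theorem bracket_swap (A B : E3 → E3) : bracket A B u = - bracket B A u := (neg_sub _ _).symm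

theorem contDiffAt_frameMap {E A B : E3 → E3} (hE : ContDiffAt ℝ ∞ E u) (hA : ContDiffAt ℝ ∞ A u)
    (hB : ContDiffAt ℝ ∞ B u) : ContDiffAt ℝ ∞ (fun y => frameMap (E y) (A y) (B y)) u :=
  ((contDiffAt_const.smulRight hE).add (contDiffAt_const.smulRight hA)).add
    (contDiffAt_const.smulRight hB)

/-- Vanishing of the pairwise brackets, in the form required by
`exists_coordinates_of_commuting_frame`. -/
theorem fderiv_frameMap_comm {E A B : E3 → E3} (hE : DifferentiableAt ℝ E u)
    (hA : DifferentiableAt ℝ A u) (hB : DifferentiableAt ℝ B u)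
    (hF : DifferentiableAt ℝ (fun y => frameMap (E y) (A y) (B y)) u)
    (hEA : bracket A E u = 0) (hEB : bracket B E u = 0) (hAB : bracket A B u = 0) (c d : E3) :
    fderiv ℝ (fun y => frameMap (E y) (A y) (B y)) u (frameMap (E u) (A u) (B u) c) d =
      fderiv ℝ (fun y => frameMap (E y) (A y) (B y)) u (frameMap (E u) (A u) (B u) d) c := by
  have key : ∀ w d, fderiv ℝ (fun y => frameMap (E y) (A y) (B y)) u w d =
      d 0 • fderiv ℝ E u w + d 1 • fderiv ℝ A u w + d 2 • fderiv ℝ B u w := by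
    intro w d
    have h1 := hF.hasFDerivAt.clm_apply (hasFDerivAt_const d u)
    have h2 : HasFDerivAt (fun y => frameMap (E y) (A y) (B y) d)
        (d 0 • fderiv ℝ E u + d 1 • fderiv ℝ A u + d 2 • fderiv ℝ B u) u :=
      ((hE.hasFDerivAt.const_smul (d 0)).add (hA.hasFDerivAt.const_smul (d 1))).add
        (hB.hasFDerivAt.const_smul (d 2))
    have h3 := congrArg (fun L : E3 →L[ℝ] E3 => L w) (h1.unique h2)
    simpa using h3
  have h1 := sub_eq_zero.1 hEA
  have h2 := sub_eq_zero.1 hEB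
  have h3 := sub_eq_zero.1 hAB
  rw [key, key, frameMap_apply, frameMap_apply]
  simp only [map_add, map_smul, h1, h2, h3, smul_add, smul_smul]
  module

end OrthogonalFrame

/-! ### From two Killing fields to adapted coordinates -/

section KillingPair

variable {M : Type*} [TopologicalSpace M] [ChartedSpace E3 M] [IsManifold (𝓡 3) ∞ M]
  [RiemannianBundle (fun x : M => TangentSpace (𝓡 3) x)]
  [IsContMDiffRiemannianBundle (𝓡 3) ∞ E3 (fun x : M => TangentSpace (𝓡 3) x)]
  {ξ : Π x : M, TangentSpace (𝓡 3) x}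

set_option maxHeartbeats 400000 in
/-- Two commuting orthogonal Killing fields without zeros are coordinate fields of orthogonal
coordinates, completed by a unit field. -/
theorem exists_chart_of_killing_pair {U : Set M} {X₁ X₂ : Π x : M, TangentSpace (𝓡 3) x}
    (hU : IsOpen U) {p : M} (hp : p ∈ U) (hX₁ : IsKillingOn X₁ U) (hX₂ : IsKillingOn X₂ U)
    (h : ∀ x ∈ U, inner ℝ (X₁ x) (X₂ x) = (0 : ℝ) ∧ X₁ x ≠ 0 ∧ X₂ x ≠ 0 ∧
      mlieBracket (𝓡 3) X₁ X₂ x = 0) :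
    ∃ e ∈ IsManifold.maximalAtlas (𝓡 3) ∞ M, ∃ ε > 0, e.target = Metric.ball 0 ε ∧ p ∈ e.source ∧
      ∀ u ∈ Metric.ball (0 : E3) ε, e.symm u ∈ U ∧ comps e X₁ u = basisVec 1 ∧
        comps e X₂ u = basisVec 2 ∧ ∀ v w, coordMetric e u v w = v 0 * w 0 +
          coordMetric e u (basisVec 1) (basisVec 1) * (v 1 * w 1) +
          coordMetric e u (basisVec 2) (basisVec 2) * (v 2 * w 2) := by
  have he₀ : chartAt E3 p ∈ IsManifold.maximalAtlas (𝓡 3) ∞ M :=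
    IsManifold.chart_mem_maximalAtlas _
  set e₀ := chartAt E3 p
  have hp₀ : p ∈ e₀.source := mem_chart_source _ _
  set x₀ := e₀ p
  have hO : ∀ᶠ u in 𝓝 x₀, u ∈ e₀.target ∧ e₀.symm u ∈ U := by
    refine (e₀.open_target.eventually_mem (e₀.map_source hp₀)).and ?_
    refine (e₀.continuousAt_symm (e₀.map_source hp₀)).eventually (hU.mem_nhds ?_)
    rwa [e₀.left_inv hp₀]
  set G := coordMetric (M := M) e₀ with hGdef
  set A := comps e₀ X₁ with hA
  set B := comps e₀ X₂ with hB
  have hsym : ∀ u v w, G u v w = G u w v := fun u => coordMetric_symm u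
  have hpos : ∀ u ∈ e₀.target, ∀ v, v ≠ 0 → 0 < G u v v := fun u hu v hv =>
    coordMetric_pos he₀ hu hv
  have hne : ∀ {X : Π x : M, TangentSpace (𝓡 3) x} {u : E3}, u ∈ e₀.target → X (e₀.symm u) ≠ 0 →
      comps e₀ X u ≠ 0 := fun {X} _ hu hX h0 => hX (by rw [← frame_comps he₀ hu X, h0, map_zero])
  have hdata : ∀ u, u ∈ e₀.target ∧ e₀.symm u ∈ U → ContDiffAt ℝ ∞ A u ∧ ContDiffAt ℝ ∞ B u ∧
      A u ≠ 0 ∧ B u ≠ 0 ∧ G u (A u) (B u) = 0 ∧ bracket A B u = 0 := by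
    rintro u ⟨hu, huU⟩
    obtain ⟨h1, h2, h3, h4⟩ := h _ huU
    have hs1 := hX₁.1.smoothFieldAt hU huU
    have hs2 := hX₂.1.smoothFieldAt hU huU
    refine ⟨contDiffAt_comps he₀ hu hs1, contDiffAt_comps he₀ hu hs2, hne hu h2, hne hu h3, ?_, ?_⟩
    · rw [hGdef, hA, hB, ← inner_eq_coordMetric he₀ hu, h1]
    · have h5 := comps_mlieBracket he₀ hu hs1 hs2
      rw [bracket, ← h5]
      exact comps_eq_of_frame_eq he₀ hu ((map_zero _).trans h4.symm)
  obtain ⟨E, hE⟩ := exists_unit_orthogonal_to_pair (G := G) (A := A) (B := B) (x₀ := x₀)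
    (hO.mono fun u hu => contDiffAt_coordMetric he₀ hu.1) (hO.mono fun u hu => (hdata u hu).1)
    (hO.mono fun u hu => (hdata u hu).2.1) (hO.mono fun u hu => hpos u hu.1) hsym
    (hO.mono fun u hu => (hdata u hu).2.2.1) (hO.mono fun u hu => (hdata u hu).2.2.2.1)
    (hO.mono fun u hu => (hdata u hu).2.2.2.2.1)
  obtain ⟨r, hr, hball⟩ := Metric.eventually_nhds_iff_ball.1 (hO.and hE)
  let Φ : E3 → E3 →L[ℝ] E3 := fun u => frameMap (E u) (A u) (B u)
  have hE0 : ∀ u ∈ Metric.ball x₀ r, E u ≠ 0 := fun u hu h0 => by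
    have := (hball u hu).2.2.1
    rw [h0, map_zero] at this
    simp at this
  have hΦs : ContDiffOn ℝ ∞ Φ (Metric.ball x₀ r) := by
    intro u hu
    obtain ⟨h1, h2⟩ := hball u hu
    exact (contDiffAt_frameMap h2.1 (hdata u h1).1 (hdata u h1).2.1).contDiffWithinAt
  have hinv : ∀ u ∈ Metric.ball x₀ r, (Φ u).IsInvertible := by
    intro u hu
    obtain ⟨h1, -, -, h2, h3⟩ := hball u hu
    obtain ⟨-, -, h4, h5, h6, -⟩ := hdata u h1
    exact isInvertible_frameMap (hpos u h1.1) (hsym u) (hE0 u hu) h4 h5 h2 h3 h6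
  have hcomm : ∀ x ∈ Metric.ball x₀ r, ∀ c d,
      fderiv ℝ Φ x (Φ x c) d = fderiv ℝ Φ x (Φ x d) c := by
    intro x hx c d
    have hnhds := Metric.isOpen_ball.mem_nhds hx
    obtain ⟨h1, h2, -⟩ := hball x hx
    obtain ⟨hAs, hBs, hA0, hB0, hAB, hbr⟩ := hdata x h1
    have hEE : ∀ᶠ y in 𝓝 x, G y (E y) (E y) = 1 := by
      filter_upwards [hnhds] with y hy using (hball y hy).2.2.1
    have hEA : ∀ᶠ y in 𝓝 x, G y (E y) (A y) = 0 := by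
      filter_upwards [hnhds] with y hy using (hball y hy).2.2.2.1
    have hEB : ∀ᶠ y in 𝓝 x, G y (E y) (B y) = 0 := by
      filter_upwards [hnhds] with y hy using (hball y hy).2.2.2.2
    have hAd := hAs.differentiableAt (by simp)
    have hBd := hBs.differentiableAt (by simp)
    have hEd := h2.differentiableAt (by simp)
    have hGd : DifferentiableAt ℝ G x := differentiableAt_coordMetric he₀ h1.1
    refine fderiv_frameMap_comm hEd hAd hBd ((hΦs.contDiffAt hnhds).differentiableAt (by simp))
      ?_ ?_ hbr c d
    · exact bracket_eq_zero (hpos x h1.1) (hsym x) hGd hAd hBd hEd hA0 hB0 hAB hEE hEA hEB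
        (hX₁.add_swap_eq_zero hU he₀ h1.1 h1.2) (bracket_self A) hbr
    · exact bracket_eq_zero (hpos x h1.1) (hsym x) hGd hAd hBd hEd hA0 hB0 hAB hEE hEA hEB
        (hX₂.add_swap_eq_zero hU he₀ h1.1 h1.2) (by rw [bracket_swap, hbr, neg_zero])
        (bracket_self B)
  obtain ⟨F, hFs, hF0, hFd⟩ := exists_coordinates_of_commuting_frame Φ x₀
    (Metric.ball_mem_nhds x₀ hr) hΦs (hinv x₀ (Metric.mem_ball_self hr)) hcomm
  have hFb : ∀ᶠ y in 𝓝 0, F y ∈ Metric.ball x₀ r := by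
    refine hFs.self_of_nhds.continuousAt.eventually ?_
    rw [hF0]
    exact Metric.ball_mem_nhds x₀ hr
  obtain ⟨e, he, ε, hε, ht, hW, hpe, -, hs⟩ := exists_chart he₀ hp₀ hFs hF0
    (by
      rw [hFd.self_of_nhds.fderiv, hF0]
      exact hinv x₀ (Metric.mem_ball_self hr)) (hFd.and hFb)
  refine ⟨e, he, ε, hε, ht, hpe, fun u hu => ?_⟩
  obtain ⟨hd, hb⟩ := hW hu
  obtain ⟨⟨ht₀, huU⟩, -, hEE, hEA, hEB⟩ := hball _ hb
  obtain ⟨-, -, -, -, hAB, -⟩ := hdata _ ⟨ht₀, huU⟩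
  have hev : ∀ᶠ y in 𝓝 u, e.symm y = e₀.symm (F y) := by
    filter_upwards [Metric.isOpen_ball.mem_nhds hu] with y hy using (hs y hy).2.2
  have hut : u ∈ e.target := ht ▸ hu
  have hmet : ∀ v w, coordMetric e u v w = v 0 * w 0 + G (F u) (A (F u)) (A (F u)) * (v 1 * w 1) +
      G (F u) (B (F u)) (B (F u)) * (v 2 * w 2) := by
    intro v w
    have h1 := metric_frameMap (G := G) (hsym (F u)) hEA hEB hAB v w
    rw [hEE, one_mul] at h1
    rw [← h1, coordMetric_apply]
    have hfr : ∀ v, (frame e u v : E3) = frame e₀ (F u) (Φ (F u) v) := fun v => by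
      have := frame_comp he₀ hd.differentiableAt ht₀ hev v
      rwa [hd.fderiv] at this
    exact inner_congr (hs u hu).2.2 (hfr v) (hfr w)
  refine ⟨by rw [(hs u hu).2.2]; exact huU, ?_, ?_, fun v w => ?_⟩
  · refine comps_of_fderiv_eq he he₀ hut hd.differentiableAt ht₀ hev ?_
    rw [hd.fderiv]
    simp [Φ, frameMap_apply, hA]
  · refine comps_of_fderiv_eq he he₀ hut hd.differentiableAt ht₀ hev ?_
    rw [hd.fderiv]
    simp [Φ, frameMap_apply, hB]
  · rw [hmet v w, hmet (basisVec 1), hmet (basisVec 2)]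
    simp

/-- In coordinates with `X₁ = ∂_y`, `X₂ = ∂_z`, the Killing equations leave coefficients depending
on `x` alone. Unit length of `ξ = ∂_y + ∂_z` makes the two coefficients sum to `1`. -/
theorem HasKillingDecompositionAt.hasAdaptedCoordinatesAt (hunit : ∀ x, ‖ξ x‖ = 1) {p : M}
    (h : HasKillingDecompositionAt ξ p) : HasAdaptedCoordinatesAt ξ p := by
  obtain ⟨U, X₁, X₂, hU, hp, hX₁, hX₂, hX⟩ := h
  obtain ⟨e, he, ε, hε, ht, hpe, hdata⟩ := exists_chart_of_killing_pair hU hp hX₁ hX₂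
    fun x hx => (hX x hx).2
  have hinv : ∀ i : Fin 3, i = 1 ∨ i = 2 → ∀ u ∈ Metric.ball (0 : E3) ε,
      fderiv ℝ (coordMetric e) u (basisVec i) = 0 := by
    rintro i (rfl | rfl) u hu
    · refine hX₁.fderiv_coordMetric_eq_zero hU he (ht ▸ hu) (hdata u hu).1 ?_
      filter_upwards [Metric.isOpen_ball.mem_nhds hu] with y hy using (hdata y hy).2.1
    · refine hX₂.fderiv_coordMetric_eq_zero hU he (ht ▸ hu) (hdata u hu).1 ?_
      filter_upwards [Metric.isOpen_ball.mem_nhds hu] with y hy using (hdata y hy).2.2.1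
  have haxis : ∀ u ∈ Metric.ball (0 : E3) ε, u 0 ∈ Ioo (-ε) ε := by
    intro u hu
    rw [mem_ball_zero_iff] at hu
    exact abs_lt.1 ((PiLp.norm_apply_le u 0).trans_lt hu)
  have hline : ∀ s ∈ Ioo (-ε) ε, s • basisVec 0 ∈ Metric.ball (0 : E3) ε := by
    intro s hs
    rw [mem_ball_zero_iff, norm_smul, norm_basisVec, mul_one, Real.norm_eq_abs]
    exact abs_lt.2 hs
  have hred : ∀ u ∈ Metric.ball (0 : E3) ε, coordMetric e u = coordMetric e (u 0 • basisVec 0) := by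
    intro u hu
    have h1 : incl (planeProj u) ∈ Metric.ball (0 : E3) ε := by
      rw [mem_ball_zero_iff] at hu ⊢
      exact (norm_incl_planeProj_le u).trans_lt hu
    have h2 := (coordMetric_translate he ht (hinv 2 (.inr rfl)) h1 (t := u 2)
      (by rwa [← eq_incl_add])).1
    have h3 := (coordMetric_translate he ht (hinv 1 (.inl rfl)) (hline _ (haxis u hu)) (t := u 1)
      (by rw [incl_apply] at h1; simpa using h1)).1
    rw [← eq_incl_add] at h2
    rw [h2, ← h3, incl_apply]
    simp
  let a : ℝ → ℝ := fun s => coordMetric e (s • basisVec 0) (basisVec 1) (basisVec 1)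
  have hb : ∀ i, basisVec i ≠ 0 := fun i h => by
    have := norm_basisVec i
    rw [h, norm_zero] at this
    exact zero_ne_one this
  have hξ : ∀ u ∈ Metric.ball (0 : E3) ε,
      ξ (e.symm u) = frame e u (basisVec 1) + frame e u (basisVec 2) := by
    intro u hu
    obtain ⟨h1, h2, h3, -⟩ := hdata u hu
    rw [(hX _ h1).1, ← h2, ← h3, frame_comps he (ht ▸ hu), frame_comps he (ht ▸ hu)]
  have hsum : ∀ s ∈ Ioo (-ε) ε,
      coordMetric e (s • basisVec 0) (basisVec 2) (basisVec 2) = 1 - a s := by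
    intro s hs
    have hu := hline s hs
    have h1 := coordMetric_unit hunit he (ht ▸ hu : s • basisVec 0 ∈ e.target)
    have h2 : comps e ξ (s • basisVec 0) = basisVec 1 + basisVec 2 :=
      comps_eq_of_frame_eq he (ht ▸ hu) (by rw [map_add, hξ _ hu])
    rw [h2, (hdata _ hu).2.2.2] at h1
    simp at h1
    linarith
  -- Both bounds are strict by positivity of the metric on `∂_y` and `∂_z`. This keeps away from the
  -- points where the square root and `arcsin` fail to be smooth.
  have ha : ∀ s ∈ Ioo (-ε) ε, 0 < a s ∧ a s < 1 := by
    intro s hs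
    have hu : s • basisVec 0 ∈ e.target := ht ▸ hline s hs
    have h1 := coordMetric_pos he hu (hb 2)
    rw [hsum s hs] at h1
    exact ⟨coordMetric_pos he hu (hb 1), by linarith⟩
  have has : ∀ s ∈ Ioo (-ε) ε, ContDiffAt ℝ ∞ a s := by
    intro s hs
    have h1 : ContDiffAt ℝ ∞ (coordMetric e) (s • basisVec 0) :=
      contDiffAt_coordMetric he (ht ▸ hline s hs)
    have h2 : ContDiffAt ℝ ∞ (fun s : ℝ => s • basisVec 0) s := contDiffAt_id.smul contDiffAt_const
    have h3 := ContDiffAt.comp (g := coordMetric e) (f := fun s : ℝ => s • basisVec 0) s h1 h2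
    exact (h3.clm_apply contDiffAt_const).clm_apply contDiffAt_const
  have hsq : ∀ s ∈ Ioo (-ε) ε, √(a s) < 1 := fun s hs => by
    rw [Real.sqrt_lt' one_pos, one_pow]
    exact (ha s hs).2
  have hsin : ∀ s ∈ Ioo (-ε) ε, Real.sin (Real.arcsin √(a s)) ^ 2 = a s := fun s hs => by
    rw [Real.sin_arcsin (by linarith [Real.sqrt_nonneg (a s)]) (hsq s hs).le,
      Real.sq_sqrt (ha s hs).1.le]
  refine ⟨e, he, fun s => Real.arcsin √(a s), hpe, ?_, fun u hu v w => ?_, fun u hu => ?_⟩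
  · rintro s ⟨u, hu, rfl⟩
    have hs := haxis u (ht ▸ hu)
    refine ContDiffAt.contDiffWithinAt ?_
    have h1 : √(a (u 0)) ≠ -1 := by linarith [Real.sqrt_nonneg (a (u 0))]
    exact ContDiffAt.comp (g := Real.arcsin) (f := fun s => √(a s)) (u 0)
      (Real.contDiffAt_arcsin h1 (hsq _ hs).ne) ((has _ hs).sqrt (ha _ hs).1.ne')
  · rw [ht] at hu
    have hs := haxis u hu
    have h1 := (hdata u hu).2.2.2 v w
    rw [coordMetric_apply, hred u hu, hsum _ hs] at h1
    rw [Real.cos_sq', hsin _ hs]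
    exact h1
  · exact hξ u (ht ▸ hu)

end KillingPair

end

end UnitKilling

theorem theorem2 {M : Type*} [TopologicalSpace M] [T2Space M] [SecondCountableTopology M]
    [ChartedSpace E3 M] [IsManifold (𝓡 3) ∞ M]
    [RiemannianBundle (fun x : M => TangentSpace (𝓡 3) x)]
    [IsContMDiffRiemannianBundle (𝓡 3) ∞ E3 (fun x : M => TangentSpace (𝓡 3) x)]
    (ξ : Π x : M, TangentSpace (𝓡 3) x) (hξ : IsKillingOn ξ univ) (hunit : ∀ x, ‖ξ x‖ = 1)
    (p : M) :
    ((∃ (S : Surface) (f : S → M) (q : S), IsTotallyGeodesic f ∧ f q = p ∧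
        ∀ r, OrthogonalAt f ξ r) ↔ IsLocalProductAt ξ p) ∧
    (∀ o : Π x : M, Orientation ℝ (TangentSpace (𝓡 3) x) (Fin 3),
      (∃! τ : M → ℝ, IsTau o ξ τ) ∧
      ∀ τ : M → ℝ, IsTau o ξ τ →
        ((∃ (S : Surface) (f : S → M) (q : S), IsTotallyGeodesic f ∧ f q = p ∧
            ∀ r, TangentAt f ξ r) ↔
          ∃ (γ : ℝ → M) (a b t₀ : ℝ), IsGeodesicOn γ a b ∧ t₀ ∈ Ioo a b ∧ γ t₀ = p ∧
            velocity γ t₀ ≠ 0 ∧ inner ℝ (velocity γ t₀) (ξ (γ t₀)) = 0 ∧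
            ∀ s ∈ Ioo a b, τ (γ s) = 0)) ∧
    [∃ (S : Surface) (f : S → M) (q : S), IsTotallyGeodesic f ∧ f q = p ∧
        ¬ OrthogonalAt f ξ q ∧ ¬ TangentAt f ξ q,
      HasKillingDecompositionAt ξ p,
      HasAdaptedCoordinatesAt ξ p].TFAE := by
  refine ⟨⟨?_, fun h => h.exists_orthogonal_surface hξ hunit⟩, fun o =>
    ⟨existsUnique_isTau hξ hunit o, fun τ hτ => ⟨?_, ?_⟩⟩, ?_⟩
  · rintro ⟨S, f, q, hf, rfl, horth⟩
    exact isLocalProductAt_of_orthogonal hξ hunit hf horth q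
  · rintro ⟨S, f, q, hf, rfl, htan⟩
    obtain ⟨γ, δ, hδ, hγ, hγ0, h⟩ := exists_geodesic_of_tangent hξ hunit hf htan q
    have h0 : (0 : ℝ) ∈ Ioo (-δ) δ := ⟨neg_neg_of_pos hδ, hδ⟩
    refine ⟨γ, -δ, δ, 0, hγ, h0, hγ0, (h 0 h0).1, (h 0 h0).2.1, fun s hs => ?_⟩
    exact hτ.eq_zero hunit (h s hs).1 (by rw [real_inner_comm]; exact (h s hs).2.1) (h s hs).2.2
  · rintro ⟨γ, a, b, t₀, hγ, ht₀, rfl, hv, horth, hτ0⟩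
    exact exists_tangent_surface_of_geodesic hξ hunit hγ ht₀ hv horth
      fun s hs v => hτ.nabla_eq_zero (hτ0 s hs) v
  · tfae_have 1 → 2
    | ⟨S, f, q, hf, hq, hO, hT⟩ => hq ▸ hasKillingDecompositionAt_of_surface hξ hunit hf hO hT
    tfae_have 2 → 3 := fun h => h.hasAdaptedCoordinatesAt hunit
    tfae_have 3 → 1 := fun h => h.exists_surface
    tfae_finish
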